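/- Let $p$ be a prime, $S$ a finite $p$-group, $\mathcal F$ a saturated fusion system over $S$, and $\mathcal R$ a $p$-local commutative ring (every prime other than $p$ is invertible in $\mathcal R$). **Notation.** A subgroup $K\le S$ is $\mathcal F$-centric ($K\in\mathcal F^c$) if $C_S(K')\le K'$ for every $K'$ that is $\mathcal F$-isomorphic to $K$. The orbit category $\mathcal O(\mathcal F^c)$ has the $\mathcal F$-centric subgroups as objects and $\mathrm{Hom}(A,K)=\mathrm{Inn}(K)\backslash\mathrm{Hom}_{\mathcal F}(A,K)$; $\overline\varphi$ is the class of $\varphi$. For $H,K\in\mathcal F^c$ preorder the pairs $(A,\overline\varphi)$ with $A\le H$ centric and $\overline\varphi\colon A\to K$ in $\mathcal O(\mathcal F^c)$ by $(A,\overline\varphi)\precsim(B,\overline\psi)$ iff for some $h\in H$ one has $A^h\le B$ and $\overline\varphi\,\overline{c_h}=\overline\psi\,\overline{\iota_{A^h}^B}$; $[H\times_{\mathcal F}K]$ denotes any set of representatives of the maximal pairs modulo the associated equivalence relation. The centric Burnside ring $B^{\mathcal F^c}_{\mathcal R}$ is the free $\mathcal R$-module on the isomorphism classes $\overline K$ of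 objects of $\mathcal O(\mathcal F^c)$ with product $\overline H\cdot\overline K=\sum_{(A,\overline\varphi)\in[H\times_{\mathcal F}K]}\overline A$. The Mackey algebra $\mu_{\mathcal R}(\mathcal F)$ is $\mathcal R\otimes_{\mathbb Z}$ the Grothendieck ring of the semiring of isomorphism classes of bisets generated by the restrictions $R_H^K$ and inductions $I_H^K$ ($H\le K\le S$) and the conjugations $c_\varphi$ ($\varphi$ an isomorphism of $\mathcal F$). A centric Mackey functor over $\mathcal F$ is a finitely generated left $\mu_{\mathcal R}(\mathcal F)$-module $M$ with $I_K^KM=0$ for all $K\notin\mathcal F^c$. For a fusion subsystem $\mathcal E\subseteq\mathcal F$ over $T\le S$, $M\downarrow_{\mathcal E}^{\mathcal F}$ is the $\mu_{\mathcal R}(\mathcal E)$-module $\sum_{K\le T}I_K^KM$, and $\mathrm r_{\mathcal E}^{\mathcal E'}$ denotes restriction of endomorphisms for $\mathcal E\subseteq\mathcal E'$. For $K\le S$ let $\mathcal F_K(K)$ be the fusion system of the group $K$. For $H\in\mathcal E^c$ and $f\in\mathrm{End}(M\downarrow_{\mathcal F_H(H)})$, the transfer $\mathrm{tr}_{\mathcal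 F_H(H)}^{\mathcal E}(f)\in\mathrm{End}(M\downarrow_{\mathcal E})$ is given on $x\in I_K^KM$, $K\in\mathcal E^c$, by $$\mathrm{tr}_{\mathcal F_H(H)}^{\mathcal E}(f)(x)=\sum_{(A,\overline\varphi)\in[H\times_{\mathcal E}K]}I_{\varphi(A)}^Kc_\varphi f\bigl(c_{\varphi^{-1}}R_{\varphi(A)}^Kx\bigr).$$ The ring $B^{\mathcal E^c}_{\mathcal R}$ acts on $M\downarrow_{\mathcal E}$, $\mathcal R$-linearly, by letting $\overline K$ act as $\mathrm{tr}_{\mathcal F_K(K)}^{\mathcal E}(\mathrm{Id})$. For an isomorphism $\varphi\colon A\to\varphi(A)$ of $\mathcal F$ and $f\in\mathrm{End}(M\downarrow_{\mathcal F_A(A)})$, ${}^{\varphi}f\in\mathrm{End}(M\downarrow_{\mathcal F_{\varphi(A)}(\varphi(A))})$ is $x\mapsto c_\varphi f(c_{\varphi^{-1}}x)$ for $x\in I_K^KM$, $K\le\varphi(A)$ centric. **Statement.** Let $H\le S$ be $\mathcal F$-centric and fully $\mathcal F$-normalized, $N_S=N_S(H)$, and let $N_{\mathcal F}=N_{\mathcal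 F}(H)$ be the fusion system over $N_S$ whose morphisms $A\to B$ are the $\varphi\in\mathrm{Hom}_{\mathcal F}(A,B)$ that extend to some $\hat\varphi\in\mathrm{Hom}_{\mathcal F}(AH,BH)$ with $\hat\varphi(H)=H$. Let $\mathcal Y$ be the set of $\mathcal F$-centric $K\le N_S$ with $K\ne H$ that are $\mathcal F$-isomorphic to a subgroup of $H$. Let $M$ be a centric Mackey functor over $\mathcal F$ on $\mathcal R$. Then $\overline{N_S}$ is invertible in $B^{N_{\mathcal F}^c}_{\mathcal R}$, and its inverse acts on $M\downarrow_{N_{\mathcal F}}^{\mathcal F}$ by an endomorphism $\overline{N_S}^{-1}\cdot$. Moreover, for every choice of $[H\times_{\mathcal F}N_S]$ and of a representative $\varphi$ of $\overline\varphi$ for each of its elements $(A,\overline\varphi)$, and for every $f\in\mathrm{End}(M\downarrow_{\mathcal F_H(H)}^{\mathcal F})$, put for $K\in\mathcal Y$ $$f_K:=\sum_{\substack{(A,\overline\varphi)\in[H\times_{\mathcal F}N_S]\\ \varphi(A)=K}}\mathrm r_{\mathcal F_K(K)}^{N_{\mathcal F}}\bigl(\overline{N_S}^{-1}\cdot\bigr)\;{}^{\varphi}\bigl(\mathrm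 r_{\mathcal F_A(A)}^{\mathcal F_H(H)}(f)\bigr).$$ Then $f_K\in\mathrm{End}(M\downarrow_{\mathcal F_K(K)}^{\mathcal F})$, the transfers below are endomorphisms of the respective Mackey functors, and $$\mathrm r_{N_{\mathcal F}}^{\mathcal F}\bigl(\mathrm{tr}_{\mathcal F_H(H)}^{\mathcal F}(f)\bigr)=\mathrm{tr}_{\mathcal F_H(H)}^{N_{\mathcal F}}(f)+\sum_{K\in\mathcal Y}\mathrm{tr}_{\mathcal F_K(K)}^{N_{\mathcal F}}(f_K).$$ -/

import Mathlib

open scoped TensorProduct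

universe u v w

namespace FusionMackey

/-! ## Bisets and the semiring of isomorphism classes of bisets -/

/-- A finite `(A, B)`-biset, written as a left `A × B`-set by `(a, b) • x = a · x · b⁻¹`. -/
structure FinBiset (A B : Type u) [Group A] [Group B] : Type (u + 1) where
  carrier : Type u
  [finite : Finite carrier]
  [action : MulAction (A × B) carrier]

attribute [instance] FinBiset.finite FinBiset.action

namespace FinBiset

variable {A B C D : Type u} [Group A] [Group B] [Group C] [Group D]

/-- Isomorphism of bisets. -/
def Iso (X Y : FinBiset A B) : Prop :=
  ∃ e : X.carrier ≃ Y.carrier, ∀ (g : A × B) (x : X.carrier), e (g • x) = g • e x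

instance isoSetoid (A B : Type u) [Group A] [Group B] : Setoid (FinBiset A B) where
  r := Iso
  iseqv :=
    { refl := fun _ => ⟨Equiv.refl _, fun _ _ => rfl⟩
      symm := by
        rintro X Y ⟨e, he⟩
        refine ⟨e.symm, fun g y => ?_⟩
        rw [Equiv.symm_apply_eq, he, Equiv.apply_symm_apply]
      trans := by
        rintro X Y Z ⟨e, he⟩ ⟨f, hf⟩
        exact ⟨e.trans f, fun g x => by simp [he, hf]⟩ }

/-- The empty biset. -/
def empty (A B : Type u) [Group A] [Group B] : FinBiset A B where
  carrier := PEmpty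
  action := { smul := fun _ x => x, one_smul := fun _ => rfl, mul_smul := fun _ _ _ => rfl }

/-- The disjoint union of two bisets. -/
def sum (X Y : FinBiset A B) : FinBiset A B where
  carrier := X.carrier ⊕ Y.carrier
  action :=
    { smul := fun g => Sum.map (g • ·) (g • ·)
      one_smul := by
        rintro (x | x)
        · exact congrArg Sum.inl (one_smul _ x)
        · exact congrArg Sum.inr (one_smul _ x)
      mul_smul := by
        rintro g h (x | x)
        · exact congrArg Sum.inl (mul_smul g h x)
        · exact congrArg Sum.inr (mul_smul g h x) }

/-- The relation `(x · b, y) ∼ (x, b · y)` defining `X ×_B Y`. -/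
instance compSetoid (X : FinBiset A B) (Y : FinBiset B C) :
    Setoid (X.carrier × Y.carrier) where
  r p q := ∃ b : B, q = (((1, b) : A × B) • p.1, ((b, 1) : B × C) • p.2)
  iseqv :=
    { refl := fun p => ⟨1, by
        have h1 : ((1, 1) : A × B) = 1 := rfl
        have h2 : ((1, 1) : B × C) = 1 := rfl
        rw [h1, h2, one_smul, one_smul]⟩
      symm := by
        rintro p q ⟨b, rfl⟩
        exact ⟨b⁻¹, by simp [smul_smul, ← Prod.one_eq_mk]⟩
      trans := by
        rintro p q r ⟨b, rfl⟩ ⟨c, rfl⟩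
        exact ⟨c * b, by simp [smul_smul]⟩ }

/-- The composition `X ×_B Y` of an `(A, B)`-biset and a `(B, C)`-biset. -/
def comp (X : FinBiset A B) (Y : FinBiset B C) : FinBiset A C where
  carrier := Quotient (compSetoid X Y)
  action :=
    { smul := fun g => Quotient.map
        (fun p => (((g.1, 1) : A × B) • p.1, ((1, g.2) : B × C) • p.2))
        (by
          rintro p q ⟨b, rfl⟩
          exact ⟨b, by simp [smul_smul]⟩)
      one_smul := by
        rintro ⟨x, y⟩
        exact congrArg (Quotient.mk _) (Prod.ext (one_smul (A × B) x) (one_smul (B × C) y))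
      mul_smul := by
        rintro g h ⟨x, y⟩
        refine congrArg (Quotient.mk _) (Prod.ext ?_ ?_)
        · simp [smul_smul]
        · simp [smul_smul] }

theorem comp_sound (X : FinBiset A B) (Y : FinBiset B C) (b : B) (x : X.carrier)
    (y : Y.carrier) :
    Quotient.mk (compSetoid X Y) (((1, b) : A × B) • x, ((b, 1) : B × C) • y) =
      Quotient.mk (compSetoid X Y) (x, y) :=
  (Quotient.sound (s := compSetoid X Y) (a := (x, y)) ⟨b, rfl⟩).symm

theorem comp_congr {X X' : FinBiset A B} {Y Y' : FinBiset B C} (hX : X.Iso X') (hY : Y.Iso Y') :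
    (X.comp Y).Iso (X'.comp Y') := by
  obtain ⟨e, he⟩ := hX
  obtain ⟨f, hf⟩ := hY
  refine ⟨Quotient.congr (e.prodCongr f) ?_, ?_⟩
  · rintro ⟨x, y⟩ ⟨x', y'⟩
    constructor
    · rintro ⟨b, h⟩
      obtain ⟨rfl, rfl⟩ := Prod.mk.inj h
      exact ⟨b, by simp [he, hf]⟩
    · rintro ⟨b, h⟩
      refine ⟨b, ?_⟩
      obtain ⟨h1, h2⟩ := Prod.mk.inj h
      simp only [Equiv.prodCongr_apply, Prod.map] at h1 h2
      rw [← he] at h1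
      rw [← hf] at h2
      rw [e.injective h1, f.injective h2]
  · rintro g ⟨x, y⟩
    exact congrArg (Quotient.mk _) (Prod.ext (he _ _) (hf _ _))

theorem sum_congr {X X' Y Y' : FinBiset A B} (hX : X.Iso X') (hY : Y.Iso Y') :
    (X.sum Y).Iso (X'.sum Y') := by
  obtain ⟨e, he⟩ := hX
  obtain ⟨f, hf⟩ := hY
  refine ⟨e.sumCongr f, ?_⟩
  rintro g (x | x)
  · exact congrArg Sum.inl (he g x)
  · exact congrArg Sum.inr (hf g x)

theorem comp_assoc (X : FinBiset A B) (Y : FinBiset B C) (Z : FinBiset C D) :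
    ((X.comp Y).comp Z).Iso (X.comp (Y.comp Z)) := by
  refine ⟨⟨Quotient.lift (fun p => Quotient.lift
      (fun q => (Quotient.mk (compSetoid X (Y.comp Z))
        (q.1, Quotient.mk (compSetoid Y Z) (q.2, p.2)))) ?_ p.1) ?_,
    Quotient.lift (fun p => Quotient.lift
      (fun q => (Quotient.mk (compSetoid (X.comp Y) Z)
        (Quotient.mk (compSetoid X Y) (p.1, q.1), q.2))) ?_ p.2) ?_, ?_, ?_⟩, ?_⟩
  · rintro ⟨x, y⟩ _ ⟨b, rfl⟩
    refine (comp_sound X (Y.comp Z) b x (Quotient.mk _ (y, p.2))).symm.trans ?_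
    refine congrArg (Quotient.mk (compSetoid X (Y.comp Z))) (Prod.ext rfl ?_)
    exact congrArg (Quotient.mk (compSetoid Y Z)) (Prod.ext rfl (one_smul (C × D) p.2))
  · rintro ⟨⟨x, y⟩, z⟩ _ ⟨c, rfl⟩
    change Quotient.mk (compSetoid X (Y.comp Z)) _ = Quotient.mk (compSetoid X (Y.comp Z)) _
    refine congrArg (Quotient.mk _) (Prod.ext (one_smul (A × B) x).symm ?_)
    exact (comp_sound Y Z c y z).symm
  · rintro ⟨y, z⟩ _ ⟨c, rfl⟩
    refine (comp_sound (X.comp Y) Z c (Quotient.mk _ (p.1, y)) z).symm.trans ?_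
    refine congrArg (Quotient.mk (compSetoid (X.comp Y) Z)) (Prod.ext ?_ rfl)
    exact congrArg (Quotient.mk (compSetoid X Y)) (Prod.ext (one_smul (A × B) p.1) rfl)
  · rintro ⟨x, ⟨y, z⟩⟩ _ ⟨b, rfl⟩
    change Quotient.mk (compSetoid (X.comp Y) Z) _ = Quotient.mk (compSetoid (X.comp Y) Z) _
    refine congrArg (Quotient.mk _) (Prod.ext ?_ (one_smul (C × D) z).symm)
    exact (comp_sound X Y b x y).symm
  · rintro ⟨⟨x, y⟩, z⟩
    rfl
  · rintro ⟨x, ⟨y, z⟩⟩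
    rfl
  · rintro g ⟨⟨x, y⟩, z⟩
    change Quotient.mk (compSetoid X (Y.comp Z)) _ = Quotient.mk (compSetoid X (Y.comp Z)) _
    refine congrArg (Quotient.mk _) (Prod.ext rfl ?_)
    refine congrArg (Quotient.mk (compSetoid Y Z)) (Prod.ext ?_ rfl)
    exact (one_smul (B × C) y).trans (one_smul (B × C) y).symm

theorem sum_comp (X Y : FinBiset A B) (Z : FinBiset B C) :
    ((X.sum Y).comp Z).Iso ((X.comp Z).sum (Y.comp Z)) := by
  refine ⟨⟨Quotient.lift (fun p => Sum.elim
      (fun x => Sum.inl (Quotient.mk (compSetoid X Z) (x, p.2)))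
      (fun y => Sum.inr (Quotient.mk (compSetoid Y Z) (y, p.2))) p.1) ?_,
    Sum.elim
      (Quotient.lift (fun q => Quotient.mk (compSetoid (X.sum Y) Z) (Sum.inl q.1, q.2)) ?_)
      (Quotient.lift (fun q => Quotient.mk (compSetoid (X.sum Y) Z) (Sum.inr q.1, q.2)) ?_),
    ?_, ?_⟩, ?_⟩
  · rintro ⟨x | x, z⟩ _ ⟨b, rfl⟩
    · exact congrArg Sum.inl (comp_sound X Z b x z).symm
    · exact congrArg Sum.inr (comp_sound Y Z b x z).symm
  · rintro ⟨x, z⟩ _ ⟨b, rfl⟩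
    exact (comp_sound (X.sum Y) Z b (Sum.inl x) z).symm
  · rintro ⟨x, z⟩ _ ⟨b, rfl⟩
    exact (comp_sound (X.sum Y) Z b (Sum.inr x) z).symm
  · rintro ⟨x | x, z⟩ <;> rfl
  · rintro (⟨x, z⟩ | ⟨x, z⟩) <;> rfl
  · rintro g ⟨x | x, z⟩ <;> rfl

theorem comp_sum (X : FinBiset A B) (Y Z : FinBiset B C) :
    (X.comp (Y.sum Z)).Iso ((X.comp Y).sum (X.comp Z)) := by
  refine ⟨⟨Quotient.lift (fun p => Sum.elim
      (fun y => Sum.inl (Quotient.mk (compSetoid X Y) (p.1, y)))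
      (fun z => Sum.inr (Quotient.mk (compSetoid X Z) (p.1, z))) p.2) ?_,
    Sum.elim
      (Quotient.lift (fun q => Quotient.mk (compSetoid X (Y.sum Z)) (q.1, Sum.inl q.2)) ?_)
      (Quotient.lift (fun q => Quotient.mk (compSetoid X (Y.sum Z)) (q.1, Sum.inr q.2)) ?_),
    ?_, ?_⟩, ?_⟩
  · rintro ⟨x, y | y⟩ _ ⟨b, rfl⟩
    · exact congrArg Sum.inl (comp_sound X Y b x y).symm
    · exact congrArg Sum.inr (comp_sound X Z b x y).symm
  · rintro ⟨x, y⟩ _ ⟨b, rfl⟩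
    exact (comp_sound X (Y.sum Z) b x (Sum.inl y)).symm
  · rintro ⟨x, y⟩ _ ⟨b, rfl⟩
    exact (comp_sound X (Y.sum Z) b x (Sum.inr y)).symm
  · rintro ⟨x, y | y⟩ <;> rfl
  · rintro (⟨x, y⟩ | ⟨x, y⟩) <;> rfl
  · rintro g ⟨x, y | y⟩ <;> rfl

/-- The transitive biset `(A × B) / Δ` with `Δ` the image of `(α, β) : C → A × B`. -/
def transitive [Finite A] [Finite B] (α : C →* A) (β : C →* B) : FinBiset A B where
  carrier := (A × B) ⧸ (α.prod β).range

/-- `(A × A) / Δ(A, id)` is a left identity for the composition of bisets. -/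
theorem id_comp [Finite A] (X : FinBiset A B) :
    ((transitive (MonoidHom.id A) (MonoidHom.id A)).comp X).Iso X := by
  let T := transitive (MonoidHom.id A) (MonoidHom.id A)
  have key : ∀ g : A × A, ∀ x : X.carrier,
      Quotient.mk (compSetoid T X) ((QuotientGroup.mk g : T.carrier), x) =
      Quotient.mk (compSetoid T X)
        ((QuotientGroup.mk 1 : T.carrier), ((g.1 * g.2⁻¹, 1) : A × B) • x) := by
    rintro ⟨a, a'⟩ x
    refine (comp_sound T X (a * a'⁻¹) _ x).symm.trans ?_
    refine congrArg (Quotient.mk _) (Prod.ext ?_ rfl)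
    refine QuotientGroup.eq.2 ⟨a⁻¹, ?_⟩
    simp
  refine ⟨⟨Quotient.lift (fun p => Quotient.liftOn' p.1
      (fun g : A × A => ((g.1 * g.2⁻¹, 1) : A × B) • p.2) ?_) ?_,
    fun x => Quotient.mk (compSetoid T X) ((QuotientGroup.mk 1 : T.carrier), x), ?_, ?_⟩, ?_⟩
  · rintro g h hgh
    obtain ⟨c, hc⟩ := QuotientGroup.leftRel_apply.1 hgh
    obtain rfl : h = g * (c, c) := by
      rw [eq_comm, ← eq_inv_mul_iff_mul_eq]; exact hc
    simp [mul_assoc]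
  · rintro ⟨⟨g⟩, x⟩ _ ⟨b, rfl⟩
    change ((g.1 * g.2⁻¹, 1) : A × B) • x =
      ((1 * g.1 * (b * g.2)⁻¹, 1) : A × B) • ((b, 1) : A × B) • x
    simp [smul_smul, mul_assoc]
  · rintro ⟨⟨g⟩, x⟩
    exact (key g x).symm
  · intro x
    change ((1 * (1 : A)⁻¹, 1) : A × B) • x = x
    simp [← Prod.one_eq_mk]
  · rintro g ⟨⟨h⟩, x⟩
    change ((g.1 * h.1 * (1 * h.2)⁻¹, 1) : A × B) • ((1, g.2) : A × B) • x =
      g • ((h.1 * h.2⁻¹, 1) : A × B) • x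
    simp [smul_smul, Prod.mul_def, mul_assoc]

/-- `(B × B) / Δ(B, id)` is a right identity for the composition of bisets. -/
theorem comp_id [Finite B] (X : FinBiset A B) :
    (X.comp (transitive (MonoidHom.id B) (MonoidHom.id B))).Iso X := by
  let T := transitive (MonoidHom.id B) (MonoidHom.id B)
  have key : ∀ g : B × B, ∀ x : X.carrier,
      Quotient.mk (compSetoid X T) (x, (QuotientGroup.mk g : T.carrier)) =
      Quotient.mk (compSetoid X T)
        (((1, g.2 * g.1⁻¹) : A × B) • x, (QuotientGroup.mk 1 : T.carrier)) := by
    rintro ⟨a, a'⟩ x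
    refine (comp_sound X T (a' * a⁻¹) x _).symm.trans ?_
    refine congrArg (Quotient.mk _) (Prod.ext rfl ?_)
    refine QuotientGroup.eq.2 ⟨a'⁻¹, ?_⟩
    simp
  refine ⟨⟨Quotient.lift (fun p => Quotient.liftOn' p.2
      (fun g : B × B => ((1, g.2 * g.1⁻¹) : A × B) • p.1) ?_) ?_,
    fun x => Quotient.mk (compSetoid X T) (x, (QuotientGroup.mk 1 : T.carrier)), ?_, ?_⟩, ?_⟩
  · rintro g h hgh
    obtain ⟨c, hc⟩ := QuotientGroup.leftRel_apply.1 hgh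
    obtain rfl : h = g * (c, c) := by
      rw [eq_comm, ← eq_inv_mul_iff_mul_eq]; exact hc
    simp [mul_assoc]
  · rintro ⟨x, ⟨g⟩⟩ _ ⟨b, rfl⟩
    change ((1, g.2 * g.1⁻¹) : A × B) • x =
      ((1, 1 * g.2 * (b * g.1)⁻¹) : A × B) • ((1, b) : A × B) • x
    simp [smul_smul, mul_assoc]
  · rintro ⟨x, ⟨g⟩⟩
    exact (key g x).symm
  · intro x
    change ((1, 1 * (1 : B)⁻¹) : A × B) • x = x
    simp [← Prod.one_eq_mk]
  · rintro g ⟨x, ⟨h⟩⟩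
    change ((1, g.2 * h.2 * (1 * h.1)⁻¹) : A × B) • ((g.1, 1) : A × B) • x =
      g • ((1, h.2 * h.1⁻¹) : A × B) • x
    simp [smul_smul, Prod.mul_def, mul_assoc]

end FinBiset

/-- Isomorphism classes of finite `(A, B)`-bisets. -/
def BisetClass (A B : Type u) [Group A] [Group B] : Type (u + 1) :=
  Quotient (FinBiset.isoSetoid A B)

namespace BisetClass

variable {A B C D : Type u} [Group A] [Group B] [Group C] [Group D]

/-- The isomorphism class of a biset. -/
def mk (X : FinBiset A B) : BisetClass A B := Quotient.mk _ X

theorem mk_eq {X Y : FinBiset A B} (h : X.Iso Y) : mk X = mk Y := Quotient.sound h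

instance : Zero (BisetClass A B) := ⟨mk (FinBiset.empty A B)⟩

/-- Addition of classes is disjoint union. -/
instance : Add (BisetClass A B) :=
  ⟨Quotient.map₂ FinBiset.sum fun _ _ hX _ _ hY => FinBiset.sum_congr hX hY⟩

/-- Composition of classes is induced by `X ×_B Y`. -/
def comp : BisetClass A B → BisetClass B C → BisetClass A C :=
  Quotient.map₂ FinBiset.comp fun _ _ hX _ _ hY => FinBiset.comp_congr hX hY

instance : AddCommMonoid (BisetClass A B) where
  add_assoc := by
    rintro ⟨X⟩ ⟨Y⟩ ⟨Z⟩
    refine mk_eq ⟨Equiv.sumAssoc _ _ _, ?_⟩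
    rintro g ((x | x) | x) <;> rfl
  zero_add := by
    rintro ⟨X⟩
    refine mk_eq ⟨Equiv.emptySum PEmpty _, ?_⟩
    rintro g (x | x)
    · exact x.elim
    · rfl
  add_zero := by
    rintro ⟨X⟩
    refine mk_eq ⟨Equiv.sumEmpty _ PEmpty, ?_⟩
    rintro g (x | x)
    · rfl
    · exact x.elim
  add_comm := by
    rintro ⟨X⟩ ⟨Y⟩
    refine mk_eq ⟨Equiv.sumComm _ _, ?_⟩
    rintro g (x | x) <;> rfl
  nsmul := nsmulRec

theorem comp_assoc (x : BisetClass A B) (y : BisetClass B C) (z : BisetClass C D) :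
    (x.comp y).comp z = x.comp (y.comp z) := by
  obtain ⟨X⟩ := x; obtain ⟨Y⟩ := y; obtain ⟨Z⟩ := z
  exact mk_eq (FinBiset.comp_assoc X Y Z)

theorem add_comp (x y : BisetClass A B) (z : BisetClass B C) :
    (x + y).comp z = x.comp z + y.comp z := by
  obtain ⟨X⟩ := x; obtain ⟨Y⟩ := y; obtain ⟨Z⟩ := z
  exact mk_eq (FinBiset.sum_comp X Y Z)

theorem comp_add (x : BisetClass A B) (y z : BisetClass B C) :
    x.comp (y + z) = x.comp y + x.comp z := by
  obtain ⟨X⟩ := x; obtain ⟨Y⟩ := y; obtain ⟨Z⟩ := z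
  exact mk_eq (FinBiset.comp_sum X Y Z)

theorem zero_comp (z : BisetClass B C) : (0 : BisetClass A B).comp z = 0 := by
  obtain ⟨Z⟩ := z
  refine mk_eq ⟨⟨Quotient.lift (fun p => p.1.elim) ?_, fun x => x.elim, ?_, ?_⟩, ?_⟩
  · rintro ⟨x, _⟩; exact x.elim
  · rintro ⟨x, _⟩; exact x.elim
  · rintro x; exact x.elim
  · rintro _ ⟨x, _⟩; exact x.elim

theorem comp_zero (z : BisetClass A B) : z.comp (0 : BisetClass B C) = 0 := by
  obtain ⟨Z⟩ := z
  refine mk_eq ⟨⟨Quotient.lift (fun p => p.2.elim) ?_, fun x => x.elim, ?_, ?_⟩, ?_⟩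
  · rintro ⟨_, x⟩; exact x.elim
  · rintro ⟨_, x⟩; exact x.elim
  · rintro x; exact x.elim
  · rintro _ ⟨_, x⟩; exact x.elim

/-- Composition with a fixed class on the right, as an additive map. -/
def compRight (z : BisetClass B C) : BisetClass A B →+ BisetClass A C where
  toFun x := x.comp z
  map_zero' := zero_comp z
  map_add' x y := add_comp x y z

/-- Composition with a fixed class on the left, as an additive map. -/
def compLeft (x : BisetClass A B) : BisetClass B C →+ BisetClass A C where
  toFun z := x.comp z
  map_zero' := comp_zero x
  map_add' y z := comp_add x y z

/-- The class of `(A × B) / Δ` with `Δ` the image of `(α, β) : C → A × B`. -/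
def ofHoms [Finite A] [Finite B] (α : C →* A) (β : C →* B) : BisetClass A B :=
  mk (FinBiset.transitive α β)

/-- The class of `(A × A) / Δ(A, id)`. -/
def ident (A : Type u) [Group A] [Finite A] : BisetClass A A :=
  ofHoms (MonoidHom.id A) (MonoidHom.id A)

theorem ident_comp [Finite A] (x : BisetClass A B) : (ident A).comp x = x := by
  obtain ⟨X⟩ := x
  exact mk_eq (FinBiset.id_comp X)

theorem comp_ident [Finite B] (x : BisetClass A B) : x.comp (ident B) = x := by
  obtain ⟨X⟩ := x
  exact mk_eq (FinBiset.comp_id X)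

end BisetClass

/-- Families of classes of `(A, B)`-bisets, one for each pair of subgroups `A, B ≤ S`. They are the
finite formal sums of classes of bisets over pairs of subgroups of `S`; the product is the
composition of bisets, a product of bisets over groups that do not match being empty. -/
def BisetSemiring (S : Type u) [Group S] : Type (u + 1) :=
  ∀ A B : Subgroup S, BisetClass A B

namespace BisetSemiring

variable {S : Type u} [Group S]

noncomputable instance [Finite S] : Fintype (Subgroup S) := Fintype.ofFinite _

instance : AddCommMonoid (BisetSemiring S) :=
  inferInstanceAs (AddCommMonoid (∀ A B : Subgroup S, BisetClass A B))

theorem add_apply (x y : BisetSemiring S) (A B : Subgroup S) : (x + y) A B = x A B + y A B := rfl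

theorem zero_apply (A B : Subgroup S) : (0 : BisetSemiring S) A B = 0 := rfl

open Classical in
/-- The class `c` of an `(A, B)`-biset, seen as an element of the semiring. -/
noncomputable def single (A B : Subgroup S) (c : BisetClass A B) : BisetSemiring S :=
  Pi.single A (Pi.single B c)

theorem single_same (A B : Subgroup S) (c : BisetClass A B) : single A B c A B = c := by
  simp [single]

theorem single_of_ne {A B : Subgroup S} (c : BisetClass A B) {A' B' : Subgroup S}
    (h : ¬(A' = A ∧ B' = B)) : single A B c A' B' = 0 := by
  classical
  by_cases hA : A' = A
  · subst hA
    have hB : B' ≠ B := fun hB => h ⟨rfl, hB⟩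
    simp [single, Pi.single_eq_of_ne hB]
  · simp [single, Pi.single_eq_of_ne hA]

theorem sum_apply {ι : Type*} (s : Finset ι) (f : ι → BisetSemiring S) (A B : Subgroup S) :
    (∑ i ∈ s, f i) A B = ∑ i ∈ s, f i A B := by
  let ev : BisetSemiring S →+ BisetClass A B :=
    { toFun := fun x => x A B, map_zero' := rfl, map_add' := fun _ _ => rfl }
  exact map_sum ev f s

variable [Finite S]

noncomputable instance : Mul (BisetSemiring S) :=
  ⟨fun x y A C => ∑ B : Subgroup S, (x A B).comp (y B C)⟩

theorem mul_apply (x y : BisetSemiring S) (A C : Subgroup S) :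
    (x * y) A C = ∑ B : Subgroup S, (x A B).comp (y B C) := rfl

/-- The sum over `A ≤ T` of the classes of the identity bisets `(A × A) / Δ(A, id)`. -/
noncomputable def idUpTo (T : Subgroup S) : BisetSemiring S :=
  open Classical in ∑ A ∈ Finset.univ.filter (· ≤ T), single A A (BisetClass.ident A)

noncomputable instance : One (BisetSemiring S) := ⟨idUpTo ⊤⟩

theorem idUpTo_apply_same {T A : Subgroup S} (hA : A ≤ T) :
    idUpTo T A A = BisetClass.ident A := by
  classical
  rw [idUpTo, sum_apply, Finset.sum_eq_single A, single_same]
  · intro B _ hB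
    exact single_of_ne _ fun h => hB h.1.symm
  · intro h
    exact absurd (Finset.mem_filter.2 ⟨Finset.mem_univ A, hA⟩ : A ∈ Finset.univ.filter (· ≤ T)) h

theorem idUpTo_apply_of_ne {T A B : Subgroup S} (h : A ≠ B) : idUpTo T A B = 0 := by
  classical
  rw [idUpTo, sum_apply]
  exact Finset.sum_eq_zero fun C _ => single_of_ne _ fun hC => h (hC.1.trans hC.2.symm)

theorem idUpTo_mul {T : Subgroup S} {x : BisetSemiring S}
    (hx : ∀ A B, ¬A ≤ T → x A B = 0) : idUpTo T * x = x := by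
  classical
  funext A B
  rw [mul_apply]
  by_cases hA : A ≤ T
  · rw [Finset.sum_eq_single A, idUpTo_apply_same hA, BisetClass.ident_comp]
    · intro C _ hC
      rw [idUpTo_apply_of_ne hC.symm, BisetClass.zero_comp]
    · intro h
      exact absurd (Finset.mem_univ _) h
  · rw [hx A B hA]
    refine Finset.sum_eq_zero fun C _ => ?_
    by_cases hC : A = C
    · subst hC
      rw [hx A B hA, BisetClass.comp_zero]
    · rw [idUpTo_apply_of_ne hC, BisetClass.zero_comp]

theorem mul_idUpTo_top (x : BisetSemiring S) : x * idUpTo ⊤ = x := by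
  classical
  funext A B
  rw [mul_apply, Finset.sum_eq_single B, idUpTo_apply_same le_top, BisetClass.comp_ident]
  · intro C _ hC
    rw [idUpTo_apply_of_ne hC, BisetClass.comp_zero]
  · intro h
    exact absurd (Finset.mem_univ _) h

noncomputable instance : Semiring (BisetSemiring S) where
  left_distrib x y z := by
    funext A C
    simp only [mul_apply, add_apply, BisetClass.comp_add, Finset.sum_add_distrib]
  right_distrib x y z := by
    funext A C
    simp only [mul_apply, add_apply, BisetClass.add_comp, Finset.sum_add_distrib]
  zero_mul x := by
    funext A C
    simp only [mul_apply, zero_apply, BisetClass.zero_comp, Finset.sum_const_zero]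
  mul_zero x := by
    funext A C
    simp only [mul_apply, zero_apply, BisetClass.comp_zero, Finset.sum_const_zero]
  mul_assoc x y z := by
    funext A D
    simp only [mul_apply]
    have h1 : ∀ C, (∑ B, (x A B).comp (y B C)).comp (z C D) =
        ∑ B, ((x A B).comp (y B C)).comp (z C D) := fun C =>
      map_sum (BisetClass.compRight (z C D)) _ _
    have h2 : ∀ B, (x A B).comp (∑ C, (y B C).comp (z C D)) =
        ∑ C, (x A B).comp ((y B C).comp (z C D)) := fun B =>
      map_sum (BisetClass.compLeft (x A B)) _ _
    simp only [h1, h2, BisetClass.comp_assoc]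
    exact Finset.sum_comm
  one_mul x := idUpTo_mul fun _ _ h => absurd le_top h
  mul_one x := mul_idUpTo_top x

/-- The restriction `R_H^K`, the class of `(H × K) / Δ(H, id)`. -/
noncomputable def res {H K : Subgroup S} (h : H ≤ K) : BisetSemiring S :=
  single H K (BisetClass.ofHoms (MonoidHom.id H) (Subgroup.inclusion h))

/-- The induction `I_H^K`, the class of `(K × H) / Δ(H, id)`. -/
noncomputable def ind {H K : Subgroup S} (h : H ≤ K) : BisetSemiring S :=
  single K H (BisetClass.ofHoms (Subgroup.inclusion h) (MonoidHom.id H))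

/-- The conjugation `c_φ`, the class of `(φ(H) × H) / Δ(H, φ)`, for an isomorphism `φ : H → K`. -/
noncomputable def conj {H K : Subgroup S} (φ : H ≃* K) : BisetSemiring S :=
  single K H (BisetClass.ofHoms φ.toMonoidHom (MonoidHom.id H))

theorem ind_refl (H : Subgroup S) : ind (le_refl H) = single H H (BisetClass.ident H) := rfl

end BisetSemiring

/-! ## Fusion systems -/

/-- A (not necessarily saturated) fusion system over a subgroup `T` of `S`. -/
structure FusionSystem {S : Type u} [Group S] (T : Subgroup S) where
  /-- The morphisms from `A` to `B`; there are none unless `A, B ≤ T`. -/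
  Hom : ∀ A B : Subgroup S, Set (A →* B)
  le_of_mem : ∀ {A B : Subgroup S} {φ : A →* B}, φ ∈ Hom A B → A ≤ T ∧ B ≤ T
  injective_of_mem : ∀ {A B : Subgroup S} {φ : A →* B}, φ ∈ Hom A B → Function.Injective φ
  comp_mem : ∀ {A B C : Subgroup S} {φ : A →* B} {ψ : B →* C},
    φ ∈ Hom A B → ψ ∈ Hom B C → ψ.comp φ ∈ Hom A C
  /-- Conjugations by elements of `T` are morphisms. -/
  conj_mem : ∀ {A B : Subgroup S} (φ : A →* B), A ≤ T → B ≤ T →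
    (∃ t ∈ T, ∀ a : A, (φ a : S) = t * a * t⁻¹) → φ ∈ Hom A B
  /-- A morphism `φ : A → B` and the inverse of `A → φ(A)` are morphisms onto and from `φ(A)`. -/
  iso_mem : ∀ {A B C : Subgroup S} {φ : A →* B} (e : A ≃* C), φ ∈ Hom A B →
    (∀ a : A, (e a : S) = φ a) → e.toMonoidHom ∈ Hom A C ∧ e.symm.toMonoidHom ∈ Hom C A

namespace FusionSystem

variable {S : Type u} [Group S] {T : Subgroup S}

/-- `A` and `B` are isomorphic in the fusion system. -/
def IsIso (F : FusionSystem T) (A B : Subgroup S) : Prop :=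
  ∃ e : A ≃* B, e.toMonoidHom ∈ F.Hom A B

theorem id_mem (F : FusionSystem T) {A : Subgroup S} (hA : A ≤ T) : MonoidHom.id A ∈ F.Hom A A :=
  F.conj_mem _ hA hA ⟨1, T.one_mem, fun a => by simp⟩

theorem isIso_refl (F : FusionSystem T) {A : Subgroup S} (hA : A ≤ T) : F.IsIso A A :=
  ⟨MulEquiv.refl A, F.id_mem hA⟩

theorem IsIso.symm {F : FusionSystem T} {A B : Subgroup S} (h : F.IsIso A B) : F.IsIso B A := by
  obtain ⟨e, he⟩ := h
  exact ⟨e.symm, (F.iso_mem e he fun _ => rfl).2⟩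

theorem IsIso.trans {F : FusionSystem T} {A B C : Subgroup S} (h : F.IsIso A B)
    (h' : F.IsIso B C) : F.IsIso A C := by
  obtain ⟨e, he⟩ := h
  obtain ⟨e', he'⟩ := h'
  exact ⟨e.trans e', F.comp_mem he he'⟩

/-- `A` is isomorphic in the fusion system to a subgroup of `B`. -/
def IsSubconj (F : FusionSystem T) (A B : Subgroup S) : Prop :=
  ∃ J ≤ B, F.IsIso A J

/-- `H` is fully normalized. -/
def IsFullyNormalized (F : FusionSystem T) (H : Subgroup S) : Prop :=
  H ≤ T ∧ ∀ K, F.IsIso K H →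
    Nat.card ↥(Subgroup.normalizer (K : Set S) ⊓ T) ≤
      Nat.card ↥(Subgroup.normalizer (H : Set S) ⊓ T)

/-- `H` is centric: `C_T(K) ≤ K` for every `K` isomorphic to `H`. -/
def IsCentric (F : FusionSystem T) (H : Subgroup S) : Prop :=
  H ≤ T ∧ ∀ K, F.IsIso H K → Subgroup.centralizer (K : Set S) ⊓ T ≤ K

/-- The image in `S` of a homomorphism between subgroups of `S`. -/
def im {A B : Subgroup S} (φ : A →* B) : Subgroup S := (B.subtype.comp φ).range

theorem im_le {A B : Subgroup S} (φ : A →* B) : im φ ≤ B := by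
  rintro _ ⟨a, rfl⟩
  exact (φ a).2

/-- A morphism seen as an isomorphism onto its image. -/
noncomputable def isoIm {A B : Subgroup S} (φ : A →* B) (h : Function.Injective φ) :
    A ≃* im φ :=
  (B.subtype.comp φ).ofInjective (B.subtype_injective.comp h)

/-- The `φ`-normalizer: the `x ∈ N_T(H)` for which some `z ∈ N_T(φ(H))` satisfies
`φ (x h x⁻¹) = z φ(h) z⁻¹` for all `h ∈ H`. -/
def phiNormalizer (T : Subgroup S) {H K : Subgroup S} (φ : H →* K) : Subgroup S where
  carrier := {x | x ∈ Subgroup.normalizer (H : Set S) ⊓ T ∧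
    ∃ z ∈ Subgroup.normalizer (im φ : Set S) ⊓ T,
      ∀ h h' : H, (h' : S) = x * h * x⁻¹ → (φ h' : S) = z * φ h * z⁻¹}
  one_mem' := by
    refine ⟨one_mem _, 1, one_mem _, fun h h' e => ?_⟩
    obtain rfl : h' = h := Subtype.ext (by simpa using e)
    simp
  mul_mem' := by
    rintro x y ⟨hx, z, hz, hxz⟩ ⟨hy, w, hw, hyw⟩
    refine ⟨mul_mem hx hy, z * w, mul_mem hz hw, fun h h' e => ?_⟩
    have hmem : y * h * y⁻¹ ∈ H := (Subgroup.mem_normalizer_iff.1 hy.1 h).1 h.2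
    rw [hxz ⟨_, hmem⟩ h' (by rw [e]; group), hyw h ⟨_, hmem⟩ rfl]
    group
  inv_mem' := by
    rintro x ⟨hx, z, hz, hxz⟩
    refine ⟨inv_mem hx, z⁻¹, inv_mem hz, fun h h' e => ?_⟩
    rw [hxz h' h (by rw [e]; group)]
    group

/-- The automorphism group of `T` in the fusion system. -/
def autTop (F : FusionSystem T) : Subgroup (MulAut T) where
  carrier := {e | e.toMonoidHom ∈ F.Hom T T}
  one_mem' := F.id_mem le_rfl
  mul_mem' := fun {a b} ha hb =>
    show (MulEquiv.toMonoidHom a).comp (MulEquiv.toMonoidHom b) ∈ F.Hom T T from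
      F.comp_mem hb ha
  inv_mem' := fun {a} ha => (F.iso_mem a ha fun _ => rfl).2

/-- Saturated fusion systems. -/
structure IsSaturated (p : ℕ) (F : FusionSystem T) : Prop where
  /-- `Aut_T(T)` is a Sylow `p`-subgroup of `Aut_F(T)`. -/
  sylow : ∃ P : Sylow p F.autTop,
    (P : Subgroup F.autTop).map F.autTop.subtype = (MulAut.conj : T →* MulAut T).range
  /-- Morphisms with fully normalized image extend to their normalizer. -/
  extend : ∀ (H : Subgroup S) (φ : H →* T), φ ∈ F.Hom H T → F.IsFullyNormalized (im φ) →
    ∃ ψ : phiNormalizer T φ →* T, ψ ∈ F.Hom (phiNormalizer T φ) T ∧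
      ∀ (h : H) (x : phiNormalizer T φ), (x : S) = h → ψ x = φ h

/-- The fusion system of the group `T` over itself. -/
def inner (T : Subgroup S) : FusionSystem T where
  Hom A B := {φ | A ≤ T ∧ B ≤ T ∧ ∃ t ∈ T, ∀ a : A, (φ a : S) = t * a * t⁻¹}
  le_of_mem h := ⟨h.1, h.2.1⟩
  injective_of_mem := by
    rintro A B φ ⟨_, _, t, _, h⟩ a b hab
    have := congrArg (Subtype.val) hab
    rw [h, h] at this
    exact Subtype.ext (mul_left_cancel (mul_right_cancel this))
  comp_mem := by
    rintro A B C φ ψ ⟨hA, _, t, ht, h⟩ ⟨_, hC, s, hs, h'⟩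
    refine ⟨hA, hC, s * t, mul_mem hs ht, fun a => ?_⟩
    rw [MonoidHom.comp_apply, h', h]
    group
  conj_mem φ hA hB h := ⟨hA, hB, h⟩
  iso_mem := by
    rintro A B C φ e ⟨hA, hB, t, ht, h⟩ he
    have hC : C ≤ T := by
      intro c hc
      have := he (e.symm ⟨c, hc⟩)
      rw [e.apply_symm_apply] at this
      change c = _ at this
      rw [this]
      exact hB (φ _).2
    refine ⟨⟨hA, hC, t, ht, fun a => (he a).trans (h a)⟩, hC, hA, t⁻¹, inv_mem ht, fun c => ?_⟩
    have h1 := (he (e.symm c)).trans (h (e.symm c))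
    rw [e.apply_symm_apply] at h1
    change ((e.symm c : A) : S) = _
    rw [h1]
    group

/-- The normalizer of `H` in a fusion system over `S`: the fusion system over `N_S(H)` whose
morphisms `A → B` are those that extend to a morphism `A H → B H` which maps `H` onto `H`. -/
def normalizerSystem (F : FusionSystem (⊤ : Subgroup S)) (H : Subgroup S) :
    FusionSystem (Subgroup.normalizer (H : Set S)) where
  Hom A B := {φ | A ≤ Subgroup.normalizer (H : Set S) ∧ B ≤ Subgroup.normalizer (H : Set S) ∧
    φ ∈ F.Hom A B ∧ ∃ ψ : ↥(A ⊔ H) →* ↥(B ⊔ H), ψ ∈ F.Hom (A ⊔ H) (B ⊔ H) ∧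
      (∀ a : A, (ψ (Subgroup.inclusion le_sup_left a) : S) = φ a) ∧
      (H.subgroupOf (A ⊔ H)).map ψ = H.subgroupOf (B ⊔ H)}
  le_of_mem h := ⟨h.1, h.2.1⟩
  injective_of_mem h := F.injective_of_mem h.2.2.1
  comp_mem := by
    rintro A B C φ ψ ⟨hA, _, hφ, φ', hφ', h1, h2⟩ ⟨_, hC, hψ, ψ', hψ', h3, h4⟩
    refine ⟨hA, hC, F.comp_mem hφ hψ, ψ'.comp φ', F.comp_mem hφ' hψ', fun a => ?_, ?_⟩
    · have : φ' (Subgroup.inclusion le_sup_left a) = Subgroup.inclusion le_sup_left (φ a) :=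
        Subtype.ext (h1 a)
      rw [MonoidHom.comp_apply, this, h3, MonoidHom.comp_apply]
    · rw [← Subgroup.map_map, h2, h4]
  conj_mem := by
    rintro A B φ hA hB ⟨t, ht, h⟩
    have htH : ∀ x ∈ H, t * x * t⁻¹ ∈ H := fun x hx => (Subgroup.mem_normalizer_iff.1 ht x).1 hx
    have hmem : ∀ x : ↥(A ⊔ H), t * x * t⁻¹ ∈ B ⊔ H := by
      rintro ⟨x, hx⟩
      have : A ⊔ H ≤ (B ⊔ H).comap (MulAut.conj t).toMonoidHom := by
        refine sup_le (fun a ha => ?_) fun x hx => ?_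
        · refine Subgroup.mem_comap.2 (Subgroup.mem_sup_left ?_)
          have := (φ ⟨a, ha⟩).2
          rw [h] at this
          exact this
        · exact Subgroup.mem_comap.2 (Subgroup.mem_sup_right (htH x hx))
      exact this hx
    let ψ : ↥(A ⊔ H) →* ↥(B ⊔ H) :=
      ((MulAut.conj t).toMonoidHom.comp (A ⊔ H).subtype).codRestrict (B ⊔ H) hmem
    have hψ : ∀ x, (ψ x : S) = t * x * t⁻¹ := fun x => rfl
    refine ⟨hA, hB, F.conj_mem φ le_top le_top ⟨t, trivial, h⟩, ψ,
      F.conj_mem ψ le_top le_top ⟨t, trivial, hψ⟩, fun a => ?_, ?_⟩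
    · rw [hψ, h]
      rfl
    · ext y
      constructor
      · rintro ⟨x, hx, rfl⟩
        exact htH x hx
      · intro hy
        have hy' : t⁻¹ * y * t ∈ H :=
          (Subgroup.mem_normalizer_iff''.1 ht y).1 hy
        refine ⟨⟨t⁻¹ * y * t, Subgroup.mem_sup_right hy'⟩, hy', Subtype.ext ?_⟩
        rw [hψ]
        group
  iso_mem := by
    rintro A B C φ e ⟨hA, hB, hφ, ψ, hψ, h1, h2⟩ he
    have hC : C ≤ B := by
      intro c hc
      have := he (e.symm ⟨c, hc⟩)
      rw [e.apply_symm_apply] at this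
      change c = _ at this
      rw [this]
      exact (φ _).2
    have hCH : C ⊔ H ≤ B ⊔ H := sup_le_sup_right hC H
    have hrange : ψ.range = (C ⊔ H).subgroupOf (B ⊔ H) := by
      have hC' : (A.subgroupOf (A ⊔ H)).map ψ = C.subgroupOf (B ⊔ H) := by
        ext y
        constructor
        · rintro ⟨x, hx, rfl⟩
          have := h1 ⟨x, hx⟩
          have hx' : Subgroup.inclusion le_sup_left ⟨(x : S), hx⟩ = x := rfl
          rw [hx', ← he] at this
          change (ψ x : S) ∈ C
          rw [this]
          exact (e _).2
        · intro hy
          refine ⟨Subgroup.inclusion le_sup_left (e.symm ⟨y, hy⟩), (e.symm ⟨y, hy⟩).2,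
            Subtype.ext ?_⟩
          rw [h1, ← he, e.apply_symm_apply]
      have htop : A.subgroupOf (A ⊔ H) ⊔ H.subgroupOf (A ⊔ H) = ⊤ := by
        rw [← Subgroup.subgroupOf_sup le_sup_left le_sup_right, Subgroup.subgroupOf_self]
      rw [MonoidHom.range_eq_map, ← htop, Subgroup.map_sup, h2, hC',
        ← Subgroup.subgroupOf_sup (hC.trans le_sup_left) le_sup_right]
    have hmem : ∀ x, (ψ x : S) ∈ C ⊔ H := fun x =>
      (hrange ▸ MonoidHom.mem_range.2 ⟨x, rfl⟩ : ψ x ∈ (C ⊔ H).subgroupOf (B ⊔ H))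
    let χ : ↥(A ⊔ H) →* ↥(C ⊔ H) := ((B ⊔ H).subtype.comp ψ).codRestrict (C ⊔ H) hmem
    have hχ : ∀ x, (χ x : S) = ψ x := fun x => rfl
    have hbij : Function.Bijective χ := by
      constructor
      · intro x y hxy
        refine F.injective_of_mem hψ (Subtype.ext ?_)
        rw [← hχ, ← hχ, hxy]
      · intro y
        have hy : Subgroup.inclusion hCH y ∈ ψ.range := hrange ▸ y.2
        obtain ⟨x, hx⟩ := hy
        exact ⟨x, Subtype.ext (congrArg (fun z : ↥(B ⊔ H) => (z : S)) hx)⟩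
    let E : ↥(A ⊔ H) ≃* ↥(C ⊔ H) := MulEquiv.ofBijective χ hbij
    have hE : ∀ x, (E x : S) = ψ x := fun x => rfl
    have hE' := F.iso_mem E hψ hE
    have he' := F.iso_mem e hφ he
    have hH : ∀ x : ↥(A ⊔ H), (E x : S) ∈ H ↔ (x : S) ∈ H := by
      intro x
      constructor
      · intro hx
        have : ψ x ∈ (H.subgroupOf (A ⊔ H)).map ψ := h2.symm ▸ (show ψ x ∈ H.subgroupOf (B ⊔ H) from hx)
        obtain ⟨x', hx', hxx'⟩ := this
        rw [← F.injective_of_mem hψ hxx']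
        exact hx'
      · intro hx
        have : ψ x ∈ H.subgroupOf (B ⊔ H) := h2 ▸ Subgroup.mem_map_of_mem ψ hx
        exact hE x ▸ this
    have heE : ∀ a : A, E (Subgroup.inclusion le_sup_left a) =
        Subgroup.inclusion le_sup_left (e a) := fun a =>
      Subtype.ext ((hE _).trans ((h1 a).trans (he a).symm))
    refine ⟨⟨hA, hC.trans hB, he'.1, E.toMonoidHom, hE'.1, fun a => ?_, ?_⟩,
      hC.trans hB, hA, he'.2, E.symm.toMonoidHom, hE'.2, fun c => ?_, ?_⟩
    · exact congrArg Subtype.val (heE a)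
    · ext y
      constructor
      · rintro ⟨x, hx, rfl⟩
        exact (hH x).2 hx
      · intro hy
        refine ⟨E.symm y, (hH _).1 ?_, E.apply_symm_apply y⟩
        rw [E.apply_symm_apply]
        exact hy
    · have := heE (e.symm c)
      rw [e.apply_symm_apply] at this
      change ((E.symm _ : ↥(A ⊔ H)) : S) = _
      rw [← this, E.symm_apply_apply]
      rfl
    · ext y
      constructor
      · rintro ⟨x, hx, rfl⟩
        refine (hH _).1 ?_
        change (E (E.symm x) : S) ∈ H
        rw [E.apply_symm_apply]
        exact hx
      · intro hy
        exact ⟨E y, (hH y).2 hy, E.symm_apply_apply y⟩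

end FusionSystem

/-! ## Products in the orbit category of centric subgroups -/

section Products

variable {S : Type u} [Group S] {T : Subgroup S}

/-- A pair `(A, φ)` with `A ≤ H` centric and `φ` a representative of a morphism `A → K` of the
orbit category. Two homomorphisms `φ, ψ : A → K` represent the same morphism of the orbit category
if and only if `ψ = c_k φ` for some `k ∈ K`. -/
structure OrbitPair (F : FusionSystem T) (H K : Subgroup S) where
  A : Subgroup S
  φ : A →* K
  le : A ≤ H
  centric : F.IsCentric A
  mem : φ ∈ F.Hom A K

namespace OrbitPair

variable {F : FusionSystem T} {H K : Subgroup S}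

/-- The preorder `(A, φ) ≾ (B, ψ)`: for some `h ∈ H` one has `A^h ≤ B` and the morphisms
`φ c_h` and `ψ ι` from `A^h = h⁻¹ A h` to `K` agree in the orbit category. -/
def Below (P Q : OrbitPair F H K) : Prop :=
  ∃ h ∈ H, ∃ hle : ∀ x : S, h * x * h⁻¹ ∈ P.A → x ∈ Q.A,
    ∃ k : K, ∀ (x : S) (hx : h * x * h⁻¹ ∈ P.A),
      Q.φ ⟨x, hle x hx⟩ = k * P.φ ⟨h * x * h⁻¹, hx⟩ * k⁻¹

theorem Below.refl (P : OrbitPair F H K) : P.Below P := by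
  refine ⟨1, one_mem _, fun x hx => by simpa using hx, 1, fun x hx => ?_⟩
  simp

theorem Below.trans {P Q U : OrbitPair F H K} (h₁ : P.Below Q) (h₂ : Q.Below U) : P.Below U := by
  obtain ⟨h, hh, hle, k, hk⟩ := h₁
  obtain ⟨h', hh', hle', k', hk'⟩ := h₂
  have e : ∀ x : S, h * h' * x * (h * h')⁻¹ = h * (h' * x * h'⁻¹) * h⁻¹ := fun x => by group
  refine ⟨h * h', mul_mem hh hh', fun x hx => hle' x (hle _ (by rw [← e]; exact hx)), k' * k,
    fun x hx => ?_⟩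
  have hx' : h * (h' * x * h'⁻¹) * h⁻¹ ∈ P.A := by rw [← e]; exact hx
  have e' : (⟨_, hx'⟩ : P.A) = ⟨_, hx⟩ := Subtype.ext (e x).symm
  rw [hk' x (hle _ hx'), hk _ hx', e']
  group

/-- The equivalence relation attached to the preorder. -/
def Equivalent (P Q : OrbitPair F H K) : Prop := P.Below Q ∧ Q.Below P

/-- Maximal pairs. -/
def IsMaximal (P : OrbitPair F H K) : Prop := ∀ Q : OrbitPair F H K, P.Below Q → Q.Below P

theorem injective (P : OrbitPair F H K) : Function.Injective P.φ := F.injective_of_mem P.mem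

/-- The image `φ(A)`. -/
def im (P : OrbitPair F H K) : Subgroup S := FusionSystem.im P.φ

/-- The representative `φ` seen as an isomorphism onto its image. -/
noncomputable def iso (P : OrbitPair F H K) : P.A ≃* P.im := FusionSystem.isoIm P.φ P.injective

theorem im_le (P : OrbitPair F H K) : P.im ≤ K := FusionSystem.im_le P.φ

instance [Finite S] : Finite (OrbitPair F H K) := by
  have : ∀ A : Subgroup S, Finite (A →* K) := fun A => DFunLike.finite _
  refine Finite.of_injective
    (fun P : OrbitPair F H K => (⟨P.A, P.φ⟩ : Σ A : Subgroup S, (A →* K))) ?_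
  rintro ⟨A, φ, _, _, _⟩ ⟨B, ψ, _, _, _⟩ h
  obtain ⟨rfl, h⟩ := Sigma.mk.inj h
  obtain rfl := eq_of_heq h
  rfl

end OrbitPair

/-- `X` is a choice of `[H ×_F K]` together with a choice of a representative `φ` of `φ̄` for each
`(A, φ̄)` in it: it contains exactly one pair from every equivalence class of maximal pairs. -/
def IsProductReps (F : FusionSystem T) (H K : Subgroup S) (X : Finset (OrbitPair F H K)) : Prop :=
  (∀ P ∈ X, P.IsMaximal) ∧
    ∀ P : OrbitPair F H K, P.IsMaximal → ∃! Q, Q ∈ X ∧ P.Equivalent Q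

theorem exists_isProductReps [Finite S] (F : FusionSystem T) (H K : Subgroup S) :
    ∃ X : Finset (OrbitPair F H K), IsProductReps F H K X := by
  classical
  let s : Setoid {P : OrbitPair F H K // P.IsMaximal} :=
    { r := fun P Q => P.1.Equivalent Q.1
      iseqv :=
        { refl := fun P => ⟨.refl _, .refl _⟩
          symm := fun h => ⟨h.2, h.1⟩
          trans := fun h h' => ⟨h.1.trans h'.1, h'.2.trans h.2⟩ } }
  have : Fintype (Quotient s) := Fintype.ofFinite _
  refine ⟨Finset.univ.image fun q : Quotient s => q.out.1, ?_, fun P hP => ?_⟩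
  · intro P hP
    obtain ⟨q, _, rfl⟩ := Finset.mem_image.1 hP
    exact q.out.2
  · have hout : P.Equivalent (Quotient.mk s ⟨P, hP⟩).out.1 :=
      s.symm (Quotient.mk_out (s := s) ⟨P, hP⟩)
    refine ⟨(Quotient.mk s ⟨P, hP⟩).out.1, ⟨Finset.mem_image.2 ⟨_, Finset.mem_univ _, rfl⟩,
      hout⟩, ?_⟩
    rintro Q ⟨hQ, hPQ⟩
    obtain ⟨q, _, rfl⟩ := Finset.mem_image.1 hQ
    have : Quotient.mk s ⟨P, hP⟩ = q := by
      rw [← Quotient.out_eq q]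
      exact Quotient.sound (s := s) hPQ
    rw [this]

/-- A fixed choice of `[H ×_F K]` and of representatives. -/
noncomputable def productReps [Finite S] (F : FusionSystem T) (H K : Subgroup S) :
    Finset (OrbitPair F H K) :=
  (exists_isProductReps F H K).choose

end Products

/-! ## The centric Burnside ring -/

section Burnside

variable {S : Type u} [Group S] {T : Subgroup S}

/-- Isomorphism of centric subgroups in the fusion system, equivalently in its orbit category. -/
def centricSetoid (F : FusionSystem T) : Setoid {K : Subgroup S // F.IsCentric K} where
  r A B := F.IsIso A.1 B.1
  iseqv :=
    { refl := fun A => F.isIso_refl A.2.1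
      symm := fun h => h.symm
      trans := fun h h' => h.trans h' }

/-- Isomorphism classes of objects of the orbit category of centric subgroups. -/
def CentricClass (F : FusionSystem T) : Type u := Quotient (centricSetoid F)

/-- The isomorphism class of a centric subgroup. -/
def CentricClass.mk {F : FusionSystem T} (K : Subgroup S) (hK : F.IsCentric K) : CentricClass F :=
  Quotient.mk (centricSetoid F) ⟨K, hK⟩

/-- A representative of a class. -/
noncomputable def CentricClass.rep {F : FusionSystem T} (a : CentricClass F) : Subgroup S :=
  (Quotient.out (s := centricSetoid F) a).1

/-- The centric Burnside ring of `F` with coefficients in `R`. The objects of the additive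
completion of the orbit category of centric subgroups are the finite formal coproducts of centric
subgroups, and two of them are isomorphic if and only if their summands are isomorphic in pairs, so
that the Grothendieck group of isomorphism classes is free on the classes of centric subgroups. -/
abbrev CentricBurnside (R : Type v) [CommRing R] (F : FusionSystem T) : Type (max u v) :=
  CentricClass F →₀ R

/-- The product of the centric Burnside ring, induced by the product of the additive completion:
the product of the classes of `H` and `K` is the sum of the classes of `A` over the `(A, φ̄)` in
`[H ×_F K]`. (This is not the pointwise product of functions.) -/
noncomputable def burnsideMul [Finite S] {R : Type v} [CommRing R] {F : FusionSystem T}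
    (x y : CentricBurnside R F) : CentricBurnside R F :=
  x.sum fun a r => y.sum fun b s =>
    ∑ P ∈ productReps F a.rep b.rep, Finsupp.single (CentricClass.mk P.A P.centric) (r * s)

/-- `e` is the identity element of the centric Burnside ring. -/
def IsBurnsideOne [Finite S] {R : Type v} [CommRing R] {F : FusionSystem T}
    (e : CentricBurnside R F) : Prop :=
  ∀ x : CentricBurnside R F, burnsideMul e x = x ∧ burnsideMul x e = x

/-- `y` is the inverse of `x` in the centric Burnside ring (which then has an identity). -/
def IsBurnsideInverse [Finite S] {R : Type v} [CommRing R] {F : FusionSystem T}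
    (x y : CentricBurnside R F) : Prop :=
  ∃ e : CentricBurnside R F, IsBurnsideOne e ∧ burnsideMul x y = e ∧ burnsideMul y x = e

theorem isCentric_self [Finite S] (F : FusionSystem T) : F.IsCentric T := by
  refine ⟨le_rfl, fun K hK => ?_⟩
  obtain ⟨e, he⟩ := hK
  have hKT : K = T :=
    Subgroup.eq_of_le_of_card_ge (F.le_of_mem he).2 (Nat.card_congr e.toEquiv).le
  rw [hKT]
  exact inf_le_right

/-- The class of the underlying `p`-group of a fusion system in its centric Burnside ring. -/
noncomputable def burnsideTop [Finite S] (R : Type v) [CommRing R] (F : FusionSystem T) :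
    CentricBurnside R F :=
  Finsupp.single (CentricClass.mk T (isCentric_self F)) 1

end Burnside

/-! ## The Mackey algebra and Mackey functors -/

section Mackey

variable {S : Type u} [Group S] [Finite S]

open BisetSemiring

/-- The semiring generated by the `I_H^K`, `R_H^K` with `H ≤ K ≤ T` and the `c_φ` with `φ` an
isomorphism of the fusion system. -/
noncomputable def mackeySemiring {T : Subgroup S} (F : FusionSystem T) :
    NonUnitalSubsemiring (BisetSemiring S) :=
  NonUnitalSubsemiring.closure
    ({x | ∃ (H K : Subgroup S) (h : H ≤ K), K ≤ T ∧ (x = ind h ∨ x = res h)} ∪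
      {x | ∃ (H K : Subgroup S) (φ : H ≃* K), φ.toMonoidHom ∈ F.Hom H K ∧ x = conj φ})

theorem idUpTo_mem_mackeySemiring {T : Subgroup S} (F : FusionSystem T) :
    idUpTo T ∈ mackeySemiring F := by
  classical
  refine sum_mem fun A hA => NonUnitalSubsemiring.subset_closure (Or.inl ?_)
  exact ⟨A, A, le_refl A, (Finset.mem_filter.1 hA).2, Or.inl (ind_refl A).symm⟩

/-- The Mackey algebra of a fusion system over `S` with coefficients in `R`. Tensoring the semiring
with the ring `R` over `ℕ` is the same as tensoring its Grothendieck group with `R` over `ℤ`. -/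
abbrev MackeyAlgebra (R : Type v) [CommRing R] (F : FusionSystem (⊤ : Subgroup S)) :
    Type (max (u + 1) v) :=
  R ⊗[ℕ] ↥((mackeySemiring F).toSubsemiring (idUpTo_mem_mackeySemiring F))

variable (R : Type v) [CommRing R] (F : FusionSystem (⊤ : Subgroup S))
variable (M : Type w) [AddCommGroup M] [Module R M] [Module (MackeyAlgebra R F) M]
variable [IsScalarTower R (MackeyAlgebra R F) M]

open Classical in
/-- The action on a Mackey functor `M` of an element of the semiring generated by the `I_H^K`,
`R_H^K` and `c_φ` (elements outside that semiring act as zero by convention). -/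
noncomputable def act (x : BisetSemiring S) : Module.End R M :=
  if hx : x ∈ (mackeySemiring F).toSubsemiring (idUpTo_mem_mackeySemiring F) then
    Algebra.lsmul R R M ((1 : R) ⊗ₜ[ℕ] ⟨x, hx⟩ : MackeyAlgebra R F)
  else 0

/-- `M` is centric: `I_K^K M = 0` if `K` is not centric. -/
def IsCentricMackeyFunctor : Prop :=
  ∀ K : Subgroup S, ¬F.IsCentric K → ∀ x : M, act R F M (ind (le_refl K)) x = 0

/-- The underlying `R`-module `1 · M` of the restriction of `M` to a fusion subsystem over `T`,
where `1` is the sum of the `I_K^K` with `K ≤ T`. -/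
noncomputable def down (T : Subgroup S) : Submodule R M := LinearMap.range (act R F M (idUpTo T))

variable {M}

/-- `f` is an endomorphism of the restriction of `M` to the fusion subsystem `E` over `T`, as a
module over the Mackey algebra of `E`. -/
def IsMackeyEnd {T : Subgroup S} (E : FusionSystem T) (f : Module.End R (down R F M T)) : Prop :=
  ∀ a ∈ mackeySemiring E, ∀ x y : down R F M T,
    (y : M) = act R F M a x → (f y : M) = act R F M a (f x)

/-- A linear endomorphism of the summand `1 · M` of `M`, extended to `M` by the projection. -/
noncomputable def extend {T : Subgroup S} (f : Module.End R (down R F M T)) : Module.End R M :=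
  (down R F M T).subtype ∘ₗ f ∘ₗ (act R F M (idUpTo T)).rangeRestrict

/-- The endomorphism of the summand `1 · M` of `M` given by a linear endomorphism of `M`. -/
noncomputable def compress (T : Subgroup S) (g : Module.End R M) : Module.End R (down R F M T) :=
  (act R F M (idUpTo T)).rangeRestrict ∘ₗ g ∘ₗ (down R F M T).subtype

/-- The restriction map from endomorphisms of the restriction of `M` to a fusion system over `T` to
endomorphisms of the restriction of `M` to a fusion subsystem over `T' ≤ T`. -/
noncomputable def restrictEnd {T : Subgroup S} (T' : Subgroup S)
    (f : Module.End R (down R F M T)) : Module.End R (down R F M T') :=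
  compress R F T' (extend R F f)

open Classical in
/-- The conjugation map of an isomorphism `φ : A → φ(A)` of `F`: it sends `f` to the endomorphism
that on `I_K^K M`, where `K = φ(L)` with `L ≤ A` centric, is `x ↦ c_φ (f (c_φ⁻¹ x))`. -/
noncomputable def conjEnd {A B : Subgroup S} (φ : A →* B) (hφ : Function.Injective φ)
    (f : Module.End R (down R F M A)) : Module.End R (down R F M (FusionSystem.im φ)) :=
  compress R F (FusionSystem.im φ)
    (∑ L : {L : Subgroup S // L ≤ A ∧ F.IsCentric L},
      let ψ : L.1 →* B := φ.comp (Subgroup.inclusion L.2.1)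
      let e : L.1 ≃* FusionSystem.im ψ :=
        FusionSystem.isoIm ψ (hφ.comp (Subgroup.inclusion_injective L.2.1))
      act R F M (conj e) ∘ₗ extend R F f ∘ₗ act R F M (conj e.symm) ∘ₗ
        act R F M (ind (le_refl (FusionSystem.im ψ))))

open Classical in
/-- The transfer map from the fusion system of `H` over itself to the fusion system `E` over `T`:
for `K` centric in `E` and `x ∈ I_K^K M` it is
`tr(f)(x) = ∑ I_{φ(A)}^K c_φ f (c_φ⁻¹ R_{φ(A)}^K x)`, the sum running over `(A, φ̄)` in
`[H ×_E K]`. -/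
noncomputable def transfer {T : Subgroup S} (E : FusionSystem T) (H : Subgroup S)
    (f : Module.End R (down R F M H)) : Module.End R (down R F M T) :=
  compress R F T
    (∑ K ∈ Finset.univ.filter (fun K : Subgroup S => E.IsCentric K),
      ∑ P ∈ productReps E H K,
        act R F M (ind P.im_le) ∘ₗ act R F M (conj P.iso) ∘ₗ extend R F f ∘ₗ
          act R F M (conj P.iso.symm) ∘ₗ act R F M (res P.im_le) ∘ₗ
            act R F M (ind (le_refl K)))

variable (M) in
/-- The action of the centric Burnside ring of the fusion subsystem `E` on the restriction of `M`:
the class of `H` acts as `θ_H θ^H`, that is, as the transfer of the identity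
`x ↦ ∑ I_{φ(A)}^K c_φ c_φ⁻¹ R_{φ(A)}^K x`, and the action is extended linearly. -/
noncomputable def burnsideAct {T : Subgroup S} (E : FusionSystem T) (u : CentricBurnside R E) :
    Module.End R (down R F M T) :=
  u.sum fun a r => r • transfer R F E a.rep LinearMap.id

open Classical in
/-- The set of the `K ≤ N_S(H)` with `K` centric, `K ≠ H` and `K` isomorphic in `F` to a subgroup
of `H`. -/
noncomputable def properSubconj (H : Subgroup S) : Finset (Subgroup S) :=
  Finset.univ.filter fun K =>
    F.IsSubconj K H ∧ K ≤ Subgroup.normalizer (H : Set S) ∧ F.IsCentric K ∧ K ≠ H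

open Classical in
/-- The endomorphism `f_K`: the sum over the `(A, φ)` in `X` with `φ(A) = K` of the composites of the
restriction of `g` with the conjugate by `φ` of the restriction of `f` to `A`. -/
noncomputable def twistedConj {H N : Subgroup S} (X : Finset (OrbitPair F H N))
    (g : Module.End R (down R F M N)) (f : Module.End R (down R F M H)) (K : Subgroup S) :
    Module.End R (down R F M K) :=
  ∑ P ∈ X.filter (fun P => P.im = K),
    restrictEnd R F K
      (restrictEnd R F P.im g ∘ₗ conjEnd R F P.φ P.injective (restrictEnd R F P.A f))

end Mackey

/-- A commutative ring in which every prime other than `p` is invertible. -/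
def IsPLocalRing (p : ℕ) (R : Type v) [CommRing R] : Prop :=
  ∀ q : ℕ, q.Prime → q ≠ p → IsUnit (q : R)

end FusionMackey

set_option linter.unusedSectionVars false

namespace FusionMackey

open FusionSystem

variable {S : Type u} [Group S] {T : Subgroup S}

/-! ## Morphisms of a fusion system as functions on `S` -/

/-! The pairs in `[H ×_E K]` are the summands of a product in the additive completion of the orbit
category of centric subgroups: two morphisms `C → H` and `C → K` out of a centric `C` factor through
exactly one of the pairs (`IsProductReps.exists_factor`), and the factorization is unique in the
orbit category (`IsProductReps.factor_unique`). Uniqueness rests on the two properties collected in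
`Good`: a morphism on a centric subgroup extends to its normalizer, and two morphisms that agree on
a centric subgroup differ by a conjugation. Saturated systems have them, and so does `N_F(H)` for
`H` centric and fully normalized (`good_normalizerSystem`). Two families of spans that represent the
same functor can therefore be matched term by term (`sum_eq_sum_of_cover`). This principle gives the
commutativity and associativity of the Burnside ring, the compatibilities that make transfers
endomorphisms (`trf_mEnd`), and the mixed product formula `trf_proj_mul_trf`.

Multiplication by the class of `T` in the Burnside ring of a system over `T` is triangular with
respect to the order of subgroups, and its diagonal entry at `K` is the number of morphisms `K → T`
in the orbit category. That number is prime to `p` (`card_repTop`): `N_T(K)` acts on these morphisms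
with fixed points the morphisms defined on `N_T(K)`, and for `K = T` the number is the index of a
Sylow subgroup. Over a `p`-local ring the class is therefore invertible, and the same triangular
argument on `M` shows that the inverse acts as an inverse (`bact_mul_trf`).

The formula is then one computation. On the restriction of `M` to `N_F(H)`, the class of `N_S`
composed with the transfer of `f` to `F` is the sum over `[H ×_F N_S]` of the transfers to `N_F(H)`
of the conjugates of `f`: both sides run over triples `C → H` in `F` and `C → N_S`, `C → L` in
`N_F(H)`. If `φ(A) = H`, then `A = H` and `φ` is an automorphism of `H`, hence a morphism of
`N_F(H)`, and the term is the transfer of `f` from `H` to `N_F(H)`. There are as many such terms as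
elements of `[H ×_{N_F(H)} N_S]` (`IsProductReps.card_filter_im_eq`), so by the product formula
inside `N_F(H)` they add up to the class of `N_S` applied to that transfer. Now apply the inverse of
the class. Transfers are linear over endomorphisms of the restriction (`trf_mul`), so the inverse
moves inside the remaining transfers, which are grouped by `K = φ(A)`.

Morphisms are handled as functions `S → S`, so that restriction and change of codomain leave the
function unchanged, and endomorphisms of restrictions of `M` are handled as elements of `End_R(M)`
absorbed by a projection. -/

/-- The function `α`, restricted to `A`, is a morphism from `A` to `B`. -/
def FusionSystem.Mor (E : FusionSystem T) (α : S → S) (A B : Subgroup S) : Prop :=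
  ∃ φ ∈ E.Hom A B, ∀ a : A, (φ a : S) = α a

/-- The subgroup generated by `α(A)`. -/
def img (α : S → S) (A : Subgroup S) : Subgroup S := Subgroup.closure (α '' A)

/-- Conjugation by `t`. -/
def cj (t : S) (x : S) : S := t * x * t⁻¹

theorem cj_cj (s t x : S) : cj s (cj t x) = cj (s * t) x := by
  unfold cj; group

theorem cj_one (x : S) : cj 1 x = x := by simp [cj]

theorem cj_injective (t : S) : Function.Injective (cj t) := fun x y h => by
  simpa [cj] using h

theorem cj_mem {K : Subgroup S} {t x : S} (ht : t ∈ K) (hx : x ∈ K) : cj t x ∈ K :=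
  mul_mem (mul_mem ht hx) (inv_mem ht)

theorem cj_inv_cj (t x : S) : cj t⁻¹ (cj t x) = x := by
  rw [cj_cj, inv_mul_cancel, cj_one]

theorem cj_cj_inv (t x : S) : cj t (cj t⁻¹ x) = x := by
  rw [cj_cj, mul_inv_cancel, cj_one]

/-- Two functions agree on `C` up to conjugation by an element of `H`. -/
def Cj (H C : Subgroup S) (α α' : S → S) : Prop := ∃ h ∈ H, ∀ c ∈ C, α' c = cj h (α c)

theorem Cj.refl (H C : Subgroup S) (α : S → S) : Cj H C α α :=
  ⟨1, one_mem _, fun c _ => (cj_one _).symm⟩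

theorem Cj.of_eq {H C : Subgroup S} {α α' : S → S} (h : ∀ c ∈ C, α' c = α c) : Cj H C α α' :=
  ⟨1, one_mem _, fun c hc => by rw [h c hc, cj_one]⟩

theorem Cj.symm {H C : Subgroup S} {α α' : S → S} (h : Cj H C α α') : Cj H C α' α := by
  obtain ⟨h, hh, e⟩ := h
  exact ⟨h⁻¹, inv_mem hh, fun c hc => by rw [e c hc, cj_inv_cj]⟩

theorem Cj.trans {H C : Subgroup S} {α α' α'' : S → S} (h : Cj H C α α') (h' : Cj H C α' α'') :
    Cj H C α α'' := by
  obtain ⟨h, hh, e⟩ := h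
  obtain ⟨k, hk, e'⟩ := h'
  exact ⟨k * h, mul_mem hk hh, fun c hc => by rw [e' c hc, e c hc, cj_cj]⟩

theorem Cj.mono {H C H' C' : Subgroup S} {α α' : S → S} (h : Cj H C α α') (hH : H ≤ H')
    (hC : C' ≤ C) : Cj H' C' α α' := by
  obtain ⟨h, hh, e⟩ := h
  exact ⟨h, hH hh, fun c hc => e c (hC hc)⟩

theorem Cj.precomp {H C C' : Subgroup S} {α α' δ : S → S} (h : Cj H C α α')
    (hδ : ∀ c ∈ C', δ c ∈ C) : Cj H C' (α ∘ δ) (α' ∘ δ) := by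
  obtain ⟨h, hh, e⟩ := h
  exact ⟨h, hh, fun c hc => e _ (hδ c hc)⟩

section Mor

variable {E : FusionSystem T} {α β : S → S} {A B C : Subgroup S}

theorem FusionSystem.Mor.le_left (h : E.Mor α A B) : A ≤ T := by
  obtain ⟨φ, hφ, -⟩ := h; exact (E.le_of_mem hφ).1

theorem FusionSystem.Mor.le_right (h : E.Mor α A B) : B ≤ T := by
  obtain ⟨φ, hφ, -⟩ := h; exact (E.le_of_mem hφ).2

theorem FusionSystem.Mor.mem (h : E.Mor α A B) {a : S} (ha : a ∈ A) : α a ∈ B := by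
  obtain ⟨φ, -, e⟩ := h
  rw [← e ⟨a, ha⟩]
  exact (φ _).2

theorem FusionSystem.Mor.map_mul (h : E.Mor α A B) {x y : S} (hx : x ∈ A) (hy : y ∈ A) :
    α (x * y) = α x * α y := by
  obtain ⟨φ, -, e⟩ := h
  have := congrArg Subtype.val (φ.map_mul ⟨x, hx⟩ ⟨y, hy⟩)
  rwa [Subgroup.coe_mul, e, e, e] at this

theorem FusionSystem.Mor.map_one (h : E.Mor α A B) : α 1 = 1 := by
  have := h.map_mul (one_mem A) (one_mem A)
  rwa [mul_one, left_eq_mul] at this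

theorem FusionSystem.Mor.map_inv (h : E.Mor α A B) {x : S} (hx : x ∈ A) : α x⁻¹ = (α x)⁻¹ := by
  rw [eq_inv_iff_mul_eq_one, ← h.map_mul (inv_mem hx) hx, inv_mul_cancel, h.map_one]

theorem FusionSystem.Mor.map_cj (h : E.Mor α A B) {x y : S} (hx : x ∈ A) (hy : y ∈ A) :
    α (cj x y) = cj (α x) (α y) := by
  rw [cj, h.map_mul (mul_mem hx hy) (inv_mem hx), h.map_mul hx hy, h.map_inv hx, cj]

theorem FusionSystem.Mor.inj (h : E.Mor α A B) {x y : S} (hx : x ∈ A) (hy : y ∈ A)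
    (e : α x = α y) : x = y := by
  obtain ⟨φ, hφ, he⟩ := h
  rw [← he ⟨x, hx⟩, ← he ⟨y, hy⟩] at e
  exact congrArg Subtype.val (E.injective_of_mem hφ (Subtype.ext e))

theorem FusionSystem.Mor.congr (h : E.Mor α A B) (e : ∀ a ∈ A, β a = α a) : E.Mor β A B := by
  obtain ⟨φ, hφ, he⟩ := h
  exact ⟨φ, hφ, fun a => (he a).trans (e a a.2).symm⟩

theorem FusionSystem.Mor.comp (h : E.Mor α A B) (h' : E.Mor β B C) : E.Mor (β ∘ α) A C := by
  obtain ⟨φ, hφ, he⟩ := h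
  obtain ⟨ψ, hψ, he'⟩ := h'
  exact ⟨ψ.comp φ, E.comp_mem hφ hψ, fun a => by
    rw [MonoidHom.comp_apply, he', he]; rfl⟩

theorem FusionSystem.mor_cj (E : FusionSystem T) {t : S} (ht : t ∈ T) (hA : A ≤ T) (hB : B ≤ T)
    (h : ∀ a ∈ A, cj t a ∈ B) : E.Mor (cj t) A B := by
  let φ : A →* B := ((MulAut.conj t).toMonoidHom.comp A.subtype).codRestrict B fun a => h a a.2
  exact ⟨φ, E.conj_mem φ hA hB ⟨t, ht, fun a => rfl⟩, fun a => rfl⟩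

theorem FusionSystem.mor_id (E : FusionSystem T) (hAB : A ≤ B) (hB : B ≤ T) : E.Mor id A B :=
  (E.mor_cj (one_mem T) (hAB.trans hB) hB fun a ha => by rw [cj_one]; exact hAB ha).congr
    fun a _ => (cj_one a).symm

theorem FusionSystem.Mor.restrict (h : E.Mor α A B) (hC : C ≤ A) : E.Mor α C B :=
  (E.mor_id hC h.le_left).comp h

theorem FusionSystem.Mor.mem_img (h : E.Mor α A B) {y : S} : y ∈ img α A ↔ ∃ a ∈ A, α a = y := by
  constructor
  · intro hy
    refine Subgroup.closure_induction (p := fun y _ => ∃ a ∈ A, α a = y) ?_ ?_ ?_ ?_ hy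
    · rintro _ ⟨a, ha, rfl⟩
      exact ⟨a, ha, rfl⟩
    · exact ⟨1, one_mem _, h.map_one⟩
    · rintro _ _ _ _ ⟨a, ha, rfl⟩ ⟨b, hb, rfl⟩
      exact ⟨a * b, mul_mem ha hb, h.map_mul ha hb⟩
    · rintro _ _ ⟨a, ha, rfl⟩
      exact ⟨a⁻¹, inv_mem ha, h.map_inv ha⟩
  · rintro ⟨a, ha, rfl⟩
    exact Subgroup.subset_closure ⟨a, ha, rfl⟩

theorem mem_img_of_mem {a : S} (ha : a ∈ A) : α a ∈ img α A :=
  Subgroup.subset_closure ⟨a, ha, rfl⟩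

theorem img_le (h : ∀ a ∈ A, α a ∈ B) : img α A ≤ B := by
  rw [img, Subgroup.closure_le]
  rintro _ ⟨a, ha, rfl⟩
  exact h a ha

theorem img_congr (h : ∀ a ∈ A, β a = α a) : img β A = img α A := by
  rw [img, img]
  congr 1
  exact Set.image_congr h

theorem img_id (A : Subgroup S) : img id A = A := by
  rw [img, Set.image_id, Subgroup.closure_eq]

theorem FusionSystem.Mor.img_le (h : E.Mor α A B) : img α A ≤ B :=
  FusionMackey.img_le fun _ ha => h.mem ha

/-- A morphism as an isomorphism onto its image. -/
theorem FusionSystem.Mor.exists_equiv (h : E.Mor α A B) :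
    ∃ e : A ≃* img α A, e.toMonoidHom ∈ E.Hom A (img α A) ∧
      e.symm.toMonoidHom ∈ E.Hom (img α A) A ∧ ∀ a : A, (e a : S) = α a := by
  have h' := h
  obtain ⟨φ, hφ, he⟩ := h
  let f : A →* img α A := (B.subtype.comp φ).codRestrict _ fun a => by
    change (φ a : S) ∈ _
    rw [he]
    exact mem_img_of_mem a.2
  have hf : ∀ a : A, (f a : S) = φ a := fun a => rfl
  have hb : Function.Bijective f := by
    constructor
    · intro x y hxy
      exact E.injective_of_mem hφ (Subtype.ext (by rw [← hf, ← hf, hxy]))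
    · rintro ⟨y, hy⟩
      obtain ⟨a, ha, rfl⟩ := h'.mem_img.1 hy
      exact ⟨⟨a, ha⟩, Subtype.ext (he _)⟩
  refine ⟨MulEquiv.ofBijective f hb, (E.iso_mem _ hφ fun a => rfl).1,
    (E.iso_mem _ hφ fun a => rfl).2, fun a => he a⟩

theorem FusionSystem.Mor.onto (h : E.Mor α A B) : E.Mor α A (img α A) := by
  obtain ⟨e, he, -, h'⟩ := h.exists_equiv
  exact ⟨_, he, h'⟩

theorem FusionSystem.Mor.isIso (h : E.Mor α A B) : E.IsIso A (img α A) := by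
  obtain ⟨e, he, -, h'⟩ := h.exists_equiv
  exact ⟨e, he⟩

theorem FusionSystem.Mor.cod (h : E.Mor α A B) (hm : ∀ a ∈ A, α a ∈ C) (hC : C ≤ T) :
    E.Mor α A C :=
  h.onto.comp (E.mor_id (FusionMackey.img_le hm) hC)

theorem FusionSystem.Mor.card_img (h : E.Mor α A B) :
    Nat.card (img α A) = Nat.card A := by
  obtain ⟨e, -⟩ := h.exists_equiv
  exact (Nat.card_congr e.toEquiv).symm

theorem FusionSystem.Mor.img_mono (h : E.Mor α A B) (hC : C ≤ A) : img α C ≤ img α A :=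
  FusionMackey.img_le fun _ hc => mem_img_of_mem (hC hc)

/-- An inverse function of `α` on `α(A)`. -/
noncomputable def finv (α : S → S) (A : Subgroup S) : S → S := Function.invFunOn α A

theorem FusionSystem.Mor.finv_apply (h : E.Mor α A B) {a : S} (ha : a ∈ A) :
    finv α A (α a) = a :=
  h.inj (Function.invFunOn_mem ⟨a, ha, rfl⟩) ha (Function.invFunOn_eq (s := (A : Set S)) ⟨a, ha, rfl⟩)

theorem FusionSystem.Mor.apply_finv (h : E.Mor α A B) {b : S} (hb : b ∈ img α A) :
    α (finv α A b) = b := by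
  obtain ⟨a, ha, rfl⟩ := h.mem_img.1 hb
  rw [h.finv_apply ha]

theorem FusionSystem.Mor.finv (h : E.Mor α A B) : E.Mor (finv α A) (img α A) A := by
  obtain ⟨e, -, he, h'⟩ := h.exists_equiv
  refine ⟨_, he, fun b => ?_⟩
  have : (b : S) = α (e.symm b) := by rw [← h', e.apply_symm_apply]
  conv_rhs => rw [this]
  rw [h.finv_apply (e.symm b).2]
  rfl

theorem FusionSystem.Mor.img_finv (h : E.Mor α A B) : img (FusionMackey.finv α A) (img α A) = A := by
  refine le_antisymm h.finv.img_le fun a ha => ?_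
  rw [← h.finv_apply ha]
  exact mem_img_of_mem (mem_img_of_mem ha)

theorem img_comp (h : E.Mor α A B) : img (β ∘ α) A = img β (img α A) := by
  rw [img, Set.image_comp]
  conv_rhs => rw [img]
  congr 2
  ext y
  exact h.mem_img.symm

theorem FusionSystem.isIso_iff_mor : E.IsIso A B ↔ ∃ α, E.Mor α A B ∧ img α A = B := by
  constructor
  · rintro ⟨e, he⟩
    classical
    let α : S → S := fun x => if hx : x ∈ A then e ⟨x, hx⟩ else 1
    have hα : E.Mor α A B := ⟨_, he, fun a => by simp [α]⟩
    refine ⟨α, hα, le_antisymm hα.img_le fun b hb => ?_⟩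
    rw [hα.mem_img]
    exact ⟨e.symm ⟨b, hb⟩, (e.symm _).2, by simp [α]⟩
  · rintro ⟨α, h, rfl⟩
    exact h.isIso

theorem FusionSystem.Mor.of_isPGroup_card_le [Finite S] (h : E.Mor α A B)
    (hc : Nat.card B ≤ Nat.card A) : img α A = B :=
  Subgroup.eq_of_le_of_card_ge h.img_le (by rwa [h.card_img])

end Mor

/-! ## Centric subgroups -/

section Centric

variable {E : FusionSystem T} {α β : S → S} {A B C : Subgroup S}

/-- An isomorphic copy of `A` is the image of a morphism defined on `A`, so centricity becomes a
membership test for elements centralizing an image. It is used in this form throughout. -/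
theorem FusionSystem.isCentric_iff : E.IsCentric A ↔
    A ≤ T ∧ ∀ α, E.Mor α A T → ∀ z ∈ T, (∀ a ∈ A, cj z (α a) = α a) → z ∈ img α A := by
  refine and_congr_right fun hA => ⟨fun h α hα z hz hc => ?_, fun h K hK z hz => ?_⟩
  · refine h _ hα.isIso ⟨Subgroup.mem_centralizer_iff.2 fun x hx => ?_, hz⟩
    obtain ⟨a, ha, rfl⟩ := hα.mem_img.1 hx
    have := hc a ha
    rw [cj, mul_inv_eq_iff_eq_mul] at this
    exact this.symm
  · obtain ⟨α, hα, rfl⟩ := isIso_iff_mor.1 hK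
    refine h α (hα.cod (fun a ha => hα.le_right (hα.mem ha)) le_rfl) z hz.2 fun a ha => ?_
    have := Subgroup.mem_centralizer_iff.1 hz.1 _ (mem_img_of_mem ha)
    rw [cj, ← this, mul_inv_cancel_right]

theorem FusionSystem.IsCentric.mem_img (h : E.IsCentric A) (hα : E.Mor α A B) {z : S} (hz : z ∈ T)
    (hc : ∀ a ∈ A, cj z (α a) = α a) : z ∈ img α A :=
  (isCentric_iff.1 h).2 α (hα.cod (fun _ ha => hα.le_right (hα.mem ha)) le_rfl) z hz hc

theorem FusionSystem.IsCentric.mono (h : E.IsCentric A) (hAB : A ≤ B) (hB : B ≤ T) :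
    E.IsCentric B :=
  isCentric_iff.2 ⟨hB, fun _ hα _ hz hc => hα.img_mono hAB
    (h.mem_img (hα.restrict hAB) hz fun a ha => hc a (hAB ha))⟩

theorem FusionSystem.IsCentric.img (h : E.IsCentric A) (hα : E.Mor α A B) :
    E.IsCentric (img α A) := by
  refine ⟨hα.img_le.trans hα.le_right, fun K hK => h.2 K (hα.isIso.trans hK)⟩

theorem FusionSystem.IsCentric.of_mor (h : E.IsCentric A) (hα : E.Mor α A B) : E.IsCentric B :=
  (h.img hα).mono hα.img_le hα.le_right

theorem FusionSystem.IsCentric.of_isIso (h : E.IsCentric A) (hα : E.IsIso A B) :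
    E.IsCentric B := by
  obtain ⟨α, hα, rfl⟩ := isIso_iff_mor.1 hα
  exact h.img hα

/-- Inclusion of fusion systems. -/
def FusionSystem.Sub {T' : Subgroup S} (E : FusionSystem T) (F : FusionSystem T') : Prop :=
  ∀ α A B, E.Mor α A B → F.Mor α A B

theorem FusionSystem.Sub.refl (E : FusionSystem T) : E.Sub E := fun _ _ _ h => h

theorem FusionSystem.Sub.le {T' : Subgroup S} {F : FusionSystem T'} (h : E.Sub F) : T ≤ T' :=
  (h _ _ _ (E.mor_id le_rfl le_rfl)).le_left

/-- A subsystem has fewer conjugates of `A`, and its centralizers are taken in a smaller group. -/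
theorem FusionSystem.Sub.centric {T' : Subgroup S} {F : FusionSystem T'} (h : E.Sub F)
    (hA : F.IsCentric A) (hT : A ≤ T) : E.IsCentric A :=
  isCentric_iff.2 ⟨hT, fun _ hα _ hz hc => hA.mem_img (h _ _ _ hα) (h.le hz) hc⟩

end Centric

/-! ### Domains of extension and the growth of normalizers. -/

/-- The elements of `N_T(C)` whose conjugation action on `C` is transported by `β` to the action of
an element of `U`. -/
def nphi (T U C : Subgroup S) (β : S → S) : Subgroup S where
  carrier := {x | x ∈ T ∧ (∀ c, cj x c ∈ C ↔ c ∈ C) ∧ ∃ z ∈ U, ∀ c ∈ C, β (cj x c) = cj z (β c)}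
  one_mem' := ⟨one_mem _, fun c => by rw [cj_one], 1, one_mem _, fun c _ => by simp only [cj_one]⟩
  mul_mem' := by
    rintro x y ⟨hx, hx', z, hz, h⟩ ⟨hy, hy', w, hw, h'⟩
    refine ⟨mul_mem hx hy, fun c => by rw [← cj_cj, hx', hy'], z * w, mul_mem hz hw, fun c hc => ?_⟩
    rw [← cj_cj, h _ ((hy' c).2 hc), h' c hc, cj_cj]
  inv_mem' := by
    rintro x ⟨hx, hx', z, hz, h⟩
    have h1 : ∀ c, cj x⁻¹ c ∈ C ↔ c ∈ C := fun c => by rw [← hx', cj_cj_inv]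
    refine ⟨inv_mem hx, h1, z⁻¹, inv_mem hz, fun c hc => ?_⟩
    have := h _ ((h1 c).2 hc)
    rw [cj_cj_inv] at this
    rw [this, cj_inv_cj]

theorem nphi_mono {T U T' U' C : Subgroup S} {β : S → S} (hT : T ≤ T') (hU : U ≤ U') :
    nphi T U C β ≤ nphi T' U' C β := by
  rintro x ⟨h, h', z, hz, h''⟩
  exact ⟨hT h, h', z, hU hz, h''⟩

theorem cj_mem_iff_of_mem {C : Subgroup S} {x : S} (hx : x ∈ C) (c : S) : cj x c ∈ C ↔ c ∈ C := by
  refine ⟨fun h => ?_, cj_mem hx⟩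
  rw [← cj_inv_cj x c]
  exact cj_mem (inv_mem hx) h

theorem mem_normalizer_iff_cj {C : Subgroup S} {x : S} :
    x ∈ Subgroup.normalizer (C : Set S) ↔ ∀ c, cj x c ∈ C ↔ c ∈ C := by
  rw [Subgroup.mem_normalizer_iff]
  exact forall_congr' fun c => Iff.comm

theorem FusionSystem.Mor.le_nphi {E : FusionSystem T} {U C K D : Subgroup S} {β : S → S}
    (h : E.Mor β C K) (hD : C ≤ D) (hK : K ≤ U) : C ≤ nphi D U C β := fun x hx =>
  ⟨hD hx, cj_mem_iff_of_mem hx, β x, hK (h.mem hx), fun _ hc => h.map_cj hx hc⟩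

/-- Normalizers grow in the nilpotent group `A`. The inductions over centric subgroups climb by this
step. -/
theorem lt_normalizer_inf {p : ℕ} [Fact p.Prime] [Finite S] {D A : Subgroup S}
    (hA : IsPGroup p A) (h : D < A) : D < A ⊓ Subgroup.normalizer (D : Set S) := by
  have := hA.isNilpotent
  have hlt : D.subgroupOf A < ⊤ := by
    rw [lt_top_iff_ne_top, Ne, Subgroup.subgroupOf_eq_top]
    exact not_le_of_gt h
  have := Group.normalizerCondition_of_isNilpotent (G := A) _ hlt
  obtain ⟨x, hx, hx'⟩ := SetLike.exists_of_lt this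
  suffices hxn : (x : S) ∈ Subgroup.normalizer (D : Set S) from
    lt_of_le_of_ne (le_inf h.le Subgroup.le_normalizer) fun e => hx' (by
      have hxD : (x : S) ∈ A ⊓ Subgroup.normalizer (D : Set S) := ⟨x.2, hxn⟩
      rw [← e] at hxD
      exact hxD)
  rw [mem_normalizer_iff_cj]
  have hle : ∀ y : A, y ∈ Subgroup.normalizer ((D.subgroupOf A : Subgroup A) : Set A) →
      ∀ c ∈ D, cj (y : S) c ∈ D := fun y hy c hc =>
    (Subgroup.mem_normalizer_iff.1 hy ⟨c, h.le hc⟩).1 hc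
  refine fun c => ⟨fun hc => ?_, hle x hx c⟩
  have := hle x⁻¹ (inv_mem hx) _ hc
  rwa [Subgroup.coe_inv, cj_inv_cj] at this

/-! ## Fusion systems with the extension and uniqueness properties of saturated ones -/

/-- Extension and uniqueness of extensions for morphisms defined on centric subgroups. -/
structure FusionSystem.Good (E : FusionSystem T) : Prop where
  epi : ∀ {K L : Subgroup S} {φ ψ : S → S}, E.IsCentric K → K ≤ L → E.Mor φ L T → E.Mor ψ L T →
    (∀ x ∈ K, ψ x = φ x) → ∃ z ∈ T, ∀ x ∈ L, ψ x = cj z (φ x)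
  ext : ∀ {C : Subgroup S} {β : S → S}, E.IsCentric C → E.Mor β C T →
    ∃ β' : S → S, E.Mor β' (nphi T T C β) T ∧ ∀ c ∈ C, β' c = β c

theorem FusionSystem.Mor.top {E : FusionSystem T} {A B : Subgroup S} {α : S → S}
    (h : E.Mor α A B) : E.Mor α A T := h.cod (fun _ ha => h.le_right (h.mem ha)) le_rfl

section Good

variable {E : FusionSystem T}

/-- The conjugating element centralizes `φ(K)`, so centricity of `K` puts it in `φ(K)` and hence in
`D`. -/
theorem FusionSystem.Good.epi_mem (hE : E.Good) {K L D : Subgroup S} {φ ψ : S → S}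
    (hK : E.IsCentric K) (hKL : K ≤ L) (hφ : E.Mor φ L T) (hψ : E.Mor ψ L T)
    (h : ∀ x ∈ K, ψ x = φ x) (hD : ∀ x ∈ K, φ x ∈ D) : Cj D L φ ψ := by
  obtain ⟨z, hz, hz'⟩ := hE.epi hK hKL hφ hψ h
  refine ⟨z, img_le hD (hK.mem_img (hφ.restrict hKL) hz fun a ha => ?_), hz'⟩
  rw [← hz' a (hKL ha), h a ha]

/-- The extension cannot leave `K`: on `β(C)` the element `β' x` acts as some `z ∈ K`, so by
centricity the two differ by an element of `β(C) ≤ K`. -/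
theorem FusionSystem.Good.ext_mem (hE : E.Good) {C H K : Subgroup S} {β : S → S}
    (hC : E.IsCentric C) (hβ : E.Mor β C K) (hH : H ≤ T) :
    ∃ β' : S → S, E.Mor β' (nphi H K C β) K ∧ ∀ c ∈ C, β' c = β c := by
  obtain ⟨β', hβ', h⟩ := hE.ext hC hβ.top
  refine ⟨β', (hβ'.restrict (nphi_mono hH hβ.le_right)).cod (fun x hx => ?_) hβ.le_right, h⟩
  have hx' := nphi_mono hH hβ.le_right hx
  obtain ⟨hxH, hxC, z, hz, hxz⟩ := hx
  have hle : C ≤ nphi T T C β := hβ.le_nphi hC.1 hβ.le_right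
  have : z⁻¹ * β' x ∈ img β C := by
    refine hC.mem_img hβ (mul_mem (inv_mem (hβ.le_right hz)) (hβ'.mem hx')) fun c hc => ?_
    rw [← cj_cj, ← h c hc, ← hβ'.map_cj hx' (hle hc), h _ ((hxC c).2 hc), hxz c hc, cj_inv_cj,
      h c hc]
  have := mul_mem hz (hβ.img_le this)
  rwa [mul_inv_cancel_left] at this

/-! ### Maximal pairs and their uniqueness. -/

/-- `(A, φ)` is maximal among the pairs `(B, ψ)` with `B ≤ H` and `ψ : B → K`, for inclusion. -/
structure MaxPair (E : FusionSystem T) (H K A : Subgroup S) (φ : S → S) : Prop where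
  le : A ≤ H
  centric : E.IsCentric A
  mor : E.Mor φ A K
  max : ∀ B ψ, A ≤ B → B ≤ H → E.Mor ψ B K → Cj K A φ ψ → B ≤ A

theorem exists_maxPair [Finite S] {H K C : Subgroup S} {β : S → S} (hC : E.IsCentric C) (hCH : C ≤ H)
    (hβ : E.Mor β C K) : ∃ A φ, C ≤ A ∧ MaxPair E H K A φ ∧ Cj K C β φ := by
  induction C using WellFoundedGT.induction generalizing β with
  | ind C ih =>
    by_cases hm : MaxPair E H K C β
    · exact ⟨C, β, le_rfl, hm, Cj.refl _ _ _⟩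
    · have : ∃ B ψ, C ≤ B ∧ B ≤ H ∧ E.Mor ψ B K ∧ Cj K C β ψ ∧ ¬B ≤ C := by
        by_contra hcon
        push Not at hcon
        exact hm ⟨hCH, hC, hβ, hcon⟩
      obtain ⟨B, ψ, hCB, hBH, hψ, hj, hBC⟩ := this
      obtain ⟨A, φ, hBA, hA, hj'⟩ := ih B (lt_of_le_not_ge hCB hBC) (hC.mono hCB hψ.le_left) hBH hψ
      exact ⟨A, φ, hCB.trans hBA, hA, hj.trans (hj'.mono le_rfl hCB)⟩

/-- For `x ∈ A` normalizing `D`, the required element of `K` is `φ x`, up to the conjugation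
relating `φ` to `β`. -/
theorem inf_normalizer_le_nphi {H K A D : Subgroup S} {φ β : S → S} (hA : A ≤ H)
    (hφ : E.Mor φ A K) (hDA : D ≤ A) (h : Cj K D φ β) :
    A ⊓ Subgroup.normalizer (D : Set S) ≤ nphi H K D β := by
  rintro x ⟨hxA, hxD⟩
  have hxD' := mem_normalizer_iff_cj.1 hxD
  obtain ⟨k, hk, h⟩ := h
  refine ⟨hA hxA, hxD', cj k (φ x), cj_mem hk (hφ.mem hxA), fun c hc => ?_⟩
  rw [h _ ((hxD' c).2 hc), h c hc, hφ.map_cj hxA (hDA hc)]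
  unfold cj
  group

/-- Upward induction on `D`. If `D` is proper in both subgroups, extend `φ` from `D` to its domain
of extension and choose a maximal pair `(M, μ)` above the extension. Both given pairs agree with `μ`
on `A ⊓ N(D)` and `B ⊓ N(D)`, which are larger than `D`, so both subgroups are `M` by induction. The
uniqueness half of the product property comes from here. -/
theorem MaxPair.eq_of_agree {p : ℕ} [Fact p.Prime] [Finite S] (hS : IsPGroup p S) (hE : E.Good)
    {H K A B D : Subgroup S} {φ ψ : S → S} (hH : H ≤ T) (hA : MaxPair E H K A φ)
    (hB : MaxPair E H K B ψ) (hD : E.IsCentric D) (hDA : D ≤ A) (hDB : D ≤ B)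
    (h : Cj K D φ ψ) : A = B ∧ Cj K A φ ψ := by
  induction D using WellFoundedGT.induction generalizing A B φ ψ with
  | ind D ih =>
    rcases hDA.eq_or_lt with rfl | hDA'
    · exact ⟨le_antisymm hDB (hA.max B ψ hDB hB.le hB.mor h), h⟩
    rcases hDB.eq_or_lt with rfl | hDB'
    · obtain rfl : A = D := le_antisymm (hB.max A φ hDA hA.le hA.mor h.symm) hDA
      exact ⟨rfl, h⟩
    have hφD := hA.mor.restrict hDA
    obtain ⟨β, hβ, hβφ⟩ := hE.ext_mem hD hφD hH
    have hDN : D ≤ nphi H K D φ := hφD.le_nphi (hDA.trans hA.le) le_rfl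
    obtain ⟨M, μ, hNM, hM, hj⟩ := exists_maxPair (hD.mono hDN hβ.le_left)
      (fun x hx => hx.1) hβ
    have key : ∀ {A' : Subgroup S} {φ' : S → S}, MaxPair E H K A' φ' → D < A' → Cj K D φ' φ →
        A' = M ∧ Cj K A' φ' μ := by
      intro A' φ' hA' hlt hj'
      have hle : A' ⊓ Subgroup.normalizer (D : Set S) ≤ nphi H K D φ :=
        inf_normalizer_le_nphi hA'.le hA'.mor hlt.le hj'
      have hlt' := lt_normalizer_inf (hS.to_subgroup A') hlt
      refine ih _ hlt' hA' hM (hD.mono hlt'.le (hle.trans hβ.le_left)) inf_le_left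
        (hle.trans hNM) ?_
      refine Cj.trans ?_ (hj.mono le_rfl hle)
      obtain ⟨k, hk, hk'⟩ := hj'
      -- Once corrected by `k`, the morphism `φ'` agrees with `β` on `D` exactly, and uniqueness of
      -- extensions compares them on `A' ⊓ N(D)`.
      have h1 : E.Mor (cj k ∘ φ') (A' ⊓ Subgroup.normalizer (D : Set S)) K :=
        (hA'.mor.restrict inf_le_left).comp (E.mor_cj (hA'.mor.le_right hk) hA'.mor.le_right
          hA'.mor.le_right fun a ha => cj_mem hk ha)
      have h2 : Cj K (A' ⊓ Subgroup.normalizer (D : Set S)) (cj k ∘ φ') β := by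
        refine hE.epi_mem hD hlt'.le h1.top (hβ.restrict hle).top (fun x hx => ?_)
          fun x hx => h1.mem (hlt'.le hx)
        rw [hβφ x hx, hk' x hx]
        rfl
      exact Cj.trans ⟨k, hk, fun c _ => rfl⟩ h2
    obtain ⟨rfl, h1⟩ := key hA hDA' (Cj.refl _ _ _)
    obtain ⟨rfl, h2⟩ := key hB hDB' h.symm
    exact ⟨rfl, h1.trans h2.symm⟩

end Good

/-! ## Pairs as functions -/

namespace OrbitPair

variable {E : FusionSystem T} {H K : Subgroup S}

open Classical in
/-- The morphism of a pair as a function on `S`. -/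
noncomputable def fn (P : OrbitPair E H K) (x : S) : S := if h : x ∈ P.A then P.φ ⟨x, h⟩ else 1

theorem fn_apply (P : OrbitPair E H K) {x : S} (h : x ∈ P.A) : P.fn x = P.φ ⟨x, h⟩ := by
  rw [fn, dif_pos h]

theorem mor (P : OrbitPair E H K) : E.Mor P.fn P.A K :=
  ⟨P.φ, P.mem, fun a => by rw [P.fn_apply a.2]⟩

theorem im_eq (P : OrbitPair E H K) : P.im = img P.fn P.A := by
  ext y
  rw [P.mor.mem_img]
  constructor
  · rintro ⟨a, rfl⟩
    exact ⟨a, a.2, P.fn_apply a.2⟩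
  · rintro ⟨a, ha, rfl⟩
    exact ⟨⟨a, ha⟩, (P.fn_apply ha).symm⟩

theorem exists_of_mor {A : Subgroup S} {φ : S → S} (hA : A ≤ H) (hc : E.IsCentric A)
    (hφ : E.Mor φ A K) : ∃ P : OrbitPair E H K, P.A = A ∧ ∀ a ∈ A, P.fn a = φ a := by
  obtain ⟨φ', h, h'⟩ := hφ
  refine ⟨⟨A, φ', hA, hc, h⟩, rfl, fun a ha => ?_⟩
  rw [fn_apply _ ha]
  exact h' _

theorem below_iff {P Q : OrbitPair E H K} : P.Below Q ↔
    ∃ h ∈ H, (∀ a ∈ P.A, cj h a ∈ Q.A) ∧ Cj K P.A P.fn (Q.fn ∘ cj h) := by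
  constructor
  · rintro ⟨h, hh, hle, k, hk⟩
    have h1 : ∀ a ∈ P.A, cj h⁻¹ a ∈ Q.A := fun a ha => hle _ (by
      have := cj_cj_inv h a
      rw [cj] at this
      rwa [this])
    refine ⟨h⁻¹, inv_mem hh, h1, k, k.2, fun a ha => ?_⟩
    have e : h * cj h⁻¹ a * h⁻¹ = a := cj_cj_inv h a
    have := congrArg Subtype.val (hk (cj h⁻¹ a) (by rwa [e]))
    rw [Function.comp_apply, Q.fn_apply (h1 a ha), this, P.fn_apply ha]
    simp only [e]
    rfl
  · rintro ⟨h, hh, hle, k, hk, e⟩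
    have h1 : ∀ x, h⁻¹ * x * h⁻¹⁻¹ ∈ P.A → x ∈ Q.A := fun x hx => by
      have := hle _ hx
      rwa [← cj, cj_cj_inv] at this
    refine ⟨h⁻¹, inv_mem hh, h1, ⟨k, hk⟩, fun x hx => Subtype.ext ?_⟩
    have := e _ hx
    rw [Function.comp_apply, ← cj, cj_cj_inv, Q.fn_apply (h1 x hx)] at this
    rw [this, P.fn_apply (x := cj h⁻¹ x) hx]
    rfl

/-- Maximality for `Below` only bounds `B` up to conjugation in `H`, but this bounds its order,
which suffices as `P.A ≤ B`. -/
theorem IsMaximal.maxPair [Finite S] {P : OrbitPair E H K} (hP : P.IsMaximal) :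
    MaxPair E H K P.A P.fn := by
  refine ⟨P.le, P.centric, P.mor, fun B ψ hB hBH hψ hj => ?_⟩
  obtain ⟨Q, rfl, hQ⟩ := exists_of_mor hBH (P.centric.mono hB hψ.le_left) hψ
  have : P.Below Q := below_iff.2 ⟨1, one_mem _, fun a ha => by rw [cj_one]; exact hB ha, by
    obtain ⟨k, hk, e⟩ := hj
    refine ⟨k, hk, fun c hc => ?_⟩
    rw [Function.comp_apply, cj_one, hQ c (hB hc), e c hc]⟩
  obtain ⟨h, hh, hle, -⟩ := below_iff.1 (hP Q this)
  have hm : E.Mor id Q.A T := E.mor_id (Q.centric.1) le_rfl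
  have hcard : Nat.card Q.A ≤ Nat.card P.A :=
    Nat.card_le_card_of_injective (fun x : Q.A => (⟨cj h x, hle x x.2⟩ : P.A)) fun x y hxy =>
      Subtype.ext (cj_injective h (congrArg Subtype.val hxy))
  exact (Subgroup.eq_of_le_of_card_ge hB hcard).ge

/-- A pair above `P` by way of `h` contains `P` literally once it is transported by `h⁻¹`. -/
theorem isMaximal_of_maxPair [Finite S] {P : OrbitPair E H K} (hH : H ≤ T)
    (hP : MaxPair E H K P.A P.fn) : P.IsMaximal := by
  intro Q hPQ
  obtain ⟨h, hh, hle, hj⟩ := below_iff.1 hPQ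
  have hm : E.Mor (cj h⁻¹) Q.A T := E.mor_cj (inv_mem (hH hh)) Q.centric.1 le_rfl
    fun a ha => cj_mem (inv_mem (hH hh)) (Q.centric.1 ha)
  have hfin : ∀ x, x ∈ img (cj h⁻¹) Q.A ↔ cj h x ∈ Q.A := by
    intro x
    rw [hm.mem_img]
    constructor
    · rintro ⟨a, ha, rfl⟩
      rwa [cj_cj_inv]
    · exact fun hx => ⟨_, hx, cj_inv_cj h x⟩
  have h1 : E.Mor (cj h) (img (cj h⁻¹) Q.A) Q.A :=
    E.mor_cj (hH hh) hm.img_le Q.centric.1 fun a ha => (hfin a).1 ha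
  have h2 := hP.max (img (cj h⁻¹) Q.A) (Q.fn ∘ cj h) (fun a ha => (hfin a).2 (hle a ha))
    (img_le fun a ha => cj_mem (inv_mem hh) (Q.le ha)) (h1.comp Q.mor) hj
  refine below_iff.2 ⟨h⁻¹, inv_mem hh, fun a ha => h2 (mem_img_of_mem ha), ?_⟩
  obtain ⟨k, hk, e⟩ := hj
  refine ⟨k⁻¹, inv_mem hk, fun c hc => ?_⟩
  have := e (cj h⁻¹ c) (h2 (mem_img_of_mem hc))
  rw [Function.comp_apply, cj_cj_inv] at this
  rw [this, cj_inv_cj]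
  rfl

end OrbitPair

/-! ### The universal property of `[H ×_E K]` in the orbit category. -/

section Reps

variable {p : ℕ} [Fact p.Prime] [Finite S] {E : FusionSystem T} {H K C : Subgroup S}
  {X : Finset (OrbitPair E H K)} {α β : S → S}

/-- Transport `β` to the subgroup `α(C)` of `H`, enlarge it to a maximal pair, and pass to the
equivalent representative. The factor `δ` is `α` followed by a conjugation in `H`. -/
theorem IsProductReps.exists_factor (hX : IsProductReps E H K X) (hC : E.IsCentric C)
    (hα : E.Mor α C H) (hβ : E.Mor β C K) : ∃ P ∈ X, ∃ δ, E.Mor δ C P.A ∧ Cj H C α δ ∧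
      Cj K C β (P.fn ∘ δ) := by
  obtain ⟨A, φ, hCA, hA, k, hk, hj⟩ := exists_maxPair (hC.img hα) hα.img_le (hα.finv.comp hβ)
  obtain ⟨P, rfl, hP⟩ := OrbitPair.exists_of_mor hA.le hA.centric hA.mor
  have hPm : P.IsMaximal := OrbitPair.isMaximal_of_maxPair hα.le_right
    ⟨hA.le, hA.centric, P.mor, fun B ψ h1 h2 h3 h4 => hA.max B ψ h1 h2 h3
      ((Cj.of_eq fun c hc => (hP c hc)).trans h4)⟩
  obtain ⟨Q, ⟨hQ, hPQ⟩, -⟩ := hX.2 P hPm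
  obtain ⟨h, hh, hle, hj'⟩ := OrbitPair.below_iff.1 hPQ.1
  have hmem : ∀ c ∈ C, α c ∈ P.A := fun c hc => hCA (mem_img_of_mem hc)
  refine ⟨Q, hQ, cj h ∘ α, (hα.cod hmem P.centric.1).comp
    (E.mor_cj (hα.le_right hh) P.centric.1 Q.centric.1 hle), ⟨h, hh, fun c _ => rfl⟩, ?_⟩
  refine Cj.trans ⟨k, hk, fun c hc => ?_⟩ (hj'.precomp hmem)
  rw [Function.comp_apply, hP _ (hmem c hc), hj _ (mem_img_of_mem hc), Function.comp_apply,
    hα.finv_apply hc]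

/-- The extension of `φ` to its normalizer is again a pair, so maximality of `A` applies to it. -/
theorem MaxPair.mem_of_nphi (hE : E.Good) (hH : H ≤ T) {A : Subgroup S} {φ : S → S}
    (hA : MaxPair E H K A φ) : nphi H K A φ ≤ A := by
  obtain ⟨β, hβ, h⟩ := hE.ext_mem hA.centric hA.mor hH
  exact hA.max _ β (hA.mor.le_nphi hA.le le_rfl) (fun x hx => hx.1) hβ (Cj.of_eq h)

/-- Transporting the second pair by `h⁻¹` gives a maximal pair that agrees with the first on `δ(C)`,
so `MaxPair.eq_of_agree` makes them equal. The two representatives are then equivalent, hence the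
same. -/
theorem IsProductReps.factor_unique (hS : IsPGroup p S) (hE : E.Good) (hX : IsProductReps E H K X)
    (hH : H ≤ T) (hC : E.IsCentric C) {P P' : OrbitPair E H K} (hP : P ∈ X) (hP' : P' ∈ X)
    {δ δ' : S → S} (hδ : E.Mor δ C P.A) (hδ' : E.Mor δ' C P'.A) (h1 : Cj H C δ δ')
    (h2 : Cj K C (P.fn ∘ δ) (P'.fn ∘ δ')) : P = P' ∧ Cj P.A C δ δ' := by
  obtain ⟨h, hh, e⟩ := h1
  have hm : E.Mor (cj h⁻¹) P'.A T := E.mor_cj (inv_mem (hH hh)) P'.centric.1 le_rfl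
    fun a ha => cj_mem (inv_mem (hH hh)) (P'.centric.1 ha)
  set A' := img (cj h⁻¹) P'.A with hA'
  have hfin : ∀ x, x ∈ A' ↔ cj h x ∈ P'.A := by
    intro x
    rw [hm.mem_img]
    constructor
    · rintro ⟨a, ha, rfl⟩
      rwa [cj_cj_inv]
    · exact fun hx => ⟨_, hx, cj_inv_cj h x⟩
  have hmor : E.Mor (cj h) A' P'.A :=
    E.mor_cj (hH hh) hm.img_le P'.centric.1 fun a ha => (hfin a).1 ha
  have hmax' := (hX.1 P' hP').maxPair
  have hmax : MaxPair E H K A' (P'.fn ∘ cj h) := by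
    refine ⟨img_le fun a ha => cj_mem (inv_mem hh) (P'.le ha), P'.centric.img hm,
      hmor.comp P'.mor, fun B ψ hB hBH hψ hj b hb => (hfin b).2 ?_⟩
    have hm2 : E.Mor (cj h) B T := E.mor_cj (hH hh) hψ.le_left le_rfl
      fun a ha => cj_mem (hH hh) (hψ.le_left ha)
    have hm3 : E.Mor (cj h⁻¹) (img (cj h) B) B := by
      refine E.mor_cj (inv_mem (hH hh)) hm2.img_le hψ.le_left fun a ha => ?_
      obtain ⟨b, hb, rfl⟩ := hm2.mem_img.1 ha
      rwa [cj_inv_cj]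
    have hsub : ∀ a ∈ P'.A, cj h⁻¹ a ∈ A' := fun a ha => mem_img_of_mem ha
    refine hmax'.max (img (cj h) B) (ψ ∘ cj h⁻¹) (fun a ha => ?_)
      (img_le fun a ha => cj_mem hh (hBH ha)) (hm3.comp hψ) ?_ (mem_img_of_mem hb)
    · rw [← cj_cj_inv h a]
      exact mem_img_of_mem (hB (hsub a ha))
    · obtain ⟨k, hk, e'⟩ := hj
      refine ⟨k, hk, fun c hc => ?_⟩
      rw [Function.comp_apply, e' _ (hsub c hc), Function.comp_apply, cj_cj_inv]
  have hmem : ∀ c ∈ C, δ c ∈ A' := fun c hc => by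
    rw [hfin, ← e c hc]
    exact hδ'.mem hc
  have hagree : Cj K (img δ C) P.fn (P'.fn ∘ cj h) := by
    obtain ⟨k, hk, e'⟩ := h2
    refine ⟨k, hk, fun x hx => ?_⟩
    obtain ⟨c, hc, rfl⟩ := hδ.mem_img.1 hx
    rw [Function.comp_apply, ← e c hc]
    exact e' c hc
  obtain ⟨hAA, hj⟩ := (hX.1 P hP).maxPair.eq_of_agree hS hE hH hmax (hC.img hδ) hδ.img_le
    (img_le hmem) hagree
  have hb : P.Below P' := OrbitPair.below_iff.2 ⟨h, hh, fun a ha => (hfin a).1 (hAA ▸ ha), hj⟩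
  obtain rfl : P = P' := by
    obtain ⟨Q, -, hQ⟩ := hX.2 P (hX.1 P hP)
    rw [hQ P ⟨hP, .refl _, .refl _⟩, hQ P' ⟨hP', hb, hX.1 P hP P' hb⟩]
  -- Now `P.fn` carries conjugation by `h` to conjugation by `k`, so `h` lies in the normalizer of
  -- `P.fn` and therefore in `P.A`.
  refine ⟨rfl, h, hmax'.mem_of_nphi hE hH ?_, e⟩
  obtain ⟨k, hk, e'⟩ := hj
  exact ⟨hh, fun c => by rw [← hfin, ← hAA], k, hk, e'⟩

end Reps

end FusionMackey

namespace FusionMackey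

open FusionSystem

variable {S : Type u} [Group S]

/-! ## Saturated fusion systems: Sylow subgroups of automorphism groups -/

/-- Since normalizers grow in `p`-groups, a `p`-subgroup containing all `p`-elements of its
normalizer is Sylow; Sylow's theorem then conjugates `A` into it. -/
theorem exists_conj_le_of_normalizer {p : ℕ} [Fact p.Prime] {Γ : Type u} [Group Γ] [Finite Γ]
    {B A : Subgroup Γ} (hB : IsPGroup p B) (hA : IsPGroup p A)
    (h : ∀ g ∈ Subgroup.normalizer (B : Set Γ), (∃ k, g ^ p ^ k = 1) → g ∈ B) :
    ∃ g : Γ, ∀ a ∈ A, g * a * g⁻¹ ∈ B := by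
  obtain ⟨P, hP⟩ := hB.exists_le_sylow
  obtain ⟨Q, hQ⟩ := hA.exists_le_sylow
  have hPB : B = P := by
    rcases hP.eq_or_lt with e | hlt
    · exact e
    · exfalso
      obtain ⟨x, hx, hxB⟩ := SetLike.exists_of_lt (lt_normalizer_inf P.isPGroup' hlt)
      obtain ⟨k, hk⟩ := P.isPGroup' ⟨x, hx.1⟩
      exact hxB (h x hx.2 ⟨k, congrArg Subtype.val hk⟩)
  obtain ⟨g, hg⟩ := MulAction.exists_smul_eq Γ Q P
  refine ⟨g, fun a ha => ?_⟩
  rw [hPB, ← hg]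
  exact Subgroup.smul_mem_pointwise_smul (a : Γ) (MulAut.conj g) (Q : Subgroup Γ) (hQ ha)

section Sat

variable {T : Subgroup S} (F : FusionSystem (⊤ : Subgroup S))

/-- The automorphism group of `Q` in the fusion system. -/
def autGrp (Q : Subgroup S) : Subgroup (MulAut Q) where
  carrier := {e | e.toMonoidHom ∈ F.Hom Q Q}
  one_mem' := F.id_mem le_top
  mul_mem' := fun {a b} ha hb =>
    show (MulEquiv.toMonoidHom a).comp (MulEquiv.toMonoidHom b) ∈ F.Hom Q Q from F.comp_mem hb ha
  inv_mem' := fun {a} ha => (F.iso_mem a ha fun _ => rfl).2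

variable {F}

open Classical in
/-- An automorphism of `Q` as a function on `S`. -/
noncomputable def efn {Q : Subgroup S} (e : autGrp F Q) (x : S) : S :=
  if h : x ∈ Q then e.1 ⟨x, h⟩ else 1

theorem efn_apply {Q : Subgroup S} (e : autGrp F Q) {x : S} (h : x ∈ Q) :
    efn e x = e.1 ⟨x, h⟩ := by
  rw [efn, dif_pos h]

theorem efn_mor {Q : Subgroup S} (e : autGrp F Q) : F.Mor (efn e) Q Q :=
  ⟨_, e.2, fun a => by rw [efn_apply e a.2]; rfl⟩

theorem efn_mul {Q : Subgroup S} (e e' : autGrp F Q) {x : S} (h : x ∈ Q) :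
    efn (e * e') x = efn e (efn e' x) := by
  rw [efn_apply _ h, efn_apply e' h, efn_apply e (Subtype.coe_prop _)]
  rfl

theorem efn_one {Q : Subgroup S} {x : S} (h : x ∈ Q) : efn (1 : autGrp F Q) x = x := by
  rw [efn_apply _ h]; rfl

theorem efn_pow {Q : Subgroup S} (e : autGrp F Q) (n : ℕ) {x : S} (h : x ∈ Q) :
    efn (e ^ n) x = (efn e)^[n] x := by
  induction n with
  | zero => rw [pow_zero, efn_one h]; rfl
  | succ n ih => rw [pow_succ', efn_mul _ _ h, ih, Function.iterate_succ_apply']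

theorem efn_ext {Q : Subgroup S} {e e' : autGrp F Q} (h : ∀ x ∈ Q, efn e x = efn e' x) : e = e' := by
  refine Subtype.ext (MulEquiv.ext fun x => Subtype.ext ?_)
  have := h x x.2
  rwa [efn_apply _ x.2, efn_apply _ x.2] at this

theorem efn_inv_efn {Q : Subgroup S} (e : autGrp F Q) {x : S} (h : x ∈ Q) :
    efn e⁻¹ (efn e x) = x := by
  rw [← efn_mul _ _ h, inv_mul_cancel, efn_one h]

variable [Finite S]

theorem exists_efn {Q : Subgroup S} {α : S → S} (h : F.Mor α Q Q) :
    ∃ e : autGrp F Q, ∀ x ∈ Q, efn e x = α x := by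
  obtain ⟨φ, hφ, he⟩ := h
  have hb : Function.Bijective φ := Finite.injective_iff_bijective.1 (F.injective_of_mem hφ)
  refine ⟨⟨MulEquiv.ofBijective φ hb, (F.iso_mem _ hφ fun a => rfl).1⟩, fun x hx => ?_⟩
  rw [efn_apply _ hx]
  exact he ⟨x, hx⟩

theorem mem_normalizer_of_cj {C : Subgroup S} {y : S} (h : ∀ c ∈ C, cj y c ∈ C) :
    y ∈ Subgroup.normalizer (C : Set S) := by
  refine mem_normalizer_iff_cj.2 fun c => ⟨fun hc => ?_, h c⟩
  have hle : C.map (MulAut.conj y).toMonoidHom ≤ C := by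
    rintro _ ⟨c, hc, rfl⟩
    exact h c hc
  have heq := Subgroup.eq_of_le_of_card_ge hle
    (Subgroup.card_map_of_injective (MulAut.conj y).injective).ge
  rw [← heq] at hc
  obtain ⟨c', hc', e⟩ := hc
  have : c' = c := cj_injective y e
  rwa [← this]

/-- The automorphisms of `Q` transported by `θ` from the conjugations by elements of `N_S(Q')`. -/
def autVia {Q Q' : Subgroup S} {θ : S → S} (hθ : F.Mor θ Q' Q) : Subgroup (autGrp F Q) where
  carrier := {e | ∃ n ∈ Subgroup.normalizer (Q' : Set S), ∀ q ∈ Q', efn e (θ q) = θ (cj n q)}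
  one_mem' := ⟨1, one_mem _, fun q hq => by rw [efn_one (hθ.mem hq), cj_one]⟩
  mul_mem' := by
    rintro e e' ⟨n, hn, h⟩ ⟨n', hn', h'⟩
    refine ⟨n * n', mul_mem hn hn', fun q hq => ?_⟩
    rw [efn_mul _ _ (hθ.mem hq), h' q hq, h _ ((mem_normalizer_iff_cj.1 hn' q).2 hq), cj_cj]
  inv_mem' := by
    rintro e ⟨n, hn, h⟩
    refine ⟨n⁻¹, inv_mem hn, fun q hq => ?_⟩
    have hq' := (mem_normalizer_iff_cj.1 (inv_mem hn) q).2 hq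
    have := h _ hq'
    rw [cj_cj_inv] at this
    rw [← this, efn_inv_efn _ (hθ.mem hq')]

/-- The powers of `e` are transported from conjugations by the powers of `n ∈ S`, so `e` has
`p`-power order. -/
theorem isPGroup_autVia {p : ℕ} (hS : IsPGroup p S) {Q Q' : Subgroup S} {θ : S → S}
    (hθ : F.Mor θ Q' Q) (him : img θ Q' = Q) : IsPGroup p (autVia hθ) := by
  rintro ⟨e, n, hn, h⟩
  obtain ⟨k, hk⟩ := hS n
  refine ⟨k, Subtype.ext (efn_ext fun x hx => ?_)⟩
  rw [← him, hθ.mem_img] at hx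
  obtain ⟨q, hq, rfl⟩ := hx
  have key : ∀ m : ℕ, (efn e)^[m] (θ q) = θ (cj (n ^ m) q) := by
    intro m
    induction m with
    | zero => rw [pow_zero, cj_one]; rfl
    | succ m ih =>
      rw [Function.iterate_succ_apply', ih,
        h _ ((mem_normalizer_iff_cj.1 (pow_mem hn m) q).2 hq), cj_cj, pow_succ']
  have h1 : efn (e ^ p ^ k) (θ q) = θ q := by
    rw [efn_pow _ _ (hθ.mem hq), key, hk, cj_one]
  exact h1.trans (efn_one (hθ.mem hq)).symm

variable (F) in
theorem exists_isFullyNormalized (Q : Subgroup S) :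
    ∃ θ, F.Mor θ Q ⊤ ∧ F.IsFullyNormalized (img θ Q) := by
  have hne : {K | F.IsIso Q K}.Nonempty := ⟨Q, F.isIso_refl le_top⟩
  obtain ⟨K, hK, hmax⟩ := Set.exists_max_image _
    (fun K : Subgroup S => Nat.card ↥(Subgroup.normalizer (K : Set S) ⊓ ⊤)) (Set.toFinite _) hne
  obtain ⟨θ, hθ, rfl⟩ := isIso_iff_mor.1 hK
  exact ⟨θ, hθ.top, le_top, fun K' hK' => hmax K' (hK.trans hK'.symm)⟩

theorem FusionSystem.IsFullyNormalized.card_le {H K : Subgroup S} (h : F.IsFullyNormalized H)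
    (hK : F.IsIso H K) : Nat.card (Subgroup.normalizer (K : Set S)) ≤
      Nat.card (Subgroup.normalizer (H : Set S)) := by
  have := h.2 K hK.symm
  rwa [inf_top_eq, inf_top_eq] at this

variable {p : ℕ}

/-- In `nphi` the witness `z` is not required to normalize `β(C)`. This is automatic, so `nphi` lies
in the domain of the extension axiom. -/
theorem FusionSystem.IsSaturated.extend_mor (hF : F.IsSaturated p) {C : Subgroup S} {β : S → S}
    (hβ : F.Mor β C ⊤) (hn : F.IsFullyNormalized (img β C)) :
    ∃ β', F.Mor β' (nphi ⊤ ⊤ C β) ⊤ ∧ ∀ c ∈ C, β' c = β c := by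
  have hβ' := hβ
  obtain ⟨φ, hφ, he⟩ := hβ
  have him : im φ = img β C := by
    ext y
    rw [hβ'.mem_img]
    constructor
    · rintro ⟨a, rfl⟩
      exact ⟨a, a.2, (he a).symm⟩
    · rintro ⟨a, ha, rfl⟩
      exact ⟨⟨a, ha⟩, he _⟩
  obtain ⟨ψ, hψ, h⟩ := hF.extend C φ hφ (him ▸ hn)
  have hle : nphi ⊤ ⊤ C β ≤ phiNormalizer ⊤ φ := by
    rintro x ⟨-, hx, z, -, hz⟩
    refine ⟨⟨mem_normalizer_iff_cj.2 hx, trivial⟩, z, ⟨?_, trivial⟩, fun h h' e => ?_⟩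
    · refine mem_normalizer_of_cj fun c hc => ?_
      rw [him, hβ'.mem_img] at hc ⊢
      obtain ⟨a, ha, rfl⟩ := hc
      exact ⟨cj x a, (hx a).2 ha, hz a ha⟩
    · rw [he, he, e]
      exact hz h h.2
  classical
  let β'' : S → S := fun x => if hx : x ∈ phiNormalizer ⊤ φ then ψ ⟨x, hx⟩ else 1
  have hβ'' : F.Mor β'' (phiNormalizer ⊤ φ) ⊤ := ⟨ψ, hψ, fun a => by simp [β'']⟩
  refine ⟨β'', hβ''.restrict hle, fun c hc => ?_⟩
  have hc' := hle (hβ'.le_nphi le_top le_top hc)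
  simp only [β'', dif_pos hc']
  rw [h ⟨c, hc⟩ ⟨c, hc'⟩ rfl, he]

theorem mor_normalizer {Q Q' : Subgroup S} {ψ : S → S}
    (hψ : F.Mor ψ (Subgroup.normalizer (Q' : Set S)) ⊤) (h : img ψ Q' = Q) :
    F.Mor ψ (Subgroup.normalizer (Q' : Set S)) (Subgroup.normalizer (Q : Set S)) := by
  have hle : Q' ≤ Subgroup.normalizer (Q' : Set S) := Subgroup.le_normalizer
  refine hψ.cod (fun x hx => mem_normalizer_of_cj fun c hc => ?_) le_top
  rw [← h, (hψ.restrict hle).mem_img] at hc ⊢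
  obtain ⟨q, hq, rfl⟩ := hc
  exact ⟨cj x q, (mem_normalizer_iff_cj.1 hx q).2 hq, hψ.map_cj hx (hle hq)⟩

theorem FusionSystem.Mor.iterate {E : FusionSystem T} {α : S → S} {A : Subgroup S}
    (h : E.Mor α A A) (n : ℕ) : E.Mor α^[n] A A := by
  induction n with
  | zero => exact E.mor_id le_rfl h.le_left
  | succ n ih => rw [Function.iterate_succ']; exact ih.comp h

/-- A power of `ψ` of `p`-power order that agrees with `ψ` where `ψ` has `p`-power order. -/
theorem exists_iterate_pPower [Fact p.Prime] {E : FusionSystem T} {ψ : S → S} {Q N : Subgroup S}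
    (hψ : E.Mor ψ N N) {b : ℕ} (hb : ∀ q ∈ Q, ψ^[p ^ b] q = q) :
    ∃ k a, (∀ q ∈ Q, ψ^[k] q = ψ q) ∧ ∀ x ∈ N, (ψ^[k])^[p ^ a] x = x := by
  have hper : ∃ m, 0 < m ∧ ∀ x ∈ N, ψ^[m] x = x := by
    let f : N → N := fun x => ⟨ψ x, hψ.mem x.2⟩
    have hf : Function.Injective f := fun x y hxy =>
      Subtype.ext (hψ.inj x.2 y.2 (congrArg Subtype.val hxy))
    let e : Equiv.Perm N := Equiv.ofBijective f (Finite.injective_iff_bijective.1 hf)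
    refine ⟨orderOf e, orderOf_pos e, fun x hx => ?_⟩
    have h1 : ∀ (m : ℕ), (((e ^ m) ⟨x, hx⟩ : N) : S) = ψ^[m] x := by
      intro m
      induction m with
      | zero => rfl
      | succ m ih =>
        rw [pow_succ', Function.iterate_succ_apply', ← ih]
        rfl
    rw [← h1, pow_orderOf_eq_one]
    rfl
  obtain ⟨m, hm, hmx⟩ := hper
  obtain ⟨a, r, hr, rfl⟩ := Nat.exists_eq_pow_mul_and_not_dvd hm.ne' p (Fact.out : p.Prime).ne_one
  have hco : Nat.Coprime r (p ^ b) :=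
    (((Fact.out : p.Prime).coprime_iff_not_dvd.2 hr).symm).pow_right b
  -- The period of `ψ` on `N` is `p ^ a * r`. Taking `k ≡ 0` modulo `r` removes the part prime to
  -- `p`, and `k ≡ 1` modulo `p ^ b` leaves `ψ` unchanged on `Q`.
  obtain ⟨k, hk0, hk1⟩ := Nat.chineseRemainder hco 0 1
  refine ⟨k, a, fun q hq => ?_, fun x hx => ?_⟩
  · have hp : Function.IsPeriodicPt ψ (p ^ b) q := hb q hq
    rw [← hp.iterate_mod_apply, hk1, hp.iterate_mod_apply, Function.iterate_one]
  · rw [← Function.iterate_mul]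
    obtain ⟨j, hj⟩ := (Nat.modEq_zero_iff_dvd.1 hk0)
    have hp : Function.IsPeriodicPt ψ (p ^ a * r) x := hmx x hx
    rw [hj, show r * j * p ^ a = (p ^ a * r) * j by ring]
    exact hp.mul_const j

/-- Automorphisms of `p`-power order are, after transport, conjugations. -/
def FusionSystem.Star (p : ℕ) (E : FusionSystem T) (Q : Subgroup S) : Prop :=
  ∀ α, E.Mor α Q Q → (∃ a, ∀ c ∈ Q, α^[p ^ a] c = c) →
    ∃ χ, E.Mor χ Q T ∧ ∃ y ∈ T, ∀ c ∈ Q, χ (α c) = cj y (χ c)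

/-- `Aut_S(Q)` contains a conjugate of every `p`-subgroup of `Aut_F(Q)`. -/
def SylowAt (p : ℕ) (F : FusionSystem (⊤ : Subgroup S)) (Q : Subgroup S) : Prop :=
  ∀ A : Subgroup (autGrp F Q), IsPGroup p A →
    ∃ g : autGrp F Q, ∀ a ∈ A, g * a * g⁻¹ ∈ autVia (F.mor_id (le_refl Q) le_top)

/-- Carry `α` to the automorphism `e = θαθ⁻¹` of `θ(Q)`. It generates a `p`-group, so some `g`
conjugates it into the conjugations by elements of the normalizer, and `χ = gθ`. -/
theorem star_of_sylowAt {Q : Subgroup S} {θ : S → S} (hθ : F.Mor θ Q ⊤)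
    (h : SylowAt p F (img θ Q)) : F.Star p Q := by
  rintro α hα ⟨a, ha⟩
  obtain ⟨e, he⟩ := exists_efn ((hθ.finv.comp hα).comp hθ.onto)
  have hθm : ∀ c ∈ Q, θ c ∈ img θ Q := fun c hc => mem_img_of_mem hc
  have he' : ∀ c ∈ Q, efn e (θ c) = θ (α c) := fun c hc => by
    rw [he _ (hθm c hc), Function.comp_apply, Function.comp_apply, hθ.finv_apply hc]
  have hit : ∀ m, ∀ c ∈ Q, (efn e)^[m] (θ c) = θ (α^[m] c) := by
    intro m
    induction m with
    | zero => exact fun c _ => rfl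
    | succ m ih =>
      intro c hc
      rw [Function.iterate_succ_apply', ih c hc, he' _ ((hα.iterate m).mem hc),
        Function.iterate_succ_apply']
  have hpow : e ^ p ^ a = 1 := efn_ext fun x hx => by
    rw [efn_pow _ _ hx, efn_one hx]
    obtain ⟨c, hc, rfl⟩ := hθ.mem_img.1 hx
    rw [hit _ c hc, ha c hc]
  have hA : IsPGroup p (Subgroup.zpowers e) := by
    rintro ⟨x, n, rfl⟩
    refine ⟨a, Subtype.ext ?_⟩
    change (e ^ n) ^ p ^ a = 1
    rw [← zpow_natCast, ← zpow_mul, mul_comm, zpow_mul, zpow_natCast, hpow, one_zpow]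
  obtain ⟨g, hg⟩ := h _ hA
  obtain ⟨y, hy, hyq⟩ := hg e (Subgroup.mem_zpowers e)
  refine ⟨efn g ∘ θ, (hθ.onto.comp (efn_mor g)).top, y, trivial, fun c hc => ?_⟩
  have h1 := hyq _ ((efn_mor g).mem (hθm c hc))
  rw [id, id, ← efn_mul _ _ (hθm c hc), inv_mul_cancel_right, efn_mul _ _ (hθm c hc),
    he' c hc] at h1
  exact h1

theorem sylowAt_top (hF : F.IsSaturated p) [Fact p.Prime] : SylowAt p F ⊤ := by
  obtain ⟨P, hP⟩ : ∃ P : Sylow p (autGrp F ⊤), (P : Subgroup (autGrp F ⊤)).map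
      (autGrp F ⊤).subtype = (MulAut.conj : (⊤ : Subgroup S) →* MulAut (⊤ : Subgroup S)).range :=
    hF.sylow
  intro A hA
  obtain ⟨Q, hQ⟩ := hA.exists_le_sylow
  obtain ⟨g, hg⟩ := MulAction.exists_smul_eq (autGrp F ⊤) Q P
  refine ⟨g, fun a ha => ?_⟩
  have h1 : g * a * g⁻¹ ∈ (P : Subgroup (autGrp F ⊤)) := by
    rw [← hg]
    exact Subgroup.smul_mem_pointwise_smul a (MulAut.conj g) (Q : Subgroup _) (hQ ha)
  have h2 : (g * a * g⁻¹).1 ∈ (MulAut.conj : (⊤ : Subgroup S) →* MulAut (⊤ : Subgroup S)).range := by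
    rw [← hP]
    exact ⟨_, h1, rfl⟩
  obtain ⟨t, ht⟩ := h2
  refine ⟨t, mem_normalizer_of_cj fun c _ => trivial, fun q hq => ?_⟩
  rw [id, id, efn_apply _ hq, ← ht]
  rfl

/-- Induction from larger to smaller subgroups. By `exists_conj_le_of_normalizer` it has to be shown
that a `p`-element `g` normalizing `Aut_S(Q)` is a conjugation. It extends to an automorphism `ψ` of
`N = N_S(Q)`, and a power of `ψ` has `p`-power order and still restricts to `g`. By the case of a
fully normalized conjugate of `N`, this power becomes a conjugation by some `y` after transport by
`χ`, and full normalization of `Q` brings `y` back to `N`. -/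
theorem sylowAt_of_isFullyNormalized [Fact p.Prime] (hS : IsPGroup p S) (hF : F.IsSaturated p)
    {Q : Subgroup S} (hQ : F.IsFullyNormalized Q) : SylowAt p F Q := by
  induction hn : Nat.card S - Nat.card Q using Nat.strong_induction_on generalizing Q with
  | _ n ih =>
    subst hn
    by_cases htop : Q = ⊤
    · subst htop
      exact sylowAt_top hF
    intro A hA
    have hid := F.mor_id (le_refl Q) le_top
    refine exists_conj_le_of_normalizer (isPGroup_autVia hS hid (img_id Q)) hA ?_
    rintro g hg ⟨b, hb⟩
    set N := Subgroup.normalizer (Q : Set S) with hN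
    have hQN : Q ≤ N := Subgroup.le_normalizer
    have hg1 := efn_mor g
    have himg : img (efn g) Q = Q := hg1.of_isPGroup_card_le le_rfl
    -- As `g` normalizes `Aut_S(Q)`, it carries conjugation by an element of `N_S(Q)` to another
    -- such conjugation, so it extends to all of `N_S(Q)`.
    have hle : N ≤ nphi ⊤ ⊤ Q (efn g) := by
      intro x hx
      have hx' := mem_normalizer_iff_cj.1 hx
      obtain ⟨e, he⟩ := exists_efn
        (F.mor_cj (A := Q) (B := Q) (t := x) trivial le_top le_top fun a ha => (hx' a).2 ha)
      have hmem : e ∈ autVia hid := ⟨x, hx, fun q hq => he q hq⟩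
      obtain ⟨z, hz, hzq⟩ := (Subgroup.mem_normalizer_iff.1 hg e).1 hmem
      refine ⟨trivial, hx', z, trivial, fun c hc => ?_⟩
      have := hzq _ (hg1.mem hc)
      rw [id, id, ← efn_mul _ _ hc, inv_mul_cancel_right, efn_mul _ _ hc, he c hc] at this
      exact this
    obtain ⟨ψ, hψ, hψg⟩ := hF.extend_mor hg1.top (himg.symm ▸ hQ)
    have hψN : F.Mor ψ N N := mor_normalizer (hψ.restrict hle) ((img_congr hψg).trans himg)
    have hψb : ∀ q ∈ Q, ψ^[p ^ b] q = q := by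
      have : ∀ m, ∀ q ∈ Q, ψ^[m] q = (efn g)^[m] q := by
        intro m
        induction m with
        | zero => exact fun q _ => rfl
        | succ m ihm =>
          intro q hq
          rw [Function.iterate_succ_apply', ihm q hq, hψg _ ((hg1.iterate m).mem hq),
            Function.iterate_succ_apply']
      intro q hq
      rw [this _ q hq, ← efn_pow _ _ hq, hb, efn_one hq]
    obtain ⟨k, a, hk, ha⟩ := exists_iterate_pPower hψN hψb
    obtain ⟨θ, hθ, hθn⟩ := exists_isFullyNormalized F N
    have hlt : Q < N := by
      have := lt_normalizer_inf (hS.to_subgroup ⊤) (lt_top_iff_ne_top.2 htop)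
      rwa [top_inf_eq] at this
    have hcard : Nat.card Q < Nat.card N := by
      by_contra hcon
      exact hlt.ne (Subgroup.eq_of_le_of_card_ge hlt.le (not_lt.1 hcon))
    have hcardS : Nat.card N ≤ Nat.card S := Subgroup.card_le_card_group N
    have hstar : F.Star p N := star_of_sylowAt hθ
      (ih _ (by rw [hθ.card_img]; omega) hθn rfl)
    obtain ⟨χ, hχ, y, -, hy⟩ := hstar _ (hψN.iterate k) ⟨a, ha⟩
    have hy' : ∀ q ∈ Q, χ (efn g q) = cj y (χ q) := fun q hq => by
      rw [← hψg q hq, ← hk q hq, hy q (hQN hq)]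
    have hχQ := hχ.restrict hQN
    have hyn : y ∈ Subgroup.normalizer (img χ Q : Set S) := mem_normalizer_of_cj fun c hc => by
      obtain ⟨q, hq, rfl⟩ := hχQ.mem_img.1 hc
      rw [← hy' q hq]
      exact mem_img_of_mem (hg1.mem hq)
    -- The order of `N_S(χ(Q))` is at most that of `N_S(Q)` because `Q` is fully normalized.
    have himgN : img χ N = Subgroup.normalizer (img χ Q : Set S) := by
      refine Subgroup.eq_of_le_of_card_ge (mor_normalizer hχ rfl).img_le ?_
      rw [hχ.card_img]
      exact hQ.card_le hχQ.isIso
    rw [← himgN, hχ.mem_img] at hyn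
    obtain ⟨x, hx, rfl⟩ := hyn
    refine ⟨x, hx, fun q hq => ?_⟩
    refine hχ.inj (hQN (hg1.mem hq)) (hQN ((mem_normalizer_iff_cj.1 hx q).2 hq)) ?_
    rw [id, id, hy' q hq, hχ.map_cj hx (hQN hq)]

theorem FusionSystem.IsSaturated.star [Fact p.Prime] (hS : IsPGroup p S) (hF : F.IsSaturated p)
    (Q : Subgroup S) : F.Star p Q := by
  obtain ⟨θ, hθ, h⟩ := exists_isFullyNormalized F Q
  exact star_of_sylowAt hθ (sylowAt_of_isFullyNormalized hS hF h)

/-- In general `θ` itself does not extend to `N_S(Q')`. The automorphisms that it transports from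
`N_S(Q')` form a `p`-group, so the Sylow property yields an automorphism `g` of the image for which
`gθ` has all of `N_S(Q')` in its domain of extension. -/
theorem FusionSystem.IsSaturated.exists_normalizer_mor [Fact p.Prime] (hS : IsPGroup p S)
    (hF : F.IsSaturated p) {Q' : Subgroup S} {θ : S → S} (hθ : F.Mor θ Q' ⊤)
    (hQ : F.IsFullyNormalized (img θ Q')) :
    ∃ ρ, F.Mor ρ (Subgroup.normalizer (Q' : Set S)) (Subgroup.normalizer (img θ Q' : Set S)) ∧
      img ρ Q' = img θ Q' := by
  have hθ' := hθ.onto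
  obtain ⟨g, hg⟩ := sylowAt_of_isFullyNormalized hS hF hQ _ (isPGroup_autVia hS hθ' rfl)
  have hχ : F.Mor (efn g ∘ θ) Q' (img θ Q') := hθ'.comp (efn_mor g)
  have him : img (efn g ∘ θ) Q' = img θ Q' := hχ.of_isPGroup_card_le hθ.card_img.le
  have hle : Subgroup.normalizer (Q' : Set S) ≤ nphi ⊤ ⊤ Q' (efn g ∘ θ) := by
    intro n hn
    have hn' := mem_normalizer_iff_cj.1 hn
    obtain ⟨e, he⟩ := exists_efn (((hθ.finv.comp
      (F.mor_cj (A := Q') (B := Q') (t := n) trivial le_top le_top fun a ha => (hn' a).2 ha))).comp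
        hθ')
    have he' : ∀ q ∈ Q', efn e (θ q) = θ (cj n q) := fun q hq => by
      rw [he _ (mem_img_of_mem hq), Function.comp_apply, Function.comp_apply, hθ.finv_apply hq]
    obtain ⟨y, hy, hyq⟩ := hg e ⟨n, hn, he'⟩
    refine ⟨trivial, hn', y, trivial, fun c hc => ?_⟩
    have hc' := hθ'.mem hc
    have := hyq _ ((efn_mor g).mem hc')
    rw [id, id, ← efn_mul _ _ hc', inv_mul_cancel_right, efn_mul _ _ hc', he' c hc] at this
    exact this
  obtain ⟨ρ, hρ, hρθ⟩ := hF.extend_mor hχ.top (him.symm ▸ hQ)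
  have := (img_congr hρθ).trans him
  exact ⟨ρ, mor_normalizer (hρ.restrict hle) this, this⟩

/-! ### Extension and uniqueness in saturated systems. -/

/-- Uniqueness of extensions from centric subgroups. -/
theorem epi_of_star [Fact p.Prime] (hS : IsPGroup p S) {E : FusionSystem T}
    (hstar : ∀ Q, E.IsCentric Q → E.Star p Q) {K L : Subgroup S} {φ ψ : S → S}
    (hK : E.IsCentric K) (hKL : K ≤ L) (hφ : E.Mor φ L T) (hψ : E.Mor ψ L T)
    (h : ∀ x ∈ K, ψ x = φ x) : ∃ z ∈ T, ∀ x ∈ L, ψ x = cj z (φ x) := by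
  induction K using WellFoundedGT.induction generalizing φ with
  | ind K ih =>
    rcases hKL.eq_or_lt with rfl | hlt
    · exact ⟨1, one_mem _, fun x hx => by rw [h x hx, cj_one]⟩
    have hlt' := lt_normalizer_inf (hS.to_subgroup L) hlt
    set N := L ⊓ Subgroup.normalizer (K : Set S) with hN
    have hNL : N ≤ L := inf_le_left
    have hKN : K ≤ N := hlt'.le
    -- It suffices to treat the normalizer of `K` in `L`: after correcting `φ` by `z`, the two maps
    -- agree on the larger subgroup `N` and induction applies.
    suffices ∃ z ∈ T, ∀ x ∈ N, ψ x = cj z (φ x) by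
      obtain ⟨z, hz, hzx⟩ := this
      obtain ⟨w, hw, hwx⟩ := ih N hlt' (hK.mono hKN (hNL.trans hφ.le_left)) hNL
        (hφ.comp (E.mor_cj hz le_rfl le_rfl fun a ha => cj_mem hz ha)) hzx
      exact ⟨w * z, mul_mem hw hz, fun x hx => by rw [hwx x hx, Function.comp_apply, cj_cj]⟩
    have hNK : ∀ x ∈ N, ∀ c ∈ K, cj x c ∈ K := fun x hx c hc =>
      (mem_normalizer_iff_cj.1 hx.2 c).2 hc
    have hφN := hφ.restrict hNL
    have hψN := hψ.restrict hNL
    have hφK := hφ.restrict hKL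
    -- The elements `φ x` and `ψ x` act equally on `φ(K)`, so by centricity they differ by an
    -- element of `φ(K)`, the image of some `k` in the center of `K`.
    have hdiff : ∀ x ∈ N, ∃ k ∈ K, ψ x = φ (x * k) ∧ ∀ c ∈ K, cj k c = c := by
      intro x hx
      have : (φ x)⁻¹ * ψ x ∈ img φ K := by
        refine hK.mem_img hφK (mul_mem (inv_mem (hφN.mem hx)) (hψN.mem hx)) fun c hc => ?_
        rw [← cj_cj, ← h c hc, ← hψN.map_cj hx (hKN hc), h _ (hNK x hx c hc),
          hφN.map_cj hx (hKN hc), cj_inv_cj, h c hc]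
      obtain ⟨k, hk, e⟩ := hφK.mem_img.1 this
      refine ⟨k, hk, ?_, fun c hc => ?_⟩
      · rw [hφN.map_mul hx (hKN hk), e, mul_inv_cancel_left]
      · refine hφK.inj (cj_mem hk hc) hc ?_
        rw [hφK.map_cj hk hc, e, ← cj_cj, ← h c hc, ← hψN.map_cj hx (hKN hc), h _ (hNK x hx c hc),
          hφN.map_cj hx (hKN hc), cj_inv_cj, h c hc]
    have hsub : ∀ x ∈ N, ψ x ∈ img φ N := fun x hx => by
      obtain ⟨k, hk, e, -⟩ := hdiff x hx
      rw [e]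
      exact mem_img_of_mem (mul_mem hx (hKN hk))
    set α := finv φ N ∘ ψ with hα
    have hαm : E.Mor α N N := (hψN.cod hsub (hφN.img_le.trans le_rfl)).comp hφN.finv
    have hαx : ∀ x ∈ N, ∃ k ∈ K, α x = x * k := fun x hx => by
      obtain ⟨k, hk, e, -⟩ := hdiff x hx
      refine ⟨k, hk, ?_⟩
      rw [hα, Function.comp_apply, e, hφN.finv_apply (mul_mem hx (hKN hk))]
    have hαK : ∀ k ∈ K, α k = k := fun k hk => by
      rw [hα, Function.comp_apply, h k hk, hφN.finv_apply (hKN hk)]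
    have hφα : ∀ x ∈ N, φ (α x) = ψ x := fun x hx => hφN.apply_finv (hsub x hx)
    obtain ⟨a, ha⟩ := IsPGroup.iff_card.1 hS
    -- Since `α` fixes `K` pointwise and `α x = x * k`, the iterates are `x * k ^ m`, and the order
    -- of `S` is a period.
    have hper : ∀ c ∈ N, α^[p ^ a] c = c := by
      intro x hx
      obtain ⟨k, hk, e⟩ := hαx x hx
      have : ∀ m, α^[m] x = x * k ^ m := by
        intro m
        induction m with
        | zero => simp
        | succ m ihm =>
          rw [Function.iterate_succ_apply', ihm, hαm.map_mul hx (hKN (pow_mem hk m)),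
            hαK _ (pow_mem hk m), e, pow_succ', mul_assoc]
      rw [this, ← ha, pow_card_eq_one', mul_one]
    have hNc : E.IsCentric N := hK.mono hKN (hNL.trans hφ.le_left)
    obtain ⟨χ, hχ, y, hy, hyx⟩ := hstar N hNc α hαm ⟨a, hper⟩
    have hχK := hχ.restrict hKN
    -- As `α` is trivial on `K`, the element `y` centralizes `χ(K)`. By centricity it comes from
    -- some `k ∈ K`, and `α` is conjugation by `k`.
    have : y ∈ img χ K := hK.mem_img hχK hy fun c hc => by
      rw [← hyx c (hKN hc), hαK c hc]
    obtain ⟨k, hk, rfl⟩ := hχK.mem_img.1 this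
    refine ⟨φ k, hφK.mem hk, fun x hx => ?_⟩
    rw [← hφα x hx, ← hφN.map_cj (hKN hk) hx]
    refine congrArg φ (hχ.inj (hαm.mem hx) (cj_mem (hKN hk) hx) ?_)
    rw [hyx x hx, hχ.map_cj (hKN hk) hx]

/-- Saturated fusion systems have the extension property for centric subgroups. -/
theorem FusionSystem.IsSaturated.good [Fact p.Prime] (hS : IsPGroup p S) (hF : F.IsSaturated p) :
    F.Good where
  epi := epi_of_star hS fun Q _ => hF.star hS Q
  ext := by
    intro C β hC hβ
    -- The extension axiom needs a fully normalized image. Move `β(C)` to one by a `ρ` defined on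
    -- all of `N_S(β(C))`, extend `ρ ∘ β`, and undo `ρ` afterwards.
    obtain ⟨θ, hθ, hn⟩ := exists_isFullyNormalized F (img β C)
    obtain ⟨ρ, hρ, him⟩ := hF.exists_normalizer_mor hS hθ hn
    have hle : img β C ≤ Subgroup.normalizer (img β C : Set S) := Subgroup.le_normalizer
    have hρβ : F.Mor (ρ ∘ β) C ⊤ := hβ.onto.comp (hρ.restrict hle).top
    have him' : img (ρ ∘ β) C = img θ (img β C) := (img_comp hβ).trans him
    obtain ⟨ψ, hψ, hψβ⟩ := hF.extend_mor hρβ (him'.symm ▸ hn)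
    have hnorm : ∀ x z, (∀ c, cj x c ∈ C ↔ c ∈ C) → (∀ c ∈ C, β (cj x c) = cj z (β c)) →
        z ∈ Subgroup.normalizer (img β C : Set S) := by
      intro x z hx hz
      refine mem_normalizer_of_cj fun c hc => ?_
      obtain ⟨a, ha, rfl⟩ := hβ.mem_img.1 hc
      rw [← hz a ha]
      exact mem_img_of_mem ((hx a).2 ha)
    have hsub : nphi ⊤ ⊤ C β ≤ nphi ⊤ ⊤ C (ρ ∘ β) := by
      rintro x ⟨-, hx, z, -, hz⟩
      refine ⟨trivial, hx, ρ z, trivial, fun c hc => ?_⟩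
      rw [Function.comp_apply, hz c hc, hρ.map_cj (hnorm x z hx hz) (hle (mem_img_of_mem hc))]
      rfl
    have hψ' := hψ.restrict hsub
    have hCle : C ≤ nphi ⊤ ⊤ C β := hβ.le_nphi le_top le_top
    -- On `ρ(β(C))` the elements `ψ x` and `ρ z` act equally, so by centricity they differ by an
    -- element of `ρ(β(C))`; hence `ψ x` lies where `ρ` can be inverted.
    have hψim : ∀ x ∈ nphi ⊤ ⊤ C β, ψ x ∈ img ρ (Subgroup.normalizer (img β C : Set S)) := by
      intro x hx
      have hx' := hx
      obtain ⟨-, hxC, z, -, hz⟩ := hx'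
      have hzn := hnorm x z hxC hz
      have : (ρ z)⁻¹ * ψ x ∈ img (ρ ∘ β) C := by
        refine hC.mem_img hρβ trivial fun c hc => ?_
        rw [← cj_cj, ← hψβ c hc, ← hψ'.map_cj hx (hCle hc), hψβ _ ((hxC c).2 hc),
          Function.comp_apply, hz c hc, hρ.map_cj hzn (hle (mem_img_of_mem hc)), cj_inv_cj,
          hψβ c hc, Function.comp_apply]
      rw [img_comp hβ] at this
      have := mul_mem (mem_img_of_mem (α := ρ) hzn) ((hρ.img_mono hle) this)
      rwa [mul_inv_cancel_left] at this
    refine ⟨finv ρ (Subgroup.normalizer (img β C : Set S)) ∘ ψ,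
      ((hψ'.cod hψim le_top).comp hρ.finv).top, fun c hc => ?_⟩
    rw [Function.comp_apply, hψβ c hc, Function.comp_apply,
      hρ.finv_apply (hle (mem_img_of_mem hc))]

end Sat

end FusionMackey

namespace FusionMackey

open FusionSystem

variable {S : Type u} [Group S]

/-! ## The normalizer of a centric fully normalized subgroup -/

section Normalizer

variable [Finite S] {F : FusionSystem (⊤ : Subgroup S)} {H : Subgroup S} {p : ℕ}

theorem normalizerSystem_sub (F : FusionSystem (⊤ : Subgroup S)) (H : Subgroup S) :
    (F.normalizerSystem H).Sub F := by
  rintro α A B ⟨φ, hφ, he⟩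
  exact ⟨φ, hφ.2.2.1, he⟩

/-- For a domain containing `H` the morphism is its own extension, so only the stability of `H` has
to be checked. -/
theorem mor_normalizerSystem {α : S → S} {A B : Subgroup S} (hα : F.Mor α A B) (hHA : H ≤ A)
    (hA : A ≤ Subgroup.normalizer (H : Set S)) (hH : ∀ x ∈ H, α x ∈ H) :
    (F.normalizerSystem H).Mor α A (Subgroup.normalizer (H : Set S)) := by
  have hHN : H ≤ Subgroup.normalizer (H : Set S) := Subgroup.le_normalizer
  have hαH : F.Mor α H H := (hα.restrict hHA).cod hH le_top
  have himg : img α H = H := hαH.of_isPGroup_card_le le_rfl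
  have hα' : F.Mor α A (Subgroup.normalizer (H : Set S)) := by
    refine hα.cod (fun x hx => mem_normalizer_of_cj fun c hc => ?_) le_top
    rw [← himg, hαH.mem_img] at hc
    obtain ⟨d, hd, rfl⟩ := hc
    rw [← hα.map_cj hx (hHA hd)]
    exact hH _ ((mem_normalizer_iff_cj.1 (hA hx) d).2 hd)
  have hAH : A ⊔ H = A := sup_eq_left.2 hHA
  have hNH : Subgroup.normalizer (H : Set S) ⊔ H = Subgroup.normalizer (H : Set S) :=
    sup_eq_left.2 hHN
  have hα'' : F.Mor α (A ⊔ H) (Subgroup.normalizer (H : Set S) ⊔ H) := by rwa [hAH, hNH]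
  obtain ⟨φ, hφ, he⟩ := hα'
  obtain ⟨ψ, hψ, he'⟩ := hα''
  refine ⟨φ, ⟨hA, le_rfl, hφ, ψ, hψ, fun a => ?_, ?_⟩, he⟩
  · rw [he, he']; rfl
  · ext y
    constructor
    · rintro ⟨x, hx, rfl⟩
      have : (ψ x : S) = α x := he' x
      rw [Subgroup.mem_subgroupOf, this]
      exact hH _ hx
    · intro hy
      have hy' : (y : S) ∈ img α H := himg.symm ▸ (show (y : S) ∈ H from hy)
      obtain ⟨x, hx, e⟩ := hαH.mem_img.1 hy'
      exact ⟨⟨x, Subgroup.mem_sup_right hx⟩, hx, Subtype.ext ((he' _).trans e)⟩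

/-- The extension provided by the definition has a domain containing `H`, so it is itself a morphism
of the normalizer system. -/
theorem exists_extension_of_mor {α : S → S} {A B : Subgroup S}
    (hα : (F.normalizerSystem H).Mor α A B) :
    ∃ ψ, F.Mor ψ (A ⊔ H) (B ⊔ H) ∧ (∀ a ∈ A, ψ a = α a) ∧ (∀ x ∈ H, ψ x ∈ H) ∧
      (F.normalizerSystem H).Mor ψ (A ⊔ H) (Subgroup.normalizer (H : Set S)) := by
  have hA := hα.le_left
  obtain ⟨φ, ⟨-, -, -, ψ, hψ, h1, h2⟩, he⟩ := hα
  classical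
  let ψ' : S → S := fun x => if hx : x ∈ A ⊔ H then ψ ⟨x, hx⟩ else 1
  have hψ' : ∀ x (hx : x ∈ A ⊔ H), ψ' x = ψ ⟨x, hx⟩ := fun x hx => by simp only [ψ', dif_pos hx]
  have hm : F.Mor ψ' (A ⊔ H) (B ⊔ H) := ⟨ψ, hψ, fun a => (hψ' a a.2).symm⟩
  have hH : ∀ x ∈ H, ψ' x ∈ H := fun x hx => by
    rw [hψ' x (Subgroup.mem_sup_right hx)]
    have : ψ ⟨x, Subgroup.mem_sup_right hx⟩ ∈ (H.subgroupOf (A ⊔ H)).map ψ :=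
      Subgroup.mem_map_of_mem ψ hx
    rw [h2] at this
    exact this
  refine ⟨ψ', hm, fun a ha => ?_, hH, mor_normalizerSystem hm le_sup_right
    (sup_le hA Subgroup.le_normalizer) hH⟩
  rw [hψ' a (Subgroup.mem_sup_left ha), ← he ⟨a, ha⟩, ← h1]
  rfl

variable [Fact p.Prime]

/-- Extend `α` to `Q ⊔ H`, replace the extension by a power of `p`-power order, and apply the
property in `F`. The resulting `χ` may move `H`; full normalization of `H` gives `ρ : N_S(χ(H)) →
N_S(H)` that brings it back, and `ρ ∘ χ` is a morphism of the normalizer system. -/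
theorem star_normalizerSystem (hS : IsPGroup p S) (hF : F.IsSaturated p)
    (hHn : F.IsFullyNormalized H) (Q : Subgroup S) : (F.normalizerSystem H).Star p Q := by
  rintro α hα ⟨b, hb⟩
  obtain ⟨ψ, hψ, hψα, hψH, -⟩ := exists_extension_of_mor hα
  have hit : ∀ m, ∀ q ∈ Q, ψ^[m] q = α^[m] q := by
    intro m
    induction m with
    | zero => exact fun q _ => rfl
    | succ m ih =>
      intro q hq
      rw [Function.iterate_succ_apply', ih q hq, hψα _ ((hα.iterate m).mem hq),
        Function.iterate_succ_apply']
  obtain ⟨k, a, hk, ha⟩ := exists_iterate_pPower (Q := Q) hψ fun q hq => (hit _ q hq).trans (hb q hq)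
  have hψHk : ∀ x ∈ H, ψ^[k] x ∈ H := fun x hx =>
    (((hψ.restrict le_sup_right).cod hψH le_top).iterate k).mem hx
  obtain ⟨χ, hχ, y, -, hy⟩ := hF.star hS (Q ⊔ H) _ (hψ.iterate k) ⟨a, ha⟩
  have hχH := hχ.restrict (le_sup_right : H ≤ Q ⊔ H)
  have him := hχH.img_finv
  obtain ⟨ρ, hρ, hρH⟩ := hF.exists_normalizer_mor hS hχH.finv.top (him.symm ▸ hHn)
  rw [him] at hρ hρH
  have hQN : Q ⊔ H ≤ Subgroup.normalizer (H : Set S) := sup_le hα.le_left Subgroup.le_normalizer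
  have hχN : ∀ x ∈ Q ⊔ H, χ x ∈ Subgroup.normalizer (img χ H : Set S) := by
    refine fun x hx => mem_normalizer_of_cj fun c hc => ?_
    obtain ⟨d, hd, rfl⟩ := hχH.mem_img.1 hc
    rw [← hχ.map_cj hx (Subgroup.mem_sup_right hd)]
    exact mem_img_of_mem ((mem_normalizer_iff_cj.1 (hQN hx) d).2 hd)
  have hyN : y ∈ Subgroup.normalizer (img χ H : Set S) := by
    refine mem_normalizer_of_cj fun c hc => ?_
    obtain ⟨d, hd, rfl⟩ := hχH.mem_img.1 hc
    rw [← hy d (Subgroup.mem_sup_right hd)]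
    exact mem_img_of_mem (hψHk d hd)
  have hm := mor_normalizerSystem ((hχ.cod hχN le_top).comp hρ) le_sup_right hQN fun x hx => by
    rw [← hρH]
    exact mem_img_of_mem (mem_img_of_mem hx)
  refine ⟨ρ ∘ χ, hm.restrict le_sup_left, ρ y, hρ.mem hyN, fun c hc => ?_⟩
  have hc' : c ∈ Q ⊔ H := Subgroup.mem_sup_left hc
  rw [Function.comp_apply, ← hψα c hc, ← hk c hc, hy c hc', hρ.map_cj hyN (hχN c hc')]
  rfl

/-- Uniqueness follows from `star_normalizerSystem`. For extension, first pass from `C` to `C ⊔ H`,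
then extend in `F`; the result still stabilizes `H`. -/
theorem good_normalizerSystem (hS : IsPGroup p S) (hF : F.IsSaturated p) (hHc : F.IsCentric H)
    (hHn : F.IsFullyNormalized H) : (F.normalizerSystem H).Good := by
  have hepi : ∀ {K L : Subgroup S} {φ ψ : S → S}, (F.normalizerSystem H).IsCentric K → K ≤ L →
      (F.normalizerSystem H).Mor φ L (Subgroup.normalizer (H : Set S)) →
      (F.normalizerSystem H).Mor ψ L (Subgroup.normalizer (H : Set S)) →
      (∀ x ∈ K, ψ x = φ x) → ∃ z ∈ Subgroup.normalizer (H : Set S), ∀ x ∈ L, ψ x = cj z (φ x) :=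
    epi_of_star hS fun Q _ => star_normalizerSystem hS hF hHn Q
  refine ⟨hepi, ?_⟩
  intro C β hC hβ
  set N := Subgroup.normalizer (H : Set S) with hN
  obtain ⟨ψ, hψ, hψβ, hψH, hψN⟩ := exists_extension_of_mor hβ
  have hCN : C ⊔ H ≤ N := hψN.le_left
  have hle : nphi N N C β ≤ nphi N N (C ⊔ H) ψ := by
    rintro x ⟨hx, hxC, z, hz, hxz⟩
    have hcjm : ∀ c ∈ C ⊔ H, cj x c ∈ C ⊔ H := by
      intro c hc
      have : C ⊔ H ≤ (C ⊔ H).comap (MulAut.conj x).toMonoidHom := sup_le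
        (fun c hc => Subgroup.mem_sup_left ((hxC c).2 hc))
        fun c hc => Subgroup.mem_sup_right ((mem_normalizer_iff_cj.1 hx c).2 hc)
      exact this hc
    have hxn := mem_normalizer_iff_cj.1 (mem_normalizer_of_cj hcjm)
    have h1 : (F.normalizerSystem H).Mor (ψ ∘ cj x) (C ⊔ H) N :=
      ((F.normalizerSystem H).mor_cj hx hCN hCN hcjm).comp hψN
    have h2 : (F.normalizerSystem H).Mor (cj z ∘ ψ) (C ⊔ H) N :=
      hψN.comp ((F.normalizerSystem H).mor_cj hz le_rfl le_rfl fun a ha => cj_mem hz ha)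
    -- The maps `ψ ∘ c_x` and `c_z ∘ ψ` agree on `C` only; on `C ⊔ H` they differ by a conjugation,
    -- which corrects `z`.
    obtain ⟨w, hw, hwx⟩ := hepi hC le_sup_left h2 h1 fun c hc => by
      rw [Function.comp_apply, Function.comp_apply, hψβ c hc, hψβ _ ((hxC c).2 hc), hxz c hc]
    refine ⟨hx, hxn, w * z, mul_mem hw hz, fun c hc => ?_⟩
    have := hwx c hc
    rw [Function.comp_apply, Function.comp_apply, cj_cj] at this
    exact this
  -- `C` is only known to be centric in the normalizer system, but `C ⊔ H` is centric in `F` because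
  -- it contains `H`.
  obtain ⟨β', hβ', hβψ⟩ := (hF.good hS).ext (hHc.mono (le_sup_right : H ≤ C ⊔ H) le_top) hψ.top
  have hle2 : C ⊔ H ≤ nphi N N (C ⊔ H) ψ := hψN.le_nphi hCN le_rfl
  have hm := mor_normalizerSystem (hβ'.restrict (nphi_mono (T := N) (U := N) le_top le_top))
    (le_sup_right.trans hle2) (fun x hx => hx.1) fun x hx => by
      rw [hβψ x (Subgroup.mem_sup_right hx)]
      exact hψH x hx
  refine ⟨β', hm.restrict hle, fun c hc => ?_⟩
  rw [hβψ c (Subgroup.mem_sup_left hc), hψβ c hc]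

end Normalizer

/-! ## Counting morphisms to the underlying group in the orbit category -/

section Count

variable {T : Subgroup S} (E : FusionSystem T)

/-- Equality of morphisms `K → T` in the orbit category. -/
def repSetoid (K : Subgroup S) : Setoid {α : S → S // E.Mor α K T} where
  r α β := Cj T K α.1 β.1
  iseqv := ⟨fun _ => Cj.refl _ _ _, fun h => h.symm, fun h h' => h.trans h'⟩

/-- The morphisms `K → T` of the orbit category. -/
def RepTop (K : Subgroup S) : Type u := Quotient (repSetoid E K)

variable {E} [Finite S] {p : ℕ} [Fact p.Prime]

instance (K : Subgroup S) : Finite (RepTop E K) :=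
  inferInstanceAs (Finite (Quotient (repSetoid E K)))

/-- The number is the index of the inner automorphisms of `T` in its automorphism group in `E`. By
`Star` every automorphism of `p`-power order is inner, so the inner ones form a Sylow `p`-subgroup.
-/
theorem card_repTop_self (hS : IsPGroup p S) (hE : E.Star p T) : ¬p ∣ Nat.card (RepTop E T) := by
  set Γ := E.autTop
  let B : Subgroup Γ := (MulAut.conj : T →* MulAut T).range.subgroupOf Γ
  have hB : IsPGroup p B := by
    rintro ⟨e, t, ht⟩
    obtain ⟨k, hk⟩ := hS.to_subgroup T t
    refine ⟨k, Subtype.ext (Subtype.ext ?_)⟩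
    change (e : MulAut T) ^ p ^ k = 1
    rw [← show MulAut.conj t = (e : MulAut T) from ht, ← map_pow, hk, map_one]
  obtain ⟨P, hP⟩ := hB.exists_le_sylow
  have hfn : ∀ e : Γ, ∃ α : S → S, E.Mor α T T ∧ ∀ t : T, α t = e.1 t := by
    classical
    intro e
    refine ⟨fun x => if hx : x ∈ T then e.1 ⟨x, hx⟩ else 1, ⟨_, e.2, fun a => ?_⟩, fun t => ?_⟩
    · simp
    · simp
  choose fn hfnm hfn using hfn
  have hPB : (P : Subgroup Γ) = B := by
    refine le_antisymm (fun e he => ?_) hP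
    obtain ⟨k, hk⟩ := P.isPGroup' ⟨e, he⟩
    have hk' : e ^ p ^ k = 1 := congrArg Subtype.val hk
    have hpow : ∀ m (t : T), (fn e)^[m] t = (e ^ m : Γ).1 t := by
      intro m
      induction m with
      | zero => exact fun t => rfl
      | succ m ih =>
        intro t
        rw [Function.iterate_succ_apply', ih, hfn, pow_succ']
        rfl
    obtain ⟨χ, hχ, y, hy, hyx⟩ := hE (fn e) (hfnm e) ⟨k, fun c hc => by
      rw [hpow _ ⟨c, hc⟩, hk']; rfl⟩
    have him : img χ T = T := hχ.of_isPGroup_card_le le_rfl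
    rw [← him, hχ.mem_img] at hy
    obtain ⟨t, ht, rfl⟩ := hy
    refine ⟨⟨t, ht⟩, MulEquiv.ext fun x => Subtype.ext ?_⟩
    change cj t x = e.1 x
    rw [← hfn]
    refine hχ.inj (cj_mem ht x.2) ((hfnm e).mem x.2) ?_
    rw [hyx x x.2, hχ.map_cj ht x.2]
  have hidx : ¬p ∣ B.index := hPB ▸ P.not_dvd_index
  rw [Subgroup.index, ← Nat.card_congr (QuotientGroup.quotientRightRelEquivQuotientLeftRel B)] at hidx
  convert hidx using 2
  symm
  refine Nat.card_eq_of_bijective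
    (Quotient.map' (s₁ := QuotientGroup.rightRel B) (s₂ := repSetoid E T)
      (fun e => ⟨fn e, hfnm e⟩) ?_) ⟨?_, ?_⟩
  · intro e e' h
    obtain ⟨t, ht⟩ := QuotientGroup.rightRel_apply.1 h
    refine ⟨t, t.2, fun c hc => ?_⟩
    have h2 : e'.1 = MulAut.conj t * e.1 := by
      rw [ht]; simp
    change fn e' c = cj (t : S) (fn e c)
    rw [hfn e' ⟨c, hc⟩, hfn e ⟨c, hc⟩, h2]
    rfl
  · rintro ⟨e⟩ ⟨e'⟩ h
    obtain ⟨t, ht, h⟩ := Quotient.exact (s := repSetoid E T) h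
    refine Quotient.sound' (s₁ := QuotientGroup.rightRel B) (QuotientGroup.rightRel_apply.2 ⟨⟨t, ht⟩, ?_⟩)
    refine eq_mul_inv_of_mul_eq (MulEquiv.ext fun c => Subtype.ext ?_)
    have h3 : fn e' c = cj t (fn e c) := h c c.2
    rw [hfn, hfn] at h3
    exact h3.symm
  · rintro ⟨α, hα⟩
    obtain ⟨φ, hφ, he⟩ := hα
    have hb : Function.Bijective φ := Finite.injective_iff_bijective.1 (E.injective_of_mem hφ)
    refine ⟨Quotient.mk _ ⟨MulEquiv.ofBijective φ hb, (E.iso_mem _ hφ fun a => rfl).1⟩,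
      Quotient.sound (s := repSetoid E T) (Cj.of_eq fun c hc => ?_)⟩
    change α c = fn _ c
    rw [hfn _ ⟨c, hc⟩, ← he ⟨c, hc⟩]
    rfl

/-- Upward induction on `K`. The `p`-group `N = N_T(K)` acts on the morphisms `K → T` by
precomposition. A class is fixed exactly when it extends to `N`, and it does so uniquely, so the
numbers for `K` and `N` are congruent modulo `p`. -/
theorem card_repTop (hS : IsPGroup p S) (hE : E.Good) (hstar : E.Star p T) {K : Subgroup S}
    (hK : E.IsCentric K) : ¬p ∣ Nat.card (RepTop E K) := by
  induction K using WellFoundedGT.induction with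
  | ind K ih =>
    rcases hK.1.eq_or_lt with rfl | hlt
    · exact card_repTop_self hS hstar
    have hlt' := lt_normalizer_inf (hS.to_subgroup T) hlt
    set N := T ⊓ Subgroup.normalizer (K : Set S) with hN
    have hKN : K ≤ N := hlt'.le
    have hNK : ∀ n ∈ N, ∀ c, cj n c ∈ K ↔ c ∈ K := fun n hn => mem_normalizer_iff_cj.1 hn.2
    have hmN : ∀ n ∈ N, E.Mor (cj n) K K := fun n hn =>
      E.mor_cj hn.1 hK.1 hK.1 fun a ha => (hNK n hn a).2 ha
    let act : MulAction N (RepTop E K) :=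
      { smul := fun n => Quotient.map' (s₁ := repSetoid E K) (s₂ := repSetoid E K)
          (fun α => ⟨α.1 ∘ cj ((n⁻¹ : N) : S), (hmN _ (n⁻¹).2).comp α.2⟩)
          fun α β h => h.precomp fun c hc => (hNK _ (n⁻¹).2 c).2 hc
        one_smul := by
          rintro ⟨α⟩
          refine congrArg (Quotient.mk _) (Subtype.ext (funext fun x => ?_))
          simp [cj]
        mul_smul := by
          rintro n m ⟨α⟩
          refine congrArg (Quotient.mk _) (Subtype.ext (funext fun x => ?_))
          simp [cj, mul_assoc] }
    have hmod := (hS.to_subgroup N).card_modEq_card_fixedPoints (RepTop E K)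
    have hcard : Nat.card (RepTop E N) = Nat.card (MulAction.fixedPoints N (RepTop E K)) := by
      refine Nat.card_eq_of_bijective (fun x => ⟨Quotient.map' (s₁ := repSetoid E N)
        (s₂ := repSetoid E K) (fun α => ⟨α.1, α.2.restrict hKN⟩)
        (fun α β h => h.mono le_rfl hKN) x, ?_⟩) ⟨?_, ?_⟩
      · obtain ⟨α, hα⟩ := x
        intro n
        refine Quotient.sound (s := repSetoid E K) (Cj.symm
          ⟨α ((n⁻¹ : N) : S), hα.mem (n⁻¹).2, fun c hc => ?_⟩)
        exact hα.map_cj (n⁻¹).2 (hKN hc)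
      · rintro ⟨α, hα⟩ ⟨β, hβ⟩ h
        obtain ⟨t, ht, h⟩ := Quotient.exact (s := repSetoid E K) (congrArg Subtype.val h)
        refine Quotient.sound (s := repSetoid E N) (Cj.trans ⟨t, ht, fun c _ => rfl⟩ ?_)
        have h1 : E.Mor (cj t ∘ α) N T :=
          hα.comp (E.mor_cj ht le_rfl le_rfl fun a ha => cj_mem ht ha)
        exact hE.epi hK hKN h1 hβ h
      · rintro ⟨⟨α, hα⟩, hfix⟩
        obtain ⟨β, hβ, h⟩ := hE.ext hK hα
        have hle : N ≤ nphi T T K α := by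
          intro n hn
          obtain ⟨z, hz, hzc⟩ := Quotient.exact (s := repSetoid E K) (hfix ⟨n, hn⟩⁻¹)
          refine ⟨hn.1, hNK n hn, z⁻¹, inv_mem hz, fun c hc => ?_⟩
          have := hzc c hc
          simp only [Function.comp_apply, inv_inv] at this
          rw [this, cj_inv_cj]
        refine ⟨Quotient.mk _ ⟨β, hβ.restrict hle⟩, Subtype.ext
          (Quotient.sound (s := repSetoid E K) (Cj.of_eq fun c hc => (h c hc).symm))⟩
    have h1 := ih N hlt' (hK.mono hKN inf_le_left)
    rw [hcard] at h1
    exact fun hdvd => h1 ((hmod.dvd_iff dvd_rfl).1 hdvd)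

/-- A pair with image `J` is inverted to a morphism `J → A ≤ T`. Conversely, a morphism `J → T`
together with the identity of `J` factors through exactly one pair, and that pair has image `J`.
These numbers are the diagonal entries of multiplication by the class of `T`. -/
theorem IsProductReps.card_filter_im [DecidableEq (Subgroup S)] (hS : IsPGroup p S) (hE : E.Good)
    {J : Subgroup S} (hJ : E.IsCentric J) {X : Finset (OrbitPair E T J)}
    (hX : IsProductReps E T J X) : (X.filter (fun P => P.im = J)).card = Nat.card (RepTop E J) := by
  have hinv : ∀ P : OrbitPair E T J, P.im = J → E.Mor (finv P.fn P.A) J P.A := fun P hP => by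
    have := P.mor.finv
    rwa [← P.im_eq, hP] at this
  have happ : ∀ P : OrbitPair E T J, P.im = J → ∀ j ∈ J, P.fn (finv P.fn P.A j) = j :=
    fun P hP j hj => P.mor.apply_finv (by rwa [← P.im_eq, hP])
  rw [← Nat.card_eq_finsetCard]
  refine Nat.card_eq_of_bijective (fun P => Quotient.mk (repSetoid E J)
    ⟨finv P.1.fn P.1.A, (hinv P.1 (Finset.mem_filter.1 P.2).2).top⟩) ⟨?_, ?_⟩
  · rintro ⟨P, hP⟩ ⟨P', hP'⟩ h
    obtain ⟨hPX, hPJ⟩ := Finset.mem_filter.1 hP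
    obtain ⟨hPX', hPJ'⟩ := Finset.mem_filter.1 hP'
    refine Subtype.ext (hX.factor_unique hS hE le_rfl hJ hPX hPX' (hinv P hPJ) (hinv P' hPJ')
      (Quotient.exact (s := repSetoid E J) h) (Cj.of_eq fun c hc => ?_)).1
    rw [Function.comp_apply, Function.comp_apply, happ P hPJ c hc, happ P' hPJ' c hc]
  · rintro ⟨α, hα⟩
    obtain ⟨P, hP, δ, hδ, h1, k, hk, h2⟩ := hX.exists_factor hJ hα (E.mor_id le_rfl hJ.1)
    have hcj : ∀ c ∈ J, P.fn (δ (cj k⁻¹ c)) = c := fun c hc => by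
      have := h2 (cj k⁻¹ c) (cj_mem (inv_mem hk) hc)
      rwa [Function.comp_apply, id, cj_cj_inv] at this
    have him : P.im = J := le_antisymm P.im_le fun c hc => by
      rw [P.im_eq, ← hcj c hc]
      exact mem_img_of_mem (hδ.mem (cj_mem (inv_mem hk) hc))
    refine ⟨⟨P, Finset.mem_filter.2 ⟨hP, him⟩⟩, Quotient.sound (s := repSetoid E J)
      (Cj.symm (h1.trans ⟨δ k⁻¹, P.centric.1 (hδ.mem (inv_mem hk)), fun c hc => ?_⟩))⟩
    change finv P.fn P.A c = _
    rw [← hδ.map_cj (inv_mem hk) hc]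
    conv_lhs => rw [← hcj c hc]
    exact P.mor.finv_apply (hδ.mem (cj_mem (inv_mem hk) hc))

end Count

end FusionMackey

namespace FusionMackey

open FusionSystem

variable {S : Type u} [Group S]

/-! ## Families that represent the same functor -/

/-- Go from an `Ok` member of one family to the member of the other above it, and back: by
uniqueness this returns to the start. So the `Ok` members correspond bijectively and are comparable
in both directions, and the remaining members contribute zero. -/
theorem sum_eq_sum_of_cover {Z ι κ N : Type*} [AddCommMonoid N] (Ok : Z → Prop) (r : Z → Z → Prop)
    (hrefl : ∀ x, Ok x → r x x) (htrans : ∀ x y z, r x y → r y z → r x z)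
    {s : Finset ι} {z : ι → Z} {t : Finset κ} {z' : κ → Z}
    (hup : ∀ x, ∀ i ∈ s, Ok x → r x (z i) → Ok (z i))
    (hup' : ∀ x, ∀ j ∈ t, Ok x → r x (z' j) → Ok (z' j))
    (hs : ∀ x, Ok x → ∃! i, i ∈ s ∧ r x (z i)) (ht : ∀ x, Ok x → ∃! j, j ∈ t ∧ r x (z' j))
    (w : Z → N) (hw : ∀ x y, Ok x → Ok y → r x y → r y x → w x = w y)
    (hs0 : ∀ i ∈ s, ¬Ok (z i) → w (z i) = 0) (ht0 : ∀ j ∈ t, ¬Ok (z' j) → w (z' j) = 0) :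
    ∑ i ∈ s, w (z i) = ∑ j ∈ t, w (z' j) := by
  classical
  have e1 : ∑ i ∈ s, w (z i) = ∑ i ∈ s.filter (fun i => Ok (z i)), w (z i) := by
    rw [Finset.sum_filter_of_ne]
    intro i hi h
    by_contra hcon
    exact h (hs0 i hi hcon)
  have e2 : ∑ j ∈ t, w (z' j) = ∑ j ∈ t.filter (fun j => Ok (z' j)), w (z' j) := by
    rw [Finset.sum_filter_of_ne]
    intro i hi h
    by_contra hcon
    exact h (ht0 i hi hcon)
  rw [e1, e2]
  have hf : ∀ i ∈ s.filter (fun i => Ok (z i)), ∃ j ∈ t.filter (fun j => Ok (z' j)),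
      r (z i) (z' j) ∧ r (z' j) (z i) := by
    intro i hi
    obtain ⟨hi, hok⟩ := Finset.mem_filter.1 hi
    obtain ⟨j, ⟨hj, hij⟩, -⟩ := ht _ hok
    have hokj := hup' _ _ hj hok hij
    obtain ⟨i', ⟨hi', hji'⟩, -⟩ := hs _ hokj
    obtain rfl := (hs _ hok).unique ⟨hi, hrefl _ hok⟩ ⟨hi', htrans _ _ _ hij hji'⟩
    exact ⟨j, Finset.mem_filter.2 ⟨hj, hokj⟩, hij, hji'⟩
  have hg : ∀ j ∈ t.filter (fun j => Ok (z' j)), ∃ i ∈ s.filter (fun i => Ok (z i)),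
      r (z i) (z' j) ∧ r (z' j) (z i) := by
    intro j hj
    obtain ⟨hj, hok⟩ := Finset.mem_filter.1 hj
    obtain ⟨i, ⟨hi, hji⟩, -⟩ := hs _ hok
    have hoki := hup _ _ hi hok hji
    obtain ⟨j', ⟨hj', hij'⟩, -⟩ := ht _ hoki
    obtain rfl := (ht _ hok).unique ⟨hj, hrefl _ hok⟩ ⟨hj', htrans _ _ _ hji hij'⟩
    exact ⟨i, Finset.mem_filter.2 ⟨hi, hoki⟩, hij', hji⟩
  choose f hfm hf1 hf2 using hf
  choose g hgm hg1 hg2 using hg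
  refine Finset.sum_bij' f g hfm hgm (fun i hi => ?_) (fun j hj => ?_) fun i hi => ?_
  · obtain ⟨hi', hok⟩ := Finset.mem_filter.1 hi
    refine (hs _ hok).unique ⟨(Finset.mem_filter.1 (hgm _ (hfm i hi))).1, ?_⟩ ⟨hi', hrefl _ hok⟩
    exact htrans _ _ _ (hf1 i hi) (hg2 _ (hfm i hi))
  · obtain ⟨hj', hok⟩ := Finset.mem_filter.1 hj
    refine (ht _ hok).unique ⟨(Finset.mem_filter.1 (hfm _ (hgm j hj))).1, ?_⟩ ⟨hj', hrefl _ hok⟩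
    exact htrans _ _ _ (hg2 j hj) (hf1 _ (hgm j hj))
  · exact hw _ _ (Finset.mem_filter.1 hi).2 (Finset.mem_filter.1 (hfm i hi)).2 (hf1 i hi) (hf2 i hi)

/-- A subgroup with three maps out of it. -/
structure Span (S : Type u) [Group S] where
  C : Subgroup S
  a : S → S
  b : S → S
  c : S → S

variable {T T' T'' : Subgroup S}

/-- `x` factors through `y` in the orbit category. -/
def Span.Le (E : FusionSystem T) (H K L : Subgroup S) (x y : Span S) : Prop :=
  ∃ δ, E.Mor δ x.C y.C ∧ Cj H x.C x.a (y.a ∘ δ) ∧ Cj K x.C x.b (y.b ∘ δ) ∧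
    Cj L x.C x.c (y.c ∘ δ)

theorem Span.Le.refl {E : FusionSystem T} {H K L : Subgroup S} {x : Span S} (h : x.C ≤ T) :
    Span.Le E H K L x x :=
  ⟨id, E.mor_id le_rfl h, Cj.refl _ _ _, Cj.refl _ _ _, Cj.refl _ _ _⟩

theorem Span.Le.trans {E : FusionSystem T} {H K L : Subgroup S} {x y z : Span S}
    (h : Span.Le E H K L x y) (h' : Span.Le E H K L y z) : Span.Le E H K L x z := by
  obtain ⟨δ, hδ, h1, h2, h3⟩ := h
  obtain ⟨ε, hε, h4, h5, h6⟩ := h'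
  have hm : ∀ c ∈ x.C, δ c ∈ y.C := fun c hc => hδ.mem hc
  exact ⟨ε ∘ δ, hδ.comp hε, h1.trans (h4.precomp hm), h2.trans (h5.precomp hm),
    h3.trans (h6.precomp hm)⟩

/-- Spans `C → H`, `C → L` in `E` with `C` centric in `F`. -/
def Ok2 (F : FusionSystem T'') (E : FusionSystem T) (H L : Subgroup S) (x : Span S) : Prop :=
  F.IsCentric x.C ∧ x.b = (fun _ => 1) ∧ E.Mor x.a x.C H ∧ E.Mor x.c x.C L

/-- Spans `C → H` in `E'`, `C → K` and `C → L` in `E`, with `C` centric in `F`. -/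
def Ok3 (F : FusionSystem T'') (E' : FusionSystem T') (E : FusionSystem T) (H K L : Subgroup S)
    (x : Span S) : Prop :=
  F.IsCentric x.C ∧ E'.Mor x.a x.C H ∧ E.Mor x.b x.C K ∧ E.Mor x.c x.C L

theorem Cj.postcomp {E : FusionSystem T} {A B C : Subgroup S} {φ δ δ' : S → S} (hφ : E.Mor φ A B)
    (h : Cj A C δ δ') (hδ : ∀ c ∈ C, δ c ∈ A) : Cj (img φ A) C (φ ∘ δ) (φ ∘ δ') := by
  obtain ⟨a, ha, h⟩ := h
  refine ⟨φ a, mem_img_of_mem ha, fun c hc => ?_⟩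
  rw [Function.comp_apply, h c hc, hφ.map_cj ha (hδ c hc), Function.comp_apply]

theorem Cj.finv {E : FusionSystem T} {A B C : Subgroup S} {φ δ η : S → S} (hφ : E.Mor φ A B)
    (h : Cj (img φ A) C (φ ∘ δ) η) (hδ : ∀ c ∈ C, δ c ∈ A) : Cj A C δ (finv φ A ∘ η) := by
  have := Cj.postcomp hφ.finv h fun c hc => mem_img_of_mem (hδ c hc)
  rw [hφ.img_finv] at this
  exact (Cj.of_eq fun c hc => hφ.finv_apply (hδ c hc)).trans this

/-! ### Families of spans that represent double and triple products. -/

section Cover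

variable [Finite S] {p : ℕ} [Fact p.Prime] {F : FusionSystem T''} {E' : FusionSystem T'}
  {E : FusionSystem T} {H K L : Subgroup S}

/-- The representatives of `[H ×_E L]`, transported along an isomorphism `σ : H₀ → H`. -/
theorem IsProductReps.cover (hS : IsPGroup p S) (hE : E.Good) (hEF : E.Sub F) {H₀ : Subgroup S}
    {σ : S → S} (hσ : E.Mor σ H₀ H) (him : img σ H₀ = H) {X : Finset (OrbitPair E H L)}
    (hX : IsProductReps E H L X) (x : Span S) (hx : Ok2 F E H₀ L x) :
    ∃! P, P ∈ X ∧ Span.Le E H₀ ⊥ L x ⟨P.A, FusionMackey.finv σ H₀, fun _ => 1, P.fn⟩ := by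
  obtain ⟨hC, hb, ha, hc⟩ := hx
  have hC' := hEF.centric hC ha.le_left
  have hH : H ≤ T := hσ.le_right
  have hb' : ∀ δ : S → S, Cj ⊥ x.C x.b ((fun _ => 1) ∘ δ) := fun δ => Cj.of_eq fun c _ => by
    rw [hb]; rfl
  refine existsUnique_of_exists_of_unique ?_ ?_
  · obtain ⟨P, hP, δ, hδ, h1, h2⟩ := hX.exists_factor hC' (ha.comp hσ) hc
    refine ⟨P, hP, δ, hδ, ?_, hb' δ, h2⟩
    rw [← him] at h1
    exact Cj.finv hσ h1 fun c hc => ha.mem hc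
  · rintro P P' ⟨hP, δ, hδ, h1, -, h2⟩ ⟨hP', δ', hδ', h1', -, h2'⟩
    have key : ∀ {Q : OrbitPair E H L} {ε : S → S}, E.Mor ε x.C Q.A →
        Cj H₀ x.C x.a (FusionMackey.finv σ H₀ ∘ ε) → Cj H x.C (σ ∘ x.a) ε := by
      intro Q ε hε h
      have := Cj.postcomp hσ h fun c hc => ha.mem hc
      rw [him] at this
      refine this.trans (Cj.of_eq fun c hc => ?_)
      rw [Function.comp_apply, Function.comp_apply, hσ.apply_finv]
      rw [him]
      exact Q.le (hε.mem hc)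
    exact (hX.factor_unique hS hE hH hC' hP hP' hδ hδ' ((key hδ h1).symm.trans (key hδ' h1'))
      (h2.symm.trans h2')).1

/-- The universal property of `[H ×_E L]` in the language of spans; together with `cover_flip` it
expresses the symmetry of the product. -/
theorem IsProductReps.cover_id (hS : IsPGroup p S) (hE : E.Good) (hEF : E.Sub F) (hH : H ≤ T)
    {X : Finset (OrbitPair E H L)}
    (hX : IsProductReps E H L X) (x : Span S) (hx : Ok2 F E H L x) :
    ∃! P, P ∈ X ∧ Span.Le E H ⊥ L x ⟨P.A, id, fun _ => 1, P.fn⟩ := by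
  obtain ⟨hC, hb, ha, hc⟩ := hx
  have hC' := hEF.centric hC ha.le_left
  refine existsUnique_of_exists_of_unique ?_ ?_
  · obtain ⟨P, hP, δ, hδ, h1, h2⟩ := hX.exists_factor hC' ha hc
    exact ⟨P, hP, δ, hδ, h1, Cj.of_eq fun c _ => by rw [hb]; rfl, h2⟩
  · rintro P P' ⟨hP, δ, hδ, h1, -, h2⟩ ⟨hP', δ', hδ', h1', -, h2'⟩
    exact (hX.factor_unique hS hE hH hC' hP hP' hδ hδ' (h1.symm.trans h1') (h2.symm.trans h2')).1

theorem IsProductReps.cover_flip (hS : IsPGroup p S) (hE : E.Good) (hEF : E.Sub F) (hL : L ≤ T)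
    {X : Finset (OrbitPair E L H)}
    (hX : IsProductReps E L H X) (x : Span S) (hx : Ok2 F E H L x) :
    ∃! P, P ∈ X ∧ Span.Le E H ⊥ L x ⟨P.A, P.fn, fun _ => 1, id⟩ := by
  obtain ⟨hC, hb, ha, hc⟩ := hx
  have hC' := hEF.centric hC ha.le_left
  refine existsUnique_of_exists_of_unique ?_ ?_
  · obtain ⟨P, hP, δ, hδ, h1, h2⟩ := hX.exists_factor hC' hc ha
    exact ⟨P, hP, δ, hδ, h2, Cj.of_eq fun c _ => by rw [hb]; rfl, h1⟩
  · rintro P P' ⟨hP, δ, hδ, h1, -, h2⟩ ⟨hP', δ', hδ', h1', -, h2'⟩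
    exact (hX.factor_unique hS hE hL hC' hP hP' hδ hδ' (h2.symm.trans h2') (h1.symm.trans h1')).1

/-- Factor first through `[K ×_E L]`, then through the product of `H` with the image of the pair
found. The leg to `H` may live in a larger system `E'`, as the mixed product formula requires. -/
theorem cover_left (hS : IsPGroup p S) (hE : E.Good) (hE' : E'.Good) (hEE' : E.Sub E')
    (hEF : E'.Sub F) (hH : H ≤ T') (hK : K ≤ T) {X : Finset (OrbitPair E K L)}
    (hX : IsProductReps E K L X) {Y : ∀ Q : OrbitPair E K L, Finset (OrbitPair E' H Q.im)}
    (hY : ∀ Q, IsProductReps E' H Q.im (Y Q)) (x : Span S) (hx : Ok3 F E' E H K L x) :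
    ∃! i : (Q : OrbitPair E K L) × OrbitPair E' H Q.im, i ∈ X.sigma Y ∧ Span.Le E H K L x
      ⟨i.2.im, finv i.2.fn i.2.A, finv i.1.fn i.1.A, id⟩ := by
  obtain ⟨hC, ha, hb, hc⟩ := hx
  have hC' := hEF.centric hC ha.le_left
  have hC'' := hEE'.centric hC' hb.le_left
  refine existsUnique_of_exists_of_unique ?_ ?_
  · obtain ⟨Q, hQ, δ, hδ, h1, h2⟩ := hX.exists_factor hC'' hb hc
    have hQδ : E.Mor (Q.fn ∘ δ) x.C Q.im := by
      rw [Q.im_eq]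
      exact hδ.comp Q.mor.onto
    obtain ⟨P, hP, ε, hε, h3, h4⟩ := (hY Q).exists_factor hC' ha (hEE' _ _ _ hQδ)
    -- `P` belongs to `E'`, but `P.fn ∘ ε` differs from the `E`-morphism `Q.fn ∘ δ` only by a
    -- conjugation in `Q.im`.
    have hη : E.Mor (P.fn ∘ ε) x.C P.im := by
      have h4' := h4
      obtain ⟨q, hq, h4'⟩ := h4'
      refine ((hQδ.comp (E.mor_cj (hQδ.le_right hq) hQδ.le_right hQδ.le_right fun a ha =>
        cj_mem hq ha)).congr h4').cod (fun c hc => ?_) (P.im_le.trans hQδ.le_right)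
      rw [P.im_eq]
      exact mem_img_of_mem (hε.mem hc)
    refine ⟨⟨Q, P⟩, Finset.mem_sigma.2 ⟨hQ, hP⟩, P.fn ∘ ε, hη, ?_, ?_, ?_⟩
    · exact h3.trans (Cj.of_eq fun c hc => P.mor.finv_apply (hε.mem hc))
    · refine h1.trans ((Cj.finv Q.mor ?_ fun c hc => hδ.mem hc).mono Q.le le_rfl)
      rwa [← Q.im_eq]
    · exact h2.trans (h4.mono Q.im_le le_rfl)
  · rintro ⟨Q, P⟩ ⟨Q', P'⟩ ⟨hi, η, hη, h1, h2, h3⟩ ⟨hi', η', hη', h1', h2', h3'⟩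
    obtain ⟨hQ, hP⟩ := Finset.mem_sigma.1 hi
    obtain ⟨hQ', hP'⟩ := Finset.mem_sigma.1 hi'
    dsimp only at *
    have hmQ : ∀ c ∈ x.C, η c ∈ img Q.fn Q.A := fun c hc => by
      rw [← Q.im_eq]
      exact P.im_le (hη.mem hc)
    have hmQ' : ∀ c ∈ x.C, η' c ∈ img Q'.fn Q'.A := fun c hc => by
      rw [← Q'.im_eq]
      exact P'.im_le (hη'.mem hc)
    have hδ := (hη.cod hmQ (Q.mor.img_le.trans Q.mor.le_right)).comp Q.mor.finv
    have hδ' := (hη'.cod hmQ' (Q'.mor.img_le.trans Q'.mor.le_right)).comp Q'.mor.finv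
    obtain ⟨rfl, hj⟩ := hX.factor_unique hS hE hK hC'' hQ hQ' hδ hδ' (h2.symm.trans h2') (by
      refine ((Cj.of_eq fun c hc => ?_).trans (h3.symm.trans h3')).trans (Cj.of_eq fun c hc => ?_)
      · exact (Q.mor.apply_finv (hmQ c hc)).symm
      · exact (Q'.mor.apply_finv (hmQ' c hc)))
    have hmP : ∀ c ∈ x.C, η c ∈ img P.fn P.A := fun c hc => by
      rw [← P.im_eq]
      exact hη.mem hc
    have hmP' : ∀ c ∈ x.C, η' c ∈ img P'.fn P'.A := fun c hc => by
      rw [← P'.im_eq]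
      exact hη'.mem hc
    have hε := ((hEE' _ _ _ hη).cod hmP (P.mor.img_le.trans P.mor.le_right)).comp P.mor.finv
    have hε' := ((hEE' _ _ _ hη').cod hmP' (P'.mor.img_le.trans P'.mor.le_right)).comp P'.mor.finv
    have hηη : Cj Q.im x.C η η' := by
      rw [Q.im_eq]
      refine ((Cj.of_eq fun c hc => ?_).trans (Cj.postcomp Q.mor hj fun c hc => hδ.mem hc)).trans
        (Cj.of_eq fun c hc => ?_)
      · exact (Q.mor.apply_finv (hmQ c hc))
      · exact (Q.mor.apply_finv (hmQ' c hc)).symm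
    obtain ⟨rfl, -⟩ := (hY Q).factor_unique hS hE' hH hC' hP hP' hε hε' (h1.symm.trans h1') (by
      refine ((Cj.of_eq fun c hc => ?_).trans hηη).trans (Cj.of_eq fun c hc => ?_)
      · exact (P.mor.apply_finv (hmP c hc)).symm
      · exact (P'.mor.apply_finv (hmP' c hc)))
    rfl

/-- The same triples as in `cover_left`, factored first through `[H ×_{E'} K]` and then through the
product in `E` of the image with `L`. -/
theorem cover_right (hS : IsPGroup p S) (hE : E.Good) (hE' : E'.Good) (hEE' : E.Sub E')
    (hEF : E'.Sub F) (hH : H ≤ T') (hK : K ≤ T) {X : Finset (OrbitPair E' H K)}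
    (hX : IsProductReps E' H K X) {Y : ∀ P : OrbitPair E' H K, Finset (OrbitPair E P.im L)}
    (hY : ∀ P, IsProductReps E P.im L (Y P)) (x : Span S) (hx : Ok3 F E' E H K L x) :
    ∃! i : (P : OrbitPair E' H K) × OrbitPair E P.im L, i ∈ X.sigma Y ∧ Span.Le E H K L x
      ⟨i.2.A, finv i.1.fn i.1.A, id, i.2.fn⟩ := by
  obtain ⟨hC, ha, hb, hc⟩ := hx
  have hC' := hEF.centric hC ha.le_left
  have hC'' := hEE'.centric hC' hb.le_left
  refine existsUnique_of_exists_of_unique ?_ ?_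
  · obtain ⟨P, hP, ε, hε, h1, h2⟩ := hX.exists_factor hC' ha (hEE' _ _ _ hb)
    -- Up to a conjugation in `K` this is the `E`-morphism `x.b`, although `P` belongs to `E'`.
    have hPε : E.Mor (P.fn ∘ ε) x.C P.im := by
      have h2' := h2
      obtain ⟨q, hq, h2'⟩ := h2'
      refine ((hb.comp (E.mor_cj (hb.le_right hq) hb.le_right hb.le_right fun a ha =>
        cj_mem hq ha)).congr h2').cod (fun c hc => ?_) (P.im_le.trans hb.le_right)
      rw [P.im_eq]
      exact mem_img_of_mem (hε.mem hc)
    obtain ⟨Q, hQ, δ, hδ, h3, h4⟩ := (hY P).exists_factor hC'' hPε hc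
    refine ⟨⟨P, Q⟩, Finset.mem_sigma.2 ⟨hP, hQ⟩, δ, hδ, ?_, ?_, h4⟩
    · refine h1.trans ((Cj.finv P.mor ?_ fun c hc => hε.mem hc).mono P.le le_rfl)
      rwa [← P.im_eq]
    · exact h2.trans (h3.mono P.im_le le_rfl)
  · rintro ⟨P, Q⟩ ⟨P', Q'⟩ ⟨hi, δ, hδ, h1, h2, h3⟩ ⟨hi', δ', hδ', h1', h2', h3'⟩
    obtain ⟨hP, hQ⟩ := Finset.mem_sigma.1 hi
    obtain ⟨hP', hQ'⟩ := Finset.mem_sigma.1 hi'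
    dsimp only at *
    have hmP : ∀ c ∈ x.C, δ c ∈ img P.fn P.A := fun c hc => by
      rw [← P.im_eq]
      exact Q.le (hδ.mem hc)
    have hmP' : ∀ c ∈ x.C, δ' c ∈ img P'.fn P'.A := fun c hc => by
      rw [← P'.im_eq]
      exact Q'.le (hδ'.mem hc)
    have hε := ((hEE' _ _ _ hδ).cod hmP (P.mor.img_le.trans P.mor.le_right)).comp P.mor.finv
    have hε' := ((hEE' _ _ _ hδ').cod hmP' (P'.mor.img_le.trans P'.mor.le_right)).comp P'.mor.finv
    obtain ⟨rfl, hj⟩ := hX.factor_unique hS hE' hH hC' hP hP' hε hε' (h1.symm.trans h1') (by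
      refine ((Cj.of_eq fun c hc => ?_).trans (h2.symm.trans h2')).trans (Cj.of_eq fun c hc => ?_)
      · exact (P.mor.apply_finv (hmP c hc)).symm
      · exact (P'.mor.apply_finv (hmP' c hc)))
    have hδδ : Cj P.im x.C δ δ' := by
      rw [P.im_eq]
      refine ((Cj.of_eq fun c hc => ?_).trans (Cj.postcomp P.mor hj fun c hc => hε.mem hc)).trans
        (Cj.of_eq fun c hc => ?_)
      · exact (P.mor.apply_finv (hmP c hc))
      · exact (P.mor.apply_finv (hmP' c hc)).symm
    obtain ⟨rfl, -⟩ := (hY P).factor_unique hS hE (P.im_le.trans hK) hC'' hQ hQ' hδ hδ' hδδ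
      (h3.symm.trans h3')
    rfl

theorem Span.Le.exists_iso {x y : Span S} (h : Span.Le E H K L x y) (h' : Span.Le E H K L y x) :
    ∃ δ, E.Mor δ x.C y.C ∧ img δ x.C = y.C ∧ Cj H x.C x.a (y.a ∘ δ) ∧ Cj K x.C x.b (y.b ∘ δ) ∧
      Cj L x.C x.c (y.c ∘ δ) := by
  obtain ⟨δ, hδ, h⟩ := h
  obtain ⟨ε, hε, -⟩ := h'
  refine ⟨δ, hδ, hδ.of_isPGroup_card_le ?_, h⟩
  rw [← hε.card_img]
  exact Subgroup.card_le_of_le hε.img_le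

theorem Ok2.le {x : Span S} (h : Ok2 F E H L x) : x.C ≤ T := h.2.2.1.le_left

theorem Span.Le.centric {x y : Span S} (hEF : E.Sub F) (hx : F.IsCentric x.C)
    (h : Span.Le E H K L x y) : F.IsCentric y.C := by
  obtain ⟨δ, hδ, -⟩ := h
  exact hx.of_mor (hEF _ _ _ hδ)

theorem Cj.mor {C : Subgroup S} {α α' : S → S} (h : Cj H C α α') (hα : E.Mor α C H) :
    E.Mor α' C H := by
  obtain ⟨k, hk, e⟩ := h
  exact (hα.comp (E.mor_cj (hα.le_right hk) hα.le_right hα.le_right fun a ha =>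
    cj_mem hk ha)).congr e

end Cover

end FusionMackey

namespace FusionMackey

open FusionSystem

variable {S : Type u} [Group S] {T T' T'' : Subgroup S}

/-! ## The centric Burnside ring is commutative and associative -/

theorem isProductReps_productReps [Finite S] (F : FusionSystem T) (H K : Subgroup S) :
    IsProductReps F H K (productReps F H K) := (exists_isProductReps F H K).choose_spec

theorem CentricClass.mk_eq_mk {E : FusionSystem T} {A B : Subgroup S} {hA : E.IsCentric A}
    {hB : E.IsCentric B} (h : E.IsIso A B) : CentricClass.mk A hA = CentricClass.mk B hB :=
  Quotient.sound (s := centricSetoid E) h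

theorem CentricClass.rep_centric {E : FusionSystem T} (a : CentricClass E) : E.IsCentric a.rep :=
  (Quotient.out (s := centricSetoid E) a).2

theorem CentricClass.mk_rep {E : FusionSystem T} (a : CentricClass E) :
    CentricClass.mk a.rep a.rep_centric = a := Quotient.out_eq (s := centricSetoid E) a

theorem CentricClass.rep_mk {E : FusionSystem T} {A : Subgroup S} (hA : E.IsCentric A) :
    E.IsIso (CentricClass.mk A hA).rep A :=
  Quotient.exact (s := centricSetoid E) (CentricClass.mk_rep (CentricClass.mk A hA))

theorem FusionSystem.IsIso.card_eq {E : FusionSystem T} {A B : Subgroup S} (h : E.IsIso A B) :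
    Nat.card A = Nat.card B := by
  obtain ⟨e, -⟩ := h
  exact Nat.card_congr e.toEquiv

section Burnside

variable [Finite S] {p : ℕ} [Fact p.Prime] {R : Type v} [CommRing R] {E : FusionSystem T}
  {H K L : Subgroup S}

variable (R E) in
/-- The product of the classes of two subgroups. -/
noncomputable def classMul (H K : Subgroup S) : CentricBurnside R E :=
  ∑ P ∈ productReps E H K, Finsupp.single (CentricClass.mk P.A P.centric) 1

variable (R E) in
/-- The product of the centric Burnside ring as a bilinear map. -/
noncomputable def burnsideBilin :
    CentricBurnside R E →ₗ[R] CentricBurnside R E →ₗ[R] CentricBurnside R E :=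
  Finsupp.linearCombination R fun a => Finsupp.linearCombination R fun b => classMul R E a.rep b.rep

theorem burnsideMul_eq (x y : CentricBurnside R E) : burnsideMul x y = burnsideBilin R E x y := by
  rw [burnsideBilin, Finsupp.linearCombination_apply, burnsideMul, Finsupp.sum, Finsupp.sum,
    LinearMap.sum_apply]
  refine Finset.sum_congr rfl fun a _ => ?_
  rw [LinearMap.smul_apply, Finsupp.linearCombination_apply, Finsupp.sum, Finsupp.sum,
    Finset.smul_sum]
  refine Finset.sum_congr rfl fun b _ => ?_
  rw [classMul, smul_smul, Finset.smul_sum]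
  exact Finset.sum_congr rfl fun P _ => by rw [Finsupp.smul_single, smul_eq_mul, mul_one]

theorem burnsideBilin_single (a b : CentricClass E) :
    burnsideBilin R E (Finsupp.single a 1) (Finsupp.single b 1) = classMul R E a.rep b.rep := by
  simp [burnsideBilin]

open Classical in
variable (R E) in
/-- The class of the apex of a span. -/
noncomputable def Span.cls (x : Span S) : CentricBurnside R E :=
  if h : E.IsCentric x.C then Finsupp.single (CentricClass.mk x.C h) 1 else 0

theorem Span.cls_eq {x : Span S} (h : E.IsCentric x.C) :
    x.cls R E = Finsupp.single (CentricClass.mk x.C h) 1 := dif_pos h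

theorem Span.cls_congr {x y : Span S} (hx : E.IsCentric x.C) (h : Span.Le E H K L x y)
    (h' : Span.Le E H K L y x) : x.cls R E = y.cls R E := by
  obtain ⟨δ, hδ, him, -⟩ := h.exists_iso h'
  rw [cls_eq hx, cls_eq (hx.of_mor hδ), CentricClass.mk_eq_mk (him ▸ hδ.isIso)]

theorem sum_cls_eq_of_cover {ι κ : Type*} {Ok : Span S → Prop} (hOk : ∀ x, Ok x → E.IsCentric x.C)
    {s : Finset ι} {z : ι → Span S} {t : Finset κ} {z' : κ → Span S}
    (hs : ∀ x, Ok x → ∃! i, i ∈ s ∧ Span.Le E H K L x (z i))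
    (ht : ∀ x, Ok x → ∃! j, j ∈ t ∧ Span.Le E H K L x (z' j))
    (hs0 : ∀ i ∈ s, Ok (z i)) (ht0 : ∀ j ∈ t, Ok (z' j)) :
    ∑ i ∈ s, (z i).cls R E = ∑ j ∈ t, (z' j).cls R E :=
  sum_eq_sum_of_cover Ok (Span.Le E H K L) (fun x hx => Span.Le.refl (hOk x hx).1)
    (fun _ _ _ => Span.Le.trans) (fun _ i hi _ _ => hs0 i hi) (fun _ j hj _ _ => ht0 j hj) hs ht
    _ (fun _ _ hx _ h h' => Span.cls_congr (hOk _ hx) h h')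
    (fun i hi h => absurd (hs0 i hi) h) fun j hj h => absurd (ht0 j hj) h

theorem classMul_eq (H K : Subgroup S) (a b c : OrbitPair E H K → S → S) :
    classMul R E H K = ∑ P ∈ productReps E H K, (⟨P.A, a P, b P, c P⟩ : Span S).cls R E :=
  Finset.sum_congr rfl fun P _ => (Span.cls_eq (x := ⟨P.A, a P, b P, c P⟩) P.centric).symm

variable (R) in
theorem classMul_comm (hS : IsPGroup p S) (hE : E.Good) (hH : H ≤ T) (hK : K ≤ T) :
    classMul R E H K = classMul R E K H := by
  rw [classMul_eq H K (fun _ => id) (fun _ _ => 1) (fun P => P.fn),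
    classMul_eq K H (fun P => P.fn) (fun _ _ => 1) (fun P => id)]
  refine sum_cls_eq_of_cover (Ok := Ok2 E E H K) (fun x hx => hx.1)
    ((isProductReps_productReps E H K).cover_id hS hE (Sub.refl E) hH)
    ((isProductReps_productReps E K H).cover_flip hS hE (Sub.refl E) hK) ?_ ?_
  · exact fun P _ => ⟨P.centric, rfl, E.mor_id P.le hH, P.mor⟩
  · exact fun P _ => ⟨P.centric, rfl, P.mor, E.mor_id P.le hK⟩

variable (R) in
theorem classMul_congr (hS : IsPGroup p S) (hE : E.Good) {H₀ : Subgroup S} (h : E.IsIso H₀ H) :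
    classMul R E H₀ K = classMul R E H K := by
  obtain ⟨σ, hσ, him⟩ := isIso_iff_mor.1 h
  have hτ := hσ.finv
  rw [him] at hτ
  rw [classMul_eq H₀ K (fun _ => id) (fun _ _ => 1) (fun P => P.fn),
    classMul_eq H K (fun P => finv σ H₀) (fun _ _ => 1) (fun P => P.fn)]
  refine sum_cls_eq_of_cover (Ok := Ok2 E E H₀ K) (fun x hx => hx.1)
    ((isProductReps_productReps E H₀ K).cover_id hS hE (Sub.refl E) hσ.le_left)
    ((isProductReps_productReps E H K).cover hS hE (Sub.refl E) hσ him) ?_ ?_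
  · exact fun P _ => ⟨P.centric, rfl, E.mor_id P.le hσ.le_left, P.mor⟩
  · exact fun P _ => ⟨P.centric, rfl, hτ.restrict P.le, P.mor⟩

variable (R) in
-- Both sides list the apexes of the triple product of `H`, `K` and `L`, as found by `cover_left`
-- and `cover_right` with `E' = E`.
theorem classMul_assoc (hS : IsPGroup p S) (hE : E.Good) (hH : H ≤ T) (hK : K ≤ T) (hL : L ≤ T) :
    ∑ Q ∈ productReps E K L, classMul R E H Q.im =
      ∑ P ∈ productReps E H K, classMul R E P.im L := by
  have h1 := sum_cls_eq_of_cover (R := R) (Ok := Ok3 E E E H K L) (fun x hx => hx.1)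
    (cover_left hS hE hE (Sub.refl E) (Sub.refl E) hH hK (isProductReps_productReps E K L)
      (fun Q => isProductReps_productReps E H Q.im))
    (cover_right hS hE hE (Sub.refl E) (Sub.refl E) hH hK (isProductReps_productReps E H K)
      (fun P => isProductReps_productReps E P.im L)) ?_ ?_
  · rw [Finset.sum_sigma, Finset.sum_sigma] at h1
    refine Eq.trans (Finset.sum_congr rfl fun Q _ => ?_)
      (h1.trans (Finset.sum_congr rfl fun P _ => ?_))
    · refine Finset.sum_congr rfl fun P _ => ?_
      rw [P.im_eq, Span.cls_eq (x := ⟨img P.fn P.A, _, _, _⟩) (P.centric.img P.mor)]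
      rw [CentricClass.mk_eq_mk P.mor.isIso]
    · exact (classMul_eq (R := R) _ _ _ _ _).symm
  · rintro ⟨Q, P⟩ -
    have hm := P.mor.finv
    have hm' := Q.mor.finv
    rw [← P.im_eq] at hm
    rw [← Q.im_eq] at hm'
    refine ⟨?_, (hm.cod (fun a ha => P.le (hm.mem ha)) hH),
      (hm'.cod (fun a ha => Q.le (hm'.mem ha)) hK).restrict P.im_le,
      E.mor_id (P.im_le.trans Q.im_le) hL⟩
    change E.IsCentric P.im
    rw [P.im_eq]
    exact P.centric.img P.mor
  · rintro ⟨P, Q⟩ -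
    have hm := P.mor.finv
    rw [← P.im_eq] at hm
    exact ⟨Q.centric, (hm.cod (fun a ha => P.le (hm.mem ha)) hH).restrict Q.le,
      E.mor_id (Q.le.trans P.im_le) hK, Q.mor⟩

theorem OrbitPair.isIso_im (P : OrbitPair E H K) : E.IsIso P.A P.im := by
  rw [P.im_eq]
  exact P.mor.isIso

theorem burnsideBilin_comm (hS : IsPGroup p S) (hE : E.Good) (x y : CentricBurnside R E) :
    burnsideBilin R E x y = burnsideBilin R E y x := by
  have : burnsideBilin R E = (burnsideBilin R E).flip := by
    ext a b : 4
    simp only [LinearMap.comp_apply, Finsupp.lsingle_apply, LinearMap.flip_apply]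
    rw [burnsideBilin_single, burnsideBilin_single, classMul_comm R hS hE a.rep_centric.1
      b.rep_centric.1]
  exact LinearMap.congr_fun₂ this x y

theorem burnsideBilin_single_classMul (hS : IsPGroup p S) (hE : E.Good) (hK : K ≤ T)
    (a : CentricClass E) : burnsideBilin R E (Finsupp.single a 1) (classMul R E H K) =
      ∑ Q ∈ productReps E H K, classMul R E a.rep Q.im := by
  rw [classMul, map_sum]
  refine Finset.sum_congr rfl fun Q _ => ?_
  rw [burnsideBilin_single, classMul_comm R hS hE a.rep_centric.1 (CentricClass.rep_centric _).1,
    classMul_congr R hS hE ((CentricClass.rep_mk Q.centric).trans Q.isIso_im),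
    classMul_comm R hS hE (Q.im_le.trans hK) a.rep_centric.1]

theorem burnsideBilin_assoc (hS : IsPGroup p S) (hE : E.Good) (x y z : CentricBurnside R E) :
    burnsideBilin R E (burnsideBilin R E x y) z = burnsideBilin R E x (burnsideBilin R E y z) := by
  have key : ∀ a b c : CentricClass E, burnsideBilin R E (burnsideBilin R E (Finsupp.single a 1)
      (Finsupp.single b 1)) (Finsupp.single c 1) = burnsideBilin R E (Finsupp.single a 1)
      (burnsideBilin R E (Finsupp.single b 1) (Finsupp.single c 1)) := by
    intro a b c
    rw [burnsideBilin_single, burnsideBilin_single,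
      burnsideBilin_single_classMul hS hE c.rep_centric.1,
      classMul_assoc R hS hE a.rep_centric.1 b.rep_centric.1 c.rep_centric.1,
      burnsideBilin_comm hS hE, burnsideBilin_single_classMul hS hE b.rep_centric.1]
    exact Finset.sum_congr rfl fun P _ =>
      classMul_comm R hS hE c.rep_centric.1 (P.im_le.trans b.rep_centric.1)
  induction x using Finsupp.induction_linear with
  | zero => simp
  | add x x' hx hx' => simp only [map_add, LinearMap.add_apply, hx, hx']
  | single a r =>
    induction y using Finsupp.induction_linear with
    | zero => simp
    | add x x' hx hx' => simp only [map_add, LinearMap.add_apply, hx, hx']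
    | single b s =>
      induction z using Finsupp.induction_linear with
      | zero => simp
      | add x x' hx hx' => simp only [map_add, hx, hx']
      | single c t =>
        have e : ∀ (a : CentricClass E) (r : R), Finsupp.single a r = r • Finsupp.single a 1 :=
          fun a r => by rw [Finsupp.smul_single, smul_eq_mul, mul_one]
        rw [e a r, e b s, e c t]
        simp only [map_smul, LinearMap.smul_apply, key]

/-! ## Invertibility of the class of the underlying group -/

theorem IsPLocalRing.isUnit_natCast (hR : IsPLocalRing p R) {n : ℕ} (hn : ¬p ∣ n) :
    IsUnit (n : R) := by
  induction n using induction_on_primes with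
  | zero => exact absurd (dvd_zero p) hn
  | one => simp
  | prime_mul q a hq ih =>
    rw [Nat.cast_mul]
    refine (hR q hq fun e => hn (e ▸ dvd_mul_right q a)).mul (ih fun h => hn (h.mul_left q))

theorem rep_top (E : FusionSystem T) : (CentricClass.mk T (isCentric_self E)).rep = T := by
  have h := CentricClass.rep_mk (isCentric_self E)
  exact Subgroup.eq_of_le_of_card_ge (CentricClass.rep_centric _).1 h.card_eq.ge

/-- The product of the classes of `T` and `K` is the number of morphisms `K → T` times the class of
`K`, plus classes of smaller subgroups. The coefficient is prime to `p`, hence a unit, and induction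
on the order solves for the class of `K`. -/
theorem burnsideBilin_top_surjective (hS : IsPGroup p S) (hE : E.Good) (hstar : E.Star p T)
    (hR : IsPLocalRing p R) : Function.Surjective (burnsideBilin R E (burnsideTop R E)) := by
  classical
  rw [← LinearMap.range_eq_top, eq_top_iff]
  have key : ∀ n, ∀ b : CentricClass E, Nat.card b.rep = n →
      Finsupp.single b (1 : R) ∈ LinearMap.range (burnsideBilin R E (burnsideTop R E)) := by
    intro n
    induction n using Nat.strong_induction_on with
    | _ n ih =>
      rintro b rfl
      have hX := isProductReps_productReps E T b.rep
      have h1 : burnsideBilin R E (burnsideTop R E) (Finsupp.single b 1) =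
          classMul R E T b.rep := by
        rw [burnsideTop, burnsideBilin_single, rep_top]
      rw [classMul, ← Finset.sum_filter_add_sum_filter_not _ (fun P => P.im = b.rep)] at h1
      have h2 : ∑ P ∈ (productReps E T b.rep).filter (fun P => P.im = b.rep),
          Finsupp.single (CentricClass.mk P.A P.centric) (1 : R) =
          (Nat.card (RepTop E b.rep) : R) • Finsupp.single b 1 := by
        rw [← hX.card_filter_im hS hE b.rep_centric, Nat.cast_smul_eq_nsmul, ← Finset.sum_const]
        refine Finset.sum_congr rfl fun P hP => ?_
        have h3 := P.isIso_im
        rw [(Finset.mem_filter.1 hP).2] at h3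
        rw [CentricClass.mk_eq_mk (hB := b.rep_centric) h3, CentricClass.mk_rep]
      obtain ⟨c, hc⟩ := hR.isUnit_natCast (card_repTop hS hE hstar b.rep_centric)
      rw [h2, ← hc] at h1
      have h4 : Finsupp.single b (1 : R) = (↑c⁻¹ : R) • (burnsideBilin R E (burnsideTop R E)
          (Finsupp.single b 1) - ∑ P ∈ (productReps E T b.rep).filter (fun P => ¬P.im = b.rep),
          Finsupp.single (CentricClass.mk P.A P.centric) (1 : R)) := by
        rw [h1, add_sub_cancel_right, smul_smul, Units.inv_mul, one_smul]
      rw [h4]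
      refine Submodule.smul_mem _ _ (Submodule.sub_mem _ ⟨_, rfl⟩ (Submodule.sum_mem _ fun P hP => ?_))
      refine ih _ ?_ _ rfl
      rw [(CentricClass.rep_mk P.centric).card_eq, P.isIso_im.card_eq]
      by_contra hcon
      exact (Finset.mem_filter.1 hP).2 (Subgroup.eq_of_le_of_card_ge P.im_le (not_lt.1 hcon))
  intro x _
  induction x using Finsupp.induction_linear with
  | zero => exact Submodule.zero_mem _
  | add x y hx hy => exact Submodule.add_mem _ (hx trivial) (hy trivial)
  | single a r =>
    have : Finsupp.single a r = r • Finsupp.single a (1 : R) := by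
      rw [Finsupp.smul_single, smul_eq_mul, mul_one]
    rw [this]
    exact Submodule.smul_mem _ _ (key _ a rfl)

/-- Surjectivity provides `e` with `T · e = T` and `u` with `T · u = e`. Every element is a multiple
of `T`, so `e` is an identity by associativity and commutativity; the existence of an identity is
part of what is proved. -/
theorem exists_isBurnsideInverse_top (hS : IsPGroup p S) (hE : E.Good) (hstar : E.Star p T)
    (hR : IsPLocalRing p R) : ∃ u, IsBurnsideInverse (burnsideTop R E) u := by
  have hsurj := burnsideBilin_top_surjective hS hE hstar hR
  obtain ⟨e, he⟩ := hsurj (burnsideTop R E)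
  obtain ⟨u, hu⟩ := hsurj e
  have h1 : ∀ x, burnsideBilin R E e x = x := by
    intro x
    obtain ⟨y, rfl⟩ := hsurj x
    rw [← burnsideBilin_assoc hS hE, burnsideBilin_comm hS hE e, he]
  refine ⟨u, e, fun x => ?_, ?_, ?_⟩
  · rw [burnsideMul_eq, burnsideMul_eq, burnsideBilin_comm hS hE x e]
    exact ⟨h1 x, h1 x⟩
  · rw [burnsideMul_eq, hu]
  · rw [burnsideMul_eq, burnsideBilin_comm hS hE, hu]

end Burnside

end FusionMackey

namespace FusionMackey

open FusionSystem

/-! ## Decomposition of bisets into orbits -/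

namespace FinBiset

variable {A B : Type u} [Group A] [Group B]

/-- An invariant subset of a biset. -/
def sub (X : FinBiset A B) (P : X.carrier → Prop)
    (h : ∀ (g : A × B) x, P x → P (g • x)) : FinBiset A B where
  carrier := {x : X.carrier // P x}
  action :=
    { smul := fun g x => ⟨g • x.1, h g x.1 x.2⟩
      one_smul := fun x => Subtype.ext (one_smul _ x.1)
      mul_smul := fun g g' x => Subtype.ext (mul_smul g g' x.1) }

theorem sum_sub_iso (X : FinBiset A B) (P : X.carrier → Prop)
    (h : ∀ (g : A × B) x, P x → P (g • x)) (h' : ∀ (g : A × B) x, ¬P x → ¬P (g • x)) :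
    ((X.sub P h).sum (X.sub (fun x => ¬P x) h')).Iso X := by
  classical
  exact ⟨Equiv.sumCompl P, by rintro g (x | x) <;> rfl⟩

theorem transitive_iso [Finite A] [Finite B] {C : Type u} [Group C] {α : C →* A} {β : C →* B}
    (X : FinBiset A B) (x : X.carrier) (hx : ∀ y, ∃ g : A × B, g • x = y)
    (hst : ∀ g : A × B, g • x = x ↔ g ∈ (α.prod β).range) : (transitive α β).Iso X := by
  have key : ∀ g g' : A × B, g • x = g' • x ↔ g⁻¹ * g' ∈ (α.prod β).range := fun g g' => by
    rw [← hst, mul_smul, inv_smul_eq_iff, eq_comm]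
  refine ⟨Equiv.ofBijective (Quotient.lift (fun g : A × B => g • x) fun g g' h => ?_) ⟨?_, ?_⟩, ?_⟩
  · exact (key g g').2 (QuotientGroup.leftRel_apply.1 h)
  · rintro ⟨g⟩ ⟨g'⟩ h
    exact QuotientGroup.eq.2 ((key g g').1 h)
  · intro y
    obtain ⟨g, hg⟩ := hx y
    exact ⟨QuotientGroup.mk g, hg⟩
  · rintro g ⟨g'⟩
    exact mul_smul g g' x

end FinBiset

namespace BisetClass

variable {A B D : Type u} [Group A] [Group B] [Group D] [Finite A] [Finite B] [Finite D]

/-- Split off the fibres of `f` one at a time; each is a single orbit with the prescribed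
stabilizer. -/
theorem mk_eq_sum_of_index {ι : Type*} (s : Finset ι) (X : FinBiset A B) (f : X.carrier → ι)
    (hf : ∀ (g : A × B) x, f (g • x) = f x) (hfs : ∀ x, f x ∈ s) (C : ι → Type u)
    [∀ i, Group (C i)] (α : ∀ i, C i →* A) (β : ∀ i, C i →* B)
    (h : ∀ i ∈ s, ∃ x, f x = i ∧ (∀ y, f y = i → ∃ g : A × B, g • x = y) ∧
      ∀ g : A × B, g • x = x ↔ g ∈ ((α i).prod (β i)).range) :
    mk X = ∑ i ∈ s, ofHoms (α i) (β i) := by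
  classical
  induction s using Finset.induction_on generalizing X with
  | empty =>
    have : IsEmpty X.carrier := ⟨fun x => absurd (hfs x) (Finset.notMem_empty _)⟩
    exact mk_eq ⟨Equiv.equivOfIsEmpty X.carrier PEmpty.{u + 1}, fun _ x => isEmptyElim x⟩
  | insert a s ha ih =>
    rw [Finset.sum_insert ha]
    have h1 : ∀ (g : A × B) x, f x = a → f (g • x) = a := fun g x hx => (hf g x).trans hx
    have h2 : ∀ (g : A × B) x, ¬f x = a → ¬f (g • x) = a := fun g x hx e => hx ((hf g x).symm.trans e)
    rw [← mk_eq (X.sum_sub_iso (fun x => f x = a) h1 h2)]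
    change mk (X.sub (fun x => f x = a) h1) + mk (X.sub (fun x => ¬f x = a) h2) = _
    refine congrArg₂ (fun x y : BisetClass A B => x + y) ?_ ?_
    · obtain ⟨x, hx, hy, hst⟩ := h a (Finset.mem_insert_self a s)
      refine (mk_eq ((X.sub _ h1).transitive_iso ⟨x, hx⟩ (fun y => ?_) fun g => ?_)).symm
      · obtain ⟨g, hg⟩ := hy y.1 y.2
        exact ⟨g, Subtype.ext hg⟩
      · rw [← hst]
        exact Subtype.ext_iff
    · refine ih (X.sub _ h2) (fun x => f x.1) (fun g x => hf g x.1)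
        (fun x => Finset.mem_of_mem_insert_of_ne (hfs x.1) x.2) fun i hi => ?_
      obtain ⟨x, hx, hy, hst⟩ := h i (Finset.mem_insert_of_mem hi)
      have hia : i ≠ a := fun e => ha (e ▸ hi)
      refine ⟨⟨x, fun e => hia (hx.symm.trans e)⟩, hx, fun y hyi => ?_, fun g => ?_⟩
      · obtain ⟨g, hg⟩ := hy y.1 hyi
        exact ⟨g, Subtype.ext hg⟩
      · rw [← hst]
        exact Subtype.ext_iff

theorem mk_eq_sum {ι : Type*} (s : Finset ι) (X : FinBiset A B) (x : ι → X.carrier) (C : ι → Type u)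
    [∀ i, Group (C i)] (α : ∀ i, C i →* A) (β : ∀ i, C i →* B)
    (hcov : ∀ y, ∃! i, i ∈ s ∧ ∃ g : A × B, g • x i = y)
    (hst : ∀ i ∈ s, ∀ g : A × B, g • x i = x i ↔ g ∈ ((α i).prod (β i)).range) :
    mk X = ∑ i ∈ s, ofHoms (α i) (β i) := by
  choose f hf hu using hcov
  dsimp only at hf hu
  refine mk_eq_sum_of_index s X f (fun g y => ?_) (fun y => (hf y).1) C α β fun i hi =>
    ⟨x i, ?_, fun y hy => ?_, hst i hi⟩
  · obtain ⟨h1, g', h2⟩ := hf y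
    exact (hu _ _ ⟨h1, g * g', by rw [mul_smul, h2]⟩).symm
  · exact (hu _ _ ⟨hi, 1, one_smul _ _⟩).symm
  · subst hy
    exact (hf y).2

/-- The composite of two transitive bisets. -/
theorem ofHoms_comp_ofHoms {C C' : Type u} [Group C] [Group C'] (α : C →* A) (β : C →* B)
    (γ : C' →* B) (δ : C' →* D) {ι : Type*} (s : Finset ι) (t : ι → B)
    (hs : ∀ b, ∃! i, i ∈ s ∧ ∃ e e', b = β e * t i * γ e') (X : ι → Type u) [∀ i, Group (X i)]
    (α' : ∀ i, X i →* A) (δ' : ∀ i, X i →* D)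
    (h : ∀ i ∈ s, ∀ a d, (∃ x, α' i x = a ∧ δ' i x = d) ↔
      ∃ e e', α e = a ∧ δ e' = d ∧ β e = t i * γ e' * (t i)⁻¹) :
    (ofHoms α β).comp (ofHoms γ δ) = ∑ i ∈ s, ofHoms (α' i) (δ' i) := by
  let Y := FinBiset.transitive α β
  let Z := FinBiset.transitive γ δ
  -- These points meet every orbit. Those of `b` and `b'` share an orbit exactly when `b` and `b'`
  -- share a double coset of the images of `β` and `γ`, and `hpt` with `b = b'` describes the
  -- stabilizers.
  let pt : B → (Y.comp Z).carrier := fun b => Quotient.mk (FinBiset.compSetoid Y Z)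
    ((QuotientGroup.mk 1 : Y.carrier), (QuotientGroup.mk (b, 1) : Z.carrier))
  have hpt : ∀ (a : A) (d : D) (b b' : B), ((a, d) : A × D) • pt b = pt b' ↔
      ∃ e e', a = α e ∧ d = δ e' ∧ b' * γ e' = β e * b := by
    intro a d b b'
    constructor
    · intro hab
      obtain ⟨c, hc⟩ := Quotient.exact (s := FinBiset.compSetoid Y Z) hab
      obtain ⟨h1, h2⟩ := Prod.mk.inj hc
      obtain ⟨e, he⟩ := QuotientGroup.eq.1 h1
      obtain ⟨e', he'⟩ := QuotientGroup.eq.1 h2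
      obtain ⟨he1, he2⟩ := Prod.mk.inj he
      obtain ⟨he1', he2'⟩ := Prod.mk.inj he'
      have he1 : α e = a := by simpa using he1
      have he2 : β e = c := by simpa using he2
      have he1' : γ e' = b'⁻¹ * (c * b) := by simpa using he1'
      have he2' : δ e' = d := by simpa using he2'
      exact ⟨e, e', he1.symm, he2'.symm, by rw [he1', he2, mul_inv_cancel_left]⟩
    · rintro ⟨e, e', rfl, rfl, hb⟩
      refine Quotient.sound (s := FinBiset.compSetoid Y Z) ⟨β e, Prod.ext ?_ ?_⟩
      · refine QuotientGroup.eq.2 ⟨e, ?_⟩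
        simp
      · refine QuotientGroup.eq.2 ⟨e', ?_⟩
        simp [← hb]
  have hall : ∀ y : (Y.comp Z).carrier, ∃ a d b, y = ((a, d) : A × D) • pt b := by
    rintro ⟨⟨a, b⟩, ⟨b', d⟩⟩
    refine ⟨a, d, b⁻¹ * b', Eq.symm (Quotient.sound (s := FinBiset.compSetoid Y Z)
      ⟨b, Prod.ext ?_ ?_⟩)⟩
    · refine QuotientGroup.eq.2 ⟨1, ?_⟩
      simp
    · refine QuotientGroup.eq.2 ⟨1, ?_⟩
      simp
  change mk (Y.comp Z) = _
  refine mk_eq_sum s (Y.comp Z) (fun i => pt (t i)) X α' δ' (fun y => ?_) fun i hi g => ?_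
  · obtain ⟨a, d, b, rfl⟩ := hall y
    have key : ∀ i, (∃ g : A × D, g • pt (t i) = ((a, d) : A × D) • pt b) ↔
        ∃ e e', b = β e * t i * γ e' := by
      intro i
      constructor
      · rintro ⟨g, hg⟩
        rw [← inv_smul_eq_iff, ← mul_smul] at hg
        obtain ⟨e, e', -, -, h2⟩ := (hpt _ _ _ _).1 hg
        exact ⟨e, e'⁻¹, by rw [← h2, map_inv, mul_inv_cancel_right]⟩
      · rintro ⟨e, e', h2⟩
        refine ⟨(a, d) * (α e, δ e'⁻¹), ?_⟩
        rw [mul_smul]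
        congr 1
        exact (hpt _ _ _ _).2 ⟨e, e'⁻¹, rfl, rfl, by rw [h2, map_inv, mul_inv_cancel_right]⟩
    obtain ⟨i, ⟨hi, hib⟩, hu⟩ := hs b
    exact ⟨i, ⟨hi, (key i).2 hib⟩, fun j hj => hu j ⟨hj.1, (key j).1 hj.2⟩⟩
  · obtain ⟨a, d⟩ := g
    rw [hpt, MonoidHom.mem_range]
    have h1 := h i hi a d
    constructor
    · rintro ⟨e, e', rfl, rfl, h2⟩
      obtain ⟨x, hx, hx'⟩ := h1.2 ⟨e, e', rfl, rfl, by rw [h2, mul_inv_cancel_right]⟩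
      exact ⟨x, Prod.ext hx hx'⟩
    · rintro ⟨x, hx⟩
      obtain ⟨hx1, hx2⟩ := Prod.mk.inj hx
      obtain ⟨e, e', rfl, rfl, h2⟩ := h1.1 ⟨x, hx1, hx2⟩
      exact ⟨e, e', rfl, rfl, by rw [h2, inv_mul_cancel_right]⟩

/-- Transitive bisets with conjugate stabilizers are isomorphic. -/
theorem ofHoms_eq_of_conj {C C' : Type u} [Group C] [Group C'] {α : C →* A} {β : C →* B}
    {α' : C' →* A} {β' : C' →* B} (a : A) (b : B) (e : C' → C) (he : Function.Surjective e)
    (hα : ∀ c, α' c = a * α (e c) * a⁻¹) (hβ : ∀ c, β' c = b * β (e c) * b⁻¹) :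
    ofHoms α β = ofHoms α' β' := by
  let X := FinBiset.transitive α β
  refine (mk_eq (X.transitive_iso (QuotientGroup.mk (a, b) : X.carrier) (fun y => ?_)
    fun g => ?_)).symm
  · obtain ⟨g, rfl⟩ := QuotientGroup.mk_surjective y
    refine ⟨g * (a, b)⁻¹, ?_⟩
    change (QuotientGroup.mk (g * (a, b)⁻¹ * (a, b)) : X.carrier) = _
    rw [inv_mul_cancel_right]
  · change (QuotientGroup.mk (g * (a, b)) : X.carrier) = QuotientGroup.mk (a, b) ↔ _
    rw [eq_comm, QuotientGroup.eq, MonoidHom.mem_range, MonoidHom.mem_range]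
    constructor
    · rintro ⟨c, hc⟩
      obtain ⟨c', rfl⟩ := he c
      refine ⟨c', ?_⟩
      have : g = (a, b) * (α.prod β) (e c') * (a, b)⁻¹ := by rw [hc]; group
      rw [this]
      exact Prod.ext (hα c') (hβ c')
    · rintro ⟨c', rfl⟩
      refine ⟨e c', ?_⟩
      refine Prod.ext ?_ ?_
      · simp [hα, mul_assoc]
      · simp [hβ, mul_assoc]

end BisetClass

end FusionMackey

namespace FusionMackey

open FusionSystem BisetSemiring

variable {S : Type u} [Group S] {T : Subgroup S}

/-! ## Transitive bisets given by functions on `S` -/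

/-- `α` restricts to a homomorphism `C → A`. -/
def Hm (α : S → S) (C A : Subgroup S) : Prop := ∃ φ : C →* A, ∀ c : C, (φ c : S) = α c

open Classical in
/-- The homomorphism given by a function. -/
noncomputable def toHom (α : S → S) (C A : Subgroup S) : C →* A :=
  if h : Hm α C A then h.choose else 1

section Hm

variable {α β : S → S} {A B C D : Subgroup S}

theorem Hm.toHom_apply (h : Hm α C A) (c : C) : (toHom α C A c : S) = α c := by
  rw [toHom, dif_pos h]
  exact h.choose_spec c

theorem Hm.mem (h : Hm α C A) {c : S} (hc : c ∈ C) : α c ∈ A := by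
  rw [← h.toHom_apply ⟨c, hc⟩]
  exact (toHom α C A _).2

theorem Hm.map_mul (h : Hm α C A) {x y : S} (hx : x ∈ C) (hy : y ∈ C) :
    α (x * y) = α x * α y := by
  obtain ⟨φ, e⟩ := h
  have := congrArg Subtype.val (φ.map_mul ⟨x, hx⟩ ⟨y, hy⟩)
  rwa [Subgroup.coe_mul, e, e, e] at this

theorem Hm.map_one (h : Hm α C A) : α 1 = 1 := by
  have := h.map_mul (one_mem C) (one_mem C)
  rwa [mul_one, left_eq_mul] at this

theorem Hm.map_inv (h : Hm α C A) {x : S} (hx : x ∈ C) : α x⁻¹ = (α x)⁻¹ := by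
  rw [eq_inv_iff_mul_eq_one, ← h.map_mul (inv_mem hx) hx, inv_mul_cancel, h.map_one]

theorem Hm.comp (h : Hm α C A) (h' : Hm β A B) : Hm (β ∘ α) C B := by
  obtain ⟨φ, h⟩ := h
  obtain ⟨ψ, h'⟩ := h'
  exact ⟨ψ.comp φ, fun c => by rw [MonoidHom.comp_apply, h', h]; rfl⟩

theorem hm_id (h : C ≤ A) : Hm id C A := ⟨Subgroup.inclusion h, fun _ => rfl⟩

theorem hm_cj (t : S) (h : ∀ c ∈ C, cj t c ∈ A) : Hm (cj t) C A :=
  ⟨((MulAut.conj t).toMonoidHom.comp C.subtype).codRestrict A fun a => h a a.2, fun _ => rfl⟩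

theorem Hm.restrict (h : Hm α C A) (hD : D ≤ C) : Hm α D A := (hm_id hD).comp h

theorem Hm.cod (h : Hm α C A) (hB : ∀ c ∈ C, α c ∈ B) : Hm α C B := by
  obtain ⟨φ, h⟩ := h
  exact ⟨(A.subtype.comp φ).codRestrict B fun c => by
    change (φ c : S) ∈ B
    rw [h]
    exact hB c c.2, h⟩

theorem FusionSystem.Mor.hm {E : FusionSystem T} (h : E.Mor α C A) : Hm α C A := by
  obtain ⟨φ, -, e⟩ := h
  exact ⟨φ, e⟩

end Hm

/-- The subgroup of the `c ∈ C` with `β c ∈ J`. -/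
def pb (β : S → S) (C J : Subgroup S) : Subgroup S := Subgroup.closure {c | c ∈ C ∧ β c ∈ J}

theorem Hm.mem_pb {β : S → S} {C K J : Subgroup S} (h : Hm β C K) {c : S} :
    c ∈ pb β C J ↔ c ∈ C ∧ β c ∈ J := by
  constructor
  · intro hc
    refine Subgroup.closure_induction (p := fun c _ => c ∈ C ∧ β c ∈ J) (fun _ h => h)
      ⟨one_mem _, by rw [h.map_one]; exact one_mem _⟩ ?_ ?_ hc
    · rintro x y _ _ ⟨hx, hx'⟩ ⟨hy, hy'⟩
      exact ⟨mul_mem hx hy, by rw [h.map_mul hx hy]; exact mul_mem hx' hy'⟩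
    · rintro x _ ⟨hx, hx'⟩
      exact ⟨inv_mem hx, by rw [h.map_inv hx]; exact inv_mem hx'⟩
  · exact fun hc => Subgroup.subset_closure hc

variable [Finite S]

/-- The transitive `(A, B)`-biset `(A × B) / {(α c, β c)}`. -/
noncomputable def sp (A B C : Subgroup S) (α β : S → S) : BisetSemiring S :=
  single A B (BisetClass.ofHoms (toHom α C A) (toHom β C B))

theorem single_mul_single (A B D : Subgroup S) (x : BisetClass A B) (y : BisetClass B D) :
    single A B x * single B D y = single A D (x.comp y) := by
  classical
  funext A' D'
  rw [mul_apply, Finset.sum_eq_single B]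
  · by_cases h : A' = A ∧ D' = D
    · obtain ⟨rfl, rfl⟩ := h
      rw [single_same, single_same, single_same]
    · rw [single_of_ne _ h]
      by_cases hA : A' = A
      · rw [single_of_ne (A := B) y fun h' => h ⟨hA, h'.2⟩, BisetClass.comp_zero]
      · rw [single_of_ne x fun h' => hA h'.1, BisetClass.zero_comp]
  · intro B' _ hB'
    rw [single_of_ne x fun h' => hB' h'.2, BisetClass.zero_comp]
  · exact fun h => absurd (Finset.mem_univ _) h

theorem single_mul_single_of_ne {A B B' D : Subgroup S} (h : B ≠ B') (x : BisetClass A B)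
    (y : BisetClass B' D) : single A B x * single B' D y = 0 := by
  classical
  funext A' D'
  rw [mul_apply, BisetSemiring.zero_apply]
  refine Finset.sum_eq_zero fun B'' _ => ?_
  by_cases hB : B'' = B
  · rw [single_of_ne y fun h' => h (hB.symm.trans h'.1), BisetClass.comp_zero]
  · rw [single_of_ne x fun h' => hB h'.2, BisetClass.zero_comp]

theorem single_zero (A B : Subgroup S) : single A B (0 : BisetClass A B) = 0 := by
  funext A' B'
  by_cases h : A' = A ∧ B' = B
  · obtain ⟨rfl, rfl⟩ := h
    exact single_same _ _ _
  · exact single_of_ne _ h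

theorem single_add (A B : Subgroup S) (x y : BisetClass A B) :
    single A B (x + y) = single A B x + single A B y := by
  funext A' B'
  rw [BisetSemiring.add_apply]
  by_cases h : A' = A ∧ B' = B
  · obtain ⟨rfl, rfl⟩ := h
    rw [single_same, single_same, single_same]
  · rw [single_of_ne _ h, single_of_ne _ h, single_of_ne _ h, add_zero]

theorem single_sum (A B : Subgroup S) {ι : Type*} (s : Finset ι) (x : ι → BisetClass A B) :
    single A B (∑ i ∈ s, x i) = ∑ i ∈ s, single A B (x i) :=
  map_sum ({ toFun := single A B, map_zero' := single_zero A B, map_add' := single_add A B } :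
    BisetClass A B →+ BisetSemiring S) x s

section Sp

variable {A B C C' D X : Subgroup S} {α β γ δ α' β' : S → S}

theorem sp_eq (hα : Hm α C A) (hβ : Hm β C B) (hα' : Hm α' C' A) (hβ' : Hm β' C' B) {e : S → S}
    (he : ∀ c ∈ C', e c ∈ C) (he' : ∀ c ∈ C, ∃ c' ∈ C', e c' = c) {a b : S} (ha : a ∈ A)
    (hb : b ∈ B) (h1 : ∀ c ∈ C', α' c = cj a (α (e c))) (h2 : ∀ c ∈ C', β' c = cj b (β (e c))) :
    sp A B C α β = sp A B C' α' β' := by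
  have key : BisetClass.ofHoms (toHom α C A) (toHom β C B) =
      BisetClass.ofHoms (toHom α' C' A) (toHom β' C' B) := by
    refine BisetClass.ofHoms_eq_of_conj (⟨a, ha⟩ : A) (⟨b, hb⟩ : B)
      (fun c : C' => (⟨e c, he c c.2⟩ : C)) (fun c => ?_) (fun c => Subtype.ext ?_)
      fun c => Subtype.ext ?_
    · obtain ⟨c', hc', h⟩ := he' c c.2
      exact ⟨⟨c', hc'⟩, Subtype.ext h⟩
    · rw [hα'.toHom_apply, h1 c c.2]
      simp [hα.toHom_apply, cj]
    · rw [hβ'.toHom_apply, h2 c c.2]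
      simp [hβ.toHom_apply, cj]
  rw [sp, sp, key]

/-- The double coset formula for the composite of two transitive bisets. -/
theorem sp_mul_sp (hα : Hm α C A) (hβ : Hm β C B) (hγ : Hm γ C' B) (hδ : Hm δ C' D) (s : Finset S)
    (t : S → S) (ht : ∀ i ∈ s, t i ∈ B)
    (hs : ∀ b ∈ B, ∃! i, i ∈ s ∧ ∃ c ∈ C, ∃ c' ∈ C', b = β c * t i * γ c') (X : S → Subgroup S)
    (α' δ' : S → S → S) (hα' : ∀ i ∈ s, Hm (α' i) (X i) A) (hδ' : ∀ i ∈ s, Hm (δ' i) (X i) D)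
    (h : ∀ i ∈ s, ∀ a d, (∃ x ∈ X i, α' i x = a ∧ δ' i x = d) ↔
      ∃ c ∈ C, ∃ c' ∈ C', α c = a ∧ δ c' = d ∧ β c = cj (t i) (γ c')) :
    sp A B C α β * sp B D C' γ δ = ∑ i ∈ s, sp A D (X i) (α' i) (δ' i) := by
  classical
  rw [sp, sp, single_mul_single, BisetClass.ofHoms_comp_ofHoms (toHom α C A) (toHom β C B)
    (toHom γ C' B) (toHom δ C' D) s.attach (fun i => ⟨t i.1, ht i.1 i.2⟩) (fun b => ?_)
    (fun i => X i.1) (fun i => toHom (α' i.1) (X i.1) A) (fun i => toHom (δ' i.1) (X i.1) D)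
    (fun i _ a d => ?_), single_sum, Finset.sum_attach s fun i => single A D
      (BisetClass.ofHoms (toHom (α' i) (X i) A) (toHom (δ' i) (X i) D))]
  · rfl
  · have key : ∀ i : s, (∃ e e', b = toHom β C B e * (⟨t i.1, ht i.1 i.2⟩ : B) * toHom γ C' B e') ↔
        ∃ c ∈ C, ∃ c' ∈ C', (b : S) = β c * t i.1 * γ c' := by
      intro i
      constructor
      · rintro ⟨e, e', h⟩
        refine ⟨e, e.2, e', e'.2, ?_⟩
        rw [h]
        simp [hβ.toHom_apply, hγ.toHom_apply]
      · rintro ⟨c, hc, c', hc', h⟩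
        refine ⟨⟨c, hc⟩, ⟨c', hc'⟩, Subtype.ext ?_⟩
        rw [h]
        simp [hβ.toHom_apply, hγ.toHom_apply]
    obtain ⟨i, ⟨hi, h1⟩, hu⟩ := hs b b.2
    exact ⟨⟨i, hi⟩, ⟨Finset.mem_attach _ _, (key _).2 h1⟩, fun j hj =>
      Subtype.ext (hu j ⟨j.2, (key j).1 hj.2⟩)⟩
  · have h1 := h i i.2 a d
    constructor
    · rintro ⟨x, rfl, rfl⟩
      obtain ⟨c, hc, c', hc', e1, e2, e3⟩ := h1.1 ⟨x, x.2, by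
        rw [(hα' i i.2).toHom_apply], by rw [(hδ' i i.2).toHom_apply]⟩
      refine ⟨⟨c, hc⟩, ⟨c', hc'⟩, Subtype.ext ?_, Subtype.ext ?_, Subtype.ext ?_⟩
      · rw [hα.toHom_apply, e1]
      · rw [hδ.toHom_apply, e2]
      · rw [hβ.toHom_apply, e3]
        simp [hγ.toHom_apply, cj]
    · rintro ⟨e, e', rfl, rfl, h2⟩
      have h3 := congrArg Subtype.val h2
      rw [hβ.toHom_apply] at h3
      simp only [Subgroup.coe_mul, Subgroup.coe_inv, hγ.toHom_apply] at h3
      obtain ⟨x, hx, e1, e2⟩ := h1.2 ⟨e, e.2, e', e'.2, by rw [hα.toHom_apply],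
        by rw [hδ.toHom_apply], h3⟩
      refine ⟨⟨x, hx⟩, Subtype.ext ?_, Subtype.ext ?_⟩
      · rw [(hα' i i.2).toHom_apply, e1]
      · rw [(hδ' i i.2).toHom_apply, e2]

/-- The right leg of the first factor is the identity of `B`, so there is a single double coset,
represented by `1`. -/
theorem sp_mul_of_right_id (hα : Hm α B A) (hγ : Hm γ C B) (hδ : Hm δ C D) :
    sp A B B α id * sp B D C γ δ = sp A D C (α ∘ γ) δ := by
  rw [sp_mul_sp hα (hm_id le_rfl) hγ hδ {1} id (by simp) (fun b hb => ⟨1, ⟨by simp, b, hb, 1,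
    one_mem _, by simp [hγ.map_one]⟩, fun i hi => by simpa using hi.1⟩) (fun _ => C)
    (fun _ => α ∘ γ) (fun _ => δ) (fun _ _ => hγ.comp hα) (fun _ _ => hδ), Finset.sum_singleton]
  intro i hi a d
  obtain rfl : i = 1 := by simpa using hi
  constructor
  · rintro ⟨x, hx, rfl, rfl⟩
    exact ⟨γ x, hγ.mem hx, x, hx, rfl, rfl, (cj_one _).symm⟩
  · rintro ⟨c, hc, c', hc', rfl, rfl, h⟩
    simp only [id, cj_one] at h
    exact ⟨c', hc', by rw [h]; rfl, rfl⟩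

theorem sp_mul_of_left_id (hα : Hm α C A) (hβ : Hm β C B) (hδ : Hm δ B D) :
    sp A B C α β * sp B D B id δ = sp A D C α (δ ∘ β) := by
  rw [sp_mul_sp hα hβ (hm_id le_rfl) hδ {1} id (by simp) (fun b hb => ⟨1, ⟨by simp, 1, one_mem _,
    b, hb, by simp [hβ.map_one]⟩, fun i hi => by simpa using hi.1⟩) (fun _ => C)
    (fun _ => α) (fun _ => δ ∘ β) (fun _ _ => hα) (fun _ _ => hβ.comp hδ), Finset.sum_singleton]
  intro i hi a d
  obtain rfl : i = 1 := by simpa using hi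
  constructor
  · rintro ⟨x, hx, rfl, rfl⟩
    exact ⟨x, hx, β x, hβ.mem hx, rfl, rfl, (cj_one _).symm⟩
  · rintro ⟨c, hc, c', hc', rfl, rfl, h⟩
    simp only [id, cj_one] at h
    exact ⟨c, hc, rfl, by rw [← h]; rfl⟩

/-! ### Double coset formulas for restriction and induction. -/

/-- `s` is a set of representatives of the double cosets `J \ K / β(C)`. -/
def IsDoubleReps (J K C : Subgroup S) (β : S → S) (s : Finset S) : Prop :=
  (∀ t ∈ s, t ∈ K) ∧ ∀ b ∈ K, ∃! t, t ∈ s ∧ ∃ j ∈ J, ∃ c ∈ C, b = j * t * β c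

theorem exists_isDoubleReps {J K : Subgroup S} (hβ : Hm β C K) :
    ∃ s, IsDoubleReps J K C β s := by
  classical
  let r : Setoid K :=
    { r := fun x y => ∃ j ∈ J, ∃ c ∈ C, (y : S) = j * x * β c
      iseqv :=
        { refl := fun x => ⟨1, one_mem _, 1, one_mem _, by simp [hβ.map_one]⟩
          symm := by
            rintro x y ⟨j, hj, c, hc, h⟩
            refine ⟨j⁻¹, inv_mem hj, c⁻¹, inv_mem hc, ?_⟩
            rw [h, hβ.map_inv hc]
            group
          trans := by
            rintro x y z ⟨j, hj, c, hc, h⟩ ⟨j', hj', c', hc', h'⟩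
            refine ⟨j' * j, mul_mem hj' hj, c * c', mul_mem hc hc', ?_⟩
            rw [h', h, hβ.map_mul hc hc']
            group } }
  have : Fintype (Quotient r) := Fintype.ofFinite _
  refine ⟨Finset.univ.image fun q : Quotient r => (q.out : S), ?_, fun b hb => ?_⟩
  · intro t ht
    obtain ⟨q, -, rfl⟩ := Finset.mem_image.1 ht
    exact q.out.2
  · refine ⟨(Quotient.mk r ⟨b, hb⟩).out, ⟨Finset.mem_image.2 ⟨_, Finset.mem_univ _, rfl⟩,
      Quotient.mk_out (s := r) ⟨b, hb⟩⟩, ?_⟩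
    rintro t ⟨ht, h⟩
    obtain ⟨q, -, rfl⟩ := Finset.mem_image.1 ht
    have : q = Quotient.mk r ⟨b, hb⟩ := by
      rw [← Quotient.out_eq q]
      exact Quotient.sound (s := r) h
    rw [this]

/-- The first factor has apex `J` itself, so the stabilizer belonging to `t` is parametrized by the
preimage of `J` under `c_t ∘ β`. -/
theorem res_mul_sp {J K : Subgroup S} (hJ : J ≤ K) (hβ : Hm β C K) (hα : Hm α C X) {s : Finset S}
    (hs : IsDoubleReps J K C β s) : sp J K J id id * sp K X C β α =
      ∑ t ∈ s, sp J X (pb (cj t ∘ β) C J) (cj t ∘ β) α := by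
  have hc : ∀ t ∈ s, Hm (cj t ∘ β) C K := fun t ht =>
    hβ.comp (hm_cj t fun c hc => cj_mem (hs.1 t ht) hc)
  have hle : ∀ t ∈ s, pb (cj t ∘ β) C J ≤ C := fun t ht x hx => ((hc t ht).mem_pb.1 hx).1
  refine sp_mul_sp (hm_id le_rfl) (hm_id hJ) hβ hα s id hs.1 hs.2 _ (fun t => cj t ∘ β)
    (fun _ => α) (fun t ht => ((hc t ht).restrict (hle t ht)).cod fun x hx =>
      ((hc t ht).mem_pb.1 hx).2) (fun t ht => hα.restrict (hle t ht)) fun t ht a d => ?_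
  constructor
  · rintro ⟨x, hx, rfl, rfl⟩
    obtain ⟨h1, h2⟩ := (hc t ht).mem_pb.1 hx
    exact ⟨_, h2, x, h1, rfl, rfl, rfl⟩
  · rintro ⟨c, hcJ, c', hc', rfl, rfl, h⟩
    refine ⟨c', (hc t ht).mem_pb.2 ⟨hc', ?_⟩, h.symm, rfl⟩
    rw [Function.comp_apply, ← id_def t, ← h]
    exact hcJ

theorem sp_mul_ind {J K : Subgroup S} (hJ : J ≤ K) (hβ : Hm β C K) (hα : Hm α C X) {s : Finset S}
    (hs : IsDoubleReps J K C β s) : sp X K C α β * sp K J J id id =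
      ∑ t ∈ s, sp X J (pb (cj t ∘ β) C J) α (cj t ∘ β) := by
  have hc : ∀ t ∈ s, Hm (cj t ∘ β) C K := fun t ht =>
    hβ.comp (hm_cj t fun c hc => cj_mem (hs.1 t ht) hc)
  have hle : ∀ t ∈ s, pb (cj t ∘ β) C J ≤ C := fun t ht x hx => ((hc t ht).mem_pb.1 hx).1
  -- The composite calls for double cosets `β(C) \ K / J`, while `s` represents `J \ K / β(C)`;
  -- inversion exchanges them.
  refine sp_mul_sp hα hβ (hm_id hJ) (hm_id le_rfl) s (fun t => t⁻¹) (fun t ht => inv_mem (hs.1 t ht))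
    (fun b hb => ?_) _ (fun _ => α) (fun t => cj t ∘ β) (fun t ht => hα.restrict (hle t ht))
    (fun t ht => ((hc t ht).restrict (hle t ht)).cod fun x hx =>
      ((hc t ht).mem_pb.1 hx).2) fun t ht a d => ?_
  · obtain ⟨t, ⟨ht, j, hj, c, hc, h⟩, hu⟩ := hs.2 b⁻¹ (inv_mem hb)
    refine ⟨t, ⟨ht, c⁻¹, inv_mem hc, j⁻¹, inv_mem hj, ?_⟩, ?_⟩
    · rw [← inv_inv b, h, hβ.map_inv hc, id]
      group
    · rintro t' ⟨ht', c', hc', j', hj', h'⟩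
      refine hu t' ⟨ht', j'⁻¹, inv_mem hj', c'⁻¹, inv_mem hc', ?_⟩
      rw [h', hβ.map_inv hc', id]
      group
  · constructor
    · rintro ⟨x, hx, rfl, rfl⟩
      obtain ⟨h1, h2⟩ := (hc t ht).mem_pb.1 hx
      exact ⟨x, h1, _, h2, rfl, rfl, (cj_inv_cj t (β x)).symm⟩
    · rintro ⟨c, hcC, c', hc', rfl, rfl, h⟩
      have h' : (cj t ∘ β) c = c' := by
        rw [Function.comp_apply, h, id, cj_cj_inv]
      exact ⟨c, (hc t ht).mem_pb.2 ⟨hcC, by rw [h']; exact hc'⟩, rfl, h'⟩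

end Sp

/-! ## The generators of the Mackey semiring -/

theorem ind_eq_sp {H K : Subgroup S} (h : H ≤ K) : ind h = sp K H H id id := by
  have h1 : toHom id H K = Subgroup.inclusion h :=
    MonoidHom.ext fun x => Subtype.ext ((hm_id h).toHom_apply x)
  have h2 : toHom id H H = MonoidHom.id H :=
    MonoidHom.ext fun x => Subtype.ext ((hm_id le_rfl).toHom_apply x)
  rw [ind, sp, h1, h2]

theorem res_eq_sp {H K : Subgroup S} (h : H ≤ K) : res h = sp H K H id id := by
  have h1 : toHom id H K = Subgroup.inclusion h :=
    MonoidHom.ext fun x => Subtype.ext ((hm_id h).toHom_apply x)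
  have h2 : toHom id H H = MonoidHom.id H :=
    MonoidHom.ext fun x => Subtype.ext ((hm_id le_rfl).toHom_apply x)
  rw [res, sp, h1, h2]

theorem conj_eq_sp {H K : Subgroup S} (φ : H ≃* K) {α : S → S} (hα : ∀ h : H, (φ h : S) = α h) :
    conj φ = sp K H H α id := by
  have h1 : toHom α H K = φ.toMonoidHom := MonoidHom.ext fun x => Subtype.ext
    ((Hm.toHom_apply ⟨φ.toMonoidHom, hα⟩ x).trans (hα x).symm)
  have h2 : toHom id H H = MonoidHom.id H :=
    MonoidHom.ext fun x => Subtype.ext ((hm_id le_rfl).toHom_apply x)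
  rw [conj, sp, h1, h2]

/-- The biset factors as a restriction, the inverse of the conjugation by `β`, the conjugation by
`α` and an induction, all of them generators. -/
theorem sp_mem_mackeySemiring {E : FusionSystem T} {A B C : Subgroup S} {α β : S → S}
    (hα : E.Mor α C A) (hβ : E.Mor β C B) : sp A B C α β ∈ mackeySemiring E := by
  obtain ⟨e, he, -, h⟩ := hα.exists_equiv
  obtain ⟨e', -, he', h'⟩ := hβ.exists_equiv
  have h1 : ind hα.img_le ∈ mackeySemiring E :=
    NonUnitalSubsemiring.subset_closure (Or.inl ⟨_, _, hα.img_le, hα.le_right, Or.inl rfl⟩)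
  have h2 : res hβ.img_le ∈ mackeySemiring E :=
    NonUnitalSubsemiring.subset_closure (Or.inl ⟨_, _, hβ.img_le, hβ.le_right, Or.inr rfl⟩)
  have h3 : conj e ∈ mackeySemiring E :=
    NonUnitalSubsemiring.subset_closure (Or.inr ⟨_, _, e, he, rfl⟩)
  have h4 : conj e'.symm ∈ mackeySemiring E :=
    NonUnitalSubsemiring.subset_closure (Or.inr ⟨_, _, e'.symm, he', rfl⟩)
  have h5 : ind hα.img_le * conj e * (conj e'.symm * res hβ.img_le) = sp A B C α β := by
    rw [ind_eq_sp, res_eq_sp, conj_eq_sp e h, conj_eq_sp (α := finv β C) e'.symm,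
      sp_mul_of_right_id (hm_id hα.img_le) hα.onto.hm (hm_id le_rfl),
      sp_mul_of_right_id hβ.finv.hm (hm_id le_rfl) (hm_id hβ.img_le)]
    · have h6 : sp C B (img β C) (finv β C ∘ id) id = sp C B C id β :=
        sp_eq hβ.finv.hm (hm_id hβ.img_le) (hm_id le_rfl) hβ.hm (e := β)
          (fun c hc => mem_img_of_mem hc) (fun c hc => hβ.mem_img.1 hc) (one_mem _) (one_mem _)
          (fun c hc => by rw [cj_one, Function.comp_apply, id, id, hβ.finv_apply hc]) fun c hc => by rw [cj_one]; rfl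
      rw [h6, Function.id_comp, sp_mul_of_left_id hα.hm (hm_id le_rfl) hβ.hm,
        Function.comp_id]
    · intro b
      have : (b : S) = β (e'.symm b) := by rw [← h', e'.apply_symm_apply]
      rw [this, hβ.finv_apply (e'.symm b).2]
  rw [← h5]
  exact mul_mem (mul_mem h1 h3) (mul_mem h4 h2)

theorem mackeySemiring_mono {T' : Subgroup S} {E : FusionSystem T} {F : FusionSystem T'}
    (h : E.Sub F) : mackeySemiring E ≤ mackeySemiring F := by
  refine NonUnitalSubsemiring.closure_le.2 ?_
  rintro x (⟨H, K, hHK, hK, rfl | rfl⟩ | ⟨H, K, φ, hφ, rfl⟩)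
  · rw [ind_eq_sp]
    exact sp_mem_mackeySemiring (h _ _ _ (E.mor_id hHK hK))
      (h _ _ _ (E.mor_id le_rfl (hHK.trans hK)))
  · rw [res_eq_sp]
    exact sp_mem_mackeySemiring (h _ _ _ (E.mor_id le_rfl (hHK.trans hK)))
      (h _ _ _ (E.mor_id hHK hK))
  · classical
    have hm : E.Mor (fun x => if hx : x ∈ H then (φ ⟨x, hx⟩ : S) else 1) H K :=
      ⟨_, hφ, fun a => by simp⟩
    rw [conj_eq_sp φ (α := fun x => if hx : x ∈ H then (φ ⟨x, hx⟩ : S) else 1) fun a => by simp]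
    exact sp_mem_mackeySemiring (h _ _ _ hm) (h _ _ _ (E.mor_id le_rfl hm.le_left))

end FusionMackey

namespace FusionMackey

open FusionSystem BisetSemiring

variable {S : Type u} [Group S] [Finite S] {T T' : Subgroup S}

/-! ## The action of the Mackey semiring -/

theorem idUpTo_eq (T : Subgroup S) : open Classical in
    idUpTo T = ∑ L ∈ Finset.univ.filter (· ≤ T), sp L L L id id := by
  classical
  refine (Finset.sum_congr rfl fun L _ => ?_).trans rfl
  rw [← ind_refl, ind_eq_sp]

theorem idUpTo_mul_sp {A B C : Subgroup S} {α β : S → S} (hα : Hm α C A) (hβ : Hm β C B)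
    (hA : A ≤ T) : idUpTo T * sp A B C α β = sp A B C α β := by
  classical
  rw [idUpTo_eq, Finset.sum_mul, Finset.sum_eq_single A]
  · rw [sp_mul_of_right_id (hm_id le_rfl) hα hβ, Function.id_comp]
  · intro L _ hL
    rw [sp, sp, single_mul_single_of_ne hL]
  · intro h
    exact absurd (Finset.mem_filter.2 ⟨Finset.mem_univ A, hA⟩) h

theorem sp_mul_idUpTo {A B C : Subgroup S} {α β : S → S} (hα : Hm α C A) (hβ : Hm β C B)
    (hB : B ≤ T) : sp A B C α β * idUpTo T = sp A B C α β := by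
  classical
  rw [idUpTo_eq, Finset.mul_sum, Finset.sum_eq_single B]
  · rw [sp_mul_of_left_id hα hβ (hm_id le_rfl), Function.id_comp]
  · intro L _ hL
    rw [sp, sp, single_mul_single_of_ne hL.symm]
  · intro h
    exact absurd (Finset.mem_filter.2 ⟨Finset.mem_univ B, hB⟩) h

open Classical in
/-- A function that extends a homomorphism. -/
noncomputable def ofHom {A B : Subgroup S} (φ : A →* B) : S → S :=
  fun x => if hx : x ∈ A then (φ ⟨x, hx⟩ : S) else 1

theorem ofHom_apply {A B : Subgroup S} (φ : A →* B) (a : A) : ofHom φ a = φ a := by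
  simp [ofHom]

theorem FusionSystem.mor_ofHom {E : FusionSystem T} {A B : Subgroup S} {φ : A →* B}
    (h : φ ∈ E.Hom A B) : E.Mor (ofHom φ) A B := ⟨φ, h, fun a => (ofHom_apply φ a).symm⟩

/-- Induction on the generators of the Mackey semiring. -/
theorem mackeySemiring_induction {E : FusionSystem T} {P : BisetSemiring S → Prop}
    (h0 : P 0) (hadd : ∀ x ∈ mackeySemiring E, ∀ y ∈ mackeySemiring E, P x → P y → P (x + y))
    (hmul : ∀ x ∈ mackeySemiring E, ∀ y ∈ mackeySemiring E, P x → P y → P (x * y))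
    (hind : ∀ J K, J ≤ K → K ≤ T → P (sp K J J id id))
    (hres : ∀ J K, J ≤ K → K ≤ T → P (sp J K J id id))
    (hconj : ∀ J K σ, E.Mor σ J K → img σ J = K → P (sp K J J σ id))
    {x : BisetSemiring S} (hx : x ∈ mackeySemiring E) : P x := by
  refine NonUnitalSubsemiring.closure_induction (p := fun x _ => P x) ?_ h0
    (fun x y hx hy => hadd x hx y hy) (fun x y hx hy => hmul x hx y hy) hx
  rintro x (⟨J, K, h, hK, rfl | rfl⟩ | ⟨J, K, φ, hφ, rfl⟩)
  · rw [ind_eq_sp]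
    exact hind J K h hK
  · rw [res_eq_sp]
    exact hres J K h hK
  · have hm := mor_ofHom hφ
    rw [conj_eq_sp φ fun a => (ofHom_apply φ.toMonoidHom a).symm]
    exact hconj J K _ hm (hm.of_isPGroup_card_le (Nat.card_congr φ.toEquiv).ge)

theorem idUpTo_mul_of_mem {E : FusionSystem T} {x : BisetSemiring S} (hx : x ∈ mackeySemiring E) :
    idUpTo T * x = x ∧ x * idUpTo T = x := by
  refine mackeySemiring_induction (P := fun x => idUpTo T * x = x ∧ x * idUpTo T = x) ?_ ?_ ?_ ?_
    ?_ ?_ hx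
  · exact ⟨mul_zero _, zero_mul _⟩
  · rintro x - y - ⟨h1, h2⟩ ⟨h3, h4⟩
    exact ⟨by rw [mul_add, h1, h3], by rw [add_mul, h2, h4]⟩
  · rintro x - y - ⟨h1, h2⟩ ⟨h3, h4⟩
    exact ⟨by rw [← mul_assoc, h1], by rw [mul_assoc, h4]⟩
  · exact fun J K h hK => ⟨idUpTo_mul_sp (hm_id h) (hm_id le_rfl) hK,
      sp_mul_idUpTo (hm_id h) (hm_id le_rfl) (h.trans hK)⟩
  · exact fun J K h hK => ⟨idUpTo_mul_sp (hm_id le_rfl) (hm_id h) (h.trans hK),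
      sp_mul_idUpTo (hm_id le_rfl) (hm_id h) hK⟩
  · exact fun J K σ hσ _ => ⟨idUpTo_mul_sp hσ.hm (hm_id le_rfl) hσ.le_right,
      sp_mul_idUpTo hσ.hm (hm_id le_rfl) hσ.le_left⟩

section Act

variable (R : Type v) [CommRing R] (F : FusionSystem (⊤ : Subgroup S))
variable (M : Type w) [AddCommGroup M] [Module R M] [Module (MackeyAlgebra R F) M]
variable [IsScalarTower R (MackeyAlgebra R F) M]

theorem act_of_mem {x : BisetSemiring S} (hx : x ∈ mackeySemiring F) :
    act R F M x = Algebra.lsmul R R M ((1 : R) ⊗ₜ[ℕ] ⟨x, hx⟩ : MackeyAlgebra R F) := dif_pos hx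

theorem act_mul {x y : BisetSemiring S} (hx : x ∈ mackeySemiring F) (hy : y ∈ mackeySemiring F) :
    act R F M (x * y) = act R F M x * act R F M y := by
  rw [act_of_mem R F M hx, act_of_mem R F M hy, act_of_mem R F M (mul_mem hx hy), ← map_mul,
    Algebra.TensorProduct.tmul_mul_tmul, one_mul]
  rfl

theorem act_zero : act R F M 0 = 0 := by
  rw [act_of_mem R F M (zero_mem _)]
  have : ((1 : R) ⊗ₜ[ℕ] ⟨0, zero_mem _⟩ : MackeyAlgebra R F) = 0 := TensorProduct.tmul_zero _ _
  rw [this, map_zero]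

theorem act_add {x y : BisetSemiring S} (hx : x ∈ mackeySemiring F) (hy : y ∈ mackeySemiring F) :
    act R F M (x + y) = act R F M x + act R F M y := by
  rw [act_of_mem R F M hx, act_of_mem R F M hy, act_of_mem R F M (add_mem hx hy), ← map_add,
    ← TensorProduct.tmul_add]
  rfl

theorem act_sum {ι : Type*} (s : Finset ι) {x : ι → BisetSemiring S}
    (hx : ∀ i ∈ s, x i ∈ mackeySemiring F) :
    act R F M (∑ i ∈ s, x i) = ∑ i ∈ s, act R F M (x i) := by
  classical
  induction s using Finset.induction_on with
  | empty => simp [act_zero]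
  | insert i s hi ih =>
    rw [Finset.sum_insert hi, Finset.sum_insert hi, act_add R F M (hx i (Finset.mem_insert_self i s))
      (sum_mem fun j hj => hx j (Finset.mem_insert_of_mem hj)),
      ih fun j hj => hx j (Finset.mem_insert_of_mem hj)]

/-- The action of a transitive biset. -/
noncomputable def op (A B C : Subgroup S) (α β : S → S) : Module.End R M :=
  act R F M (sp A B C α β)

/-- The projection onto the values at the subgroups of `T`. -/
noncomputable def proj (T : Subgroup S) : Module.End R M := act R F M (idUpTo T)

section Op

variable {R F M} {A B C C' D L X : Subgroup S} {α β γ δ α' β' : S → S}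

theorem op_mul_of_right_id (hα : F.Mor α B A) (hγ : F.Mor γ C B) (hδ : F.Mor δ C D) :
    op R F M A B B α id * op R F M B D C γ δ = op R F M A D C (α ∘ γ) δ := by
  rw [op, op, op, ← act_mul R F M (sp_mem_mackeySemiring hα (F.mor_id le_rfl le_top))
    (sp_mem_mackeySemiring hγ hδ), sp_mul_of_right_id hα.hm hγ.hm hδ.hm]

theorem op_mul_of_left_id (hα : F.Mor α C A) (hβ : F.Mor β C B) (hδ : F.Mor δ B D) :
    op R F M A B C α β * op R F M B D B id δ = op R F M A D C α (δ ∘ β) := by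
  rw [op, op, op, ← act_mul R F M (sp_mem_mackeySemiring hα hβ)
    (sp_mem_mackeySemiring (F.mor_id le_rfl le_top) hδ), sp_mul_of_left_id hα.hm hβ.hm hδ.hm]

theorem op_mul_op_of_ne {B' : Subgroup S} (hα : F.Mor α C A) (hβ : F.Mor β C B)
    (hα' : F.Mor α' C' B') (hβ' : F.Mor β' C' D) (h : B ≠ B') :
    op R F M A B C α β * op R F M B' D C' α' β' = 0 := by
  rw [op, op, ← act_mul R F M (sp_mem_mackeySemiring hα hβ) (sp_mem_mackeySemiring hα' hβ'), sp, sp,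
    single_mul_single_of_ne h, act_zero]

/-- Reparametrization along an isomorphism `δ : C' → C`. -/
theorem op_eq (hα : F.Mor α C A) (hβ : F.Mor β C B) (hδ : F.Mor δ C' C) (him : img δ C' = C)
    (h1 : Cj A C' (α ∘ δ) α') (h2 : Cj B C' (β ∘ δ) β') :
    op R F M A B C α β = op R F M A B C' α' β' := by
  obtain ⟨a, ha, h1⟩ := h1
  obtain ⟨b, hb, h2⟩ := h2
  have e1 : F.Mor α' C' A := ((hδ.comp hα).comp (F.mor_cj trivial le_top le_top
    fun x hx => cj_mem ha hx)).congr h1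
  have e2 : F.Mor β' C' B := ((hδ.comp hβ).comp (F.mor_cj trivial le_top le_top
    fun x hx => cj_mem hb hx)).congr h2
  rw [op, op, sp_eq hα.hm hβ.hm e1.hm e2.hm (fun c hc => hδ.mem hc)
    (fun c hc => hδ.mem_img.1 (him ▸ hc)) ha hb h1 h2]

theorem op_congr (hα : F.Mor α C A) (hβ : F.Mor β C B) (h1 : Cj A C α α') (h2 : Cj B C β β') :
    op R F M A B C α β = op R F M A B C α' β' :=
  op_eq hα hβ (F.mor_id le_rfl le_top) (img_id C) h1 h2

theorem op_one_mul (hα : F.Mor α C A) (hβ : F.Mor β C B) :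
    op R F M A A A id id * op R F M A B C α β = op R F M A B C α β :=
  op_mul_of_right_id (F.mor_id le_rfl le_top) hα hβ

theorem op_mul_one (hα : F.Mor α C A) (hβ : F.Mor β C B) :
    op R F M A B C α β * op R F M B B B id id = op R F M A B C α β :=
  op_mul_of_left_id hα hβ (F.mor_id le_rfl le_top)

theorem op_eq_mul (hα : F.Mor α C A) (hβ : F.Mor β C B) :
    op R F M A B C α β = op R F M A C C α id * op R F M C B C id β :=
  (op_mul_of_right_id hα (F.mor_id le_rfl le_top) hβ).symm

/-- A transitive biset with apex `C` factors through `I_C^C`, which acts as zero on a centric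
functor. -/
theorem op_eq_zero (hM : IsCentricMackeyFunctor R F M) (hα : F.Mor α C A) (hβ : F.Mor β C B)
    (hC : ¬F.IsCentric C) : op R F M A B C α β = 0 := by
  have h : op R F M C C C id id = 0 := LinearMap.ext fun x => by
    rw [op, ← ind_eq_sp (le_refl C)]
    exact hM C hC x
  have hid := F.mor_id (le_refl C) le_top
  rw [op_eq_mul hα hβ, ← op_one_mul hid hβ, h, zero_mul, mul_zero]

theorem one_eq_zero (hM : IsCentricMackeyFunctor R F M) (hC : ¬F.IsCentric C) :
    op R F M C C C id id = 0 :=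
  op_eq_zero hM (F.mor_id le_rfl le_top) (F.mor_id le_rfl le_top) hC

theorem op_res_mul {J K : Subgroup S} (hJ : J ≤ K) (hβ : F.Mor β C K) (hα : F.Mor α C X)
    {s : Finset S} (hs : IsDoubleReps J K C β s) :
    op R F M J K J id id * op R F M K X C β α =
      ∑ t ∈ s, op R F M J X (pb (cj t ∘ β) C J) (cj t ∘ β) α := by
  rw [op, op, ← act_mul R F M (sp_mem_mackeySemiring (F.mor_id le_rfl le_top) (F.mor_id hJ le_top))
    (sp_mem_mackeySemiring hβ hα), res_mul_sp hJ hβ.hm hα.hm hs]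
  refine act_sum R F M s fun t ht => ?_
  have hc : F.Mor (cj t ∘ β) C K := hβ.comp
    (F.mor_cj trivial le_top le_top fun c hc => cj_mem (hs.1 t ht) hc)
  have hle : pb (cj t ∘ β) C J ≤ C := fun x hx => (hc.hm.mem_pb.1 hx).1
  exact sp_mem_mackeySemiring ((hc.restrict hle).cod (fun c hc' => (hc.hm.mem_pb.1 hc').2) le_top)
    (hα.restrict hle)

theorem op_mul_ind {J K : Subgroup S} (hJ : J ≤ K) (hβ : F.Mor β C K) (hα : F.Mor α C X)
    {s : Finset S} (hs : IsDoubleReps J K C β s) :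
    op R F M X K C α β * op R F M K J J id id =
      ∑ t ∈ s, op R F M X J (pb (cj t ∘ β) C J) α (cj t ∘ β) := by
  rw [op, op, ← act_mul R F M (sp_mem_mackeySemiring hα hβ)
    (sp_mem_mackeySemiring (F.mor_id hJ le_top) (F.mor_id le_rfl le_top)),
    sp_mul_ind hJ hβ.hm hα.hm hs]
  refine act_sum R F M s fun t ht => ?_
  have hc : F.Mor (cj t ∘ β) C K := hβ.comp
    (F.mor_cj trivial le_top le_top fun c hc => cj_mem (hs.1 t ht) hc)
  have hle : pb (cj t ∘ β) C J ≤ C := fun x hx => (hc.hm.mem_pb.1 hx).1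
  exact sp_mem_mackeySemiring (hα.restrict hle)
    ((hc.restrict hle).cod (fun c hc' => (hc.hm.mem_pb.1 hc').2) le_top)

open Classical in
theorem proj_eq (T : Subgroup S) :
    proj R F M T = ∑ L ∈ Finset.univ.filter (· ≤ T), op R F M L L L id id := by
  rw [proj, idUpTo_eq, act_sum]
  · rfl
  · exact fun L _ => sp_mem_mackeySemiring (F.mor_id le_rfl le_top) (F.mor_id le_rfl le_top)

theorem idUpTo_mem (T : Subgroup S) : idUpTo T ∈ mackeySemiring F := by
  classical
  rw [idUpTo_eq]
  exact sum_mem fun L _ => sp_mem_mackeySemiring (F.mor_id le_rfl le_top) (F.mor_id le_rfl le_top)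

theorem proj_mul_op (hα : F.Mor α C A) (hβ : F.Mor β C B) (hA : A ≤ T) :
    proj R F M T * op R F M A B C α β = op R F M A B C α β := by
  rw [proj, op, ← act_mul R F M (idUpTo_mem T) (sp_mem_mackeySemiring hα hβ),
    idUpTo_mul_sp hα.hm hβ.hm hA]

theorem op_mul_proj (hα : F.Mor α C A) (hβ : F.Mor β C B) (hB : B ≤ T) :
    op R F M A B C α β * proj R F M T = op R F M A B C α β := by
  rw [proj, op, ← act_mul R F M (sp_mem_mackeySemiring hα hβ) (idUpTo_mem T),
    sp_mul_idUpTo hα.hm hβ.hm hB]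

theorem proj_mul_proj (h : T' ≤ T) : proj R F M T * proj R F M T' = proj R F M T' ∧
    proj R F M T' * proj R F M T = proj R F M T' := by
  classical
  rw [proj_eq T', Finset.mul_sum, Finset.sum_mul]
  have hid : ∀ L : Subgroup S, F.Mor id L L := fun L => F.mor_id le_rfl le_top
  refine ⟨Finset.sum_congr rfl fun L hL => ?_, Finset.sum_congr rfl fun L hL => ?_⟩
  · exact proj_mul_op (hid L) (hid L) ((Finset.mem_filter.1 hL).2.trans h)
  · exact op_mul_proj (hid L) (hid L) ((Finset.mem_filter.1 hL).2.trans h)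

end Op

/-! ## Endomorphisms of the restrictions of a Mackey functor as endomorphisms of the module -/

variable {R M}

/-- `g` is an endomorphism of the restriction of `M` to `E`, extended to `M` by the projection. -/
def MEnd (E : FusionSystem T) (g : Module.End R M) : Prop :=
  (∀ a ∈ mackeySemiring E, act R F M a * g = g * act R F M a) ∧ g * proj R F M T = g

variable {F} {E : FusionSystem T}

theorem MEnd.proj_mul {g : Module.End R M} (hg : MEnd F E g) : proj R F M T * g = g := by
  exact (hg.1 _ (idUpTo_mem_mackeySemiring E)).trans hg.2

theorem MEnd.comm {g : Module.End R M} (hg : MEnd F E g) {A B C : Subgroup S} {α β : S → S}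
    (hα : E.Mor α C A) (hβ : E.Mor β C B) :
    op R F M A B C α β * g = g * op R F M A B C α β := hg.1 _ (sp_mem_mackeySemiring hα hβ)

/-- Commutation with `g` passes to sums and products, so the generators of the Mackey semiring
suffice. -/
theorem MEnd.of_generators (hE : E.Sub F) {g : Module.End R M} (hp : g * proj R F M T = g)
    (hind : ∀ J K, J ≤ K → K ≤ T → op R F M K J J id id * g = g * op R F M K J J id id)
    (hres : ∀ J K, J ≤ K → K ≤ T → op R F M J K J id id * g = g * op R F M J K J id id)
    (hconj : ∀ J K σ, E.Mor σ J K → img σ J = K →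
      op R F M K J J σ id * g = g * op R F M K J J σ id) : MEnd F E g := by
  have hle := mackeySemiring_mono hE
  refine ⟨fun a ha => mackeySemiring_induction
    (P := fun a => act R F M a * g = g * act R F M a) ?_ ?_ ?_ hind hres hconj ha, hp⟩
  · rw [act_zero, zero_mul, mul_zero]
  · intro x hx y hy h1 h2
    rw [act_add R F M (hle hx) (hle hy), add_mul, mul_add, h1, h2]
  · intro x hx y hy h1 h2
    rw [act_mul R F M (hle hx) (hle hy), mul_assoc, h2, ← mul_assoc, h1, mul_assoc]

theorem MEnd.sum {ι : Type*} {s : Finset ι} {g : ι → Module.End R M}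
    (h : ∀ i ∈ s, MEnd F E (g i)) : MEnd F E (∑ i ∈ s, g i) := by
  refine ⟨fun a ha => ?_, ?_⟩
  · rw [Finset.mul_sum, Finset.sum_mul]
    exact Finset.sum_congr rfl fun i hi => (h i hi).1 a ha
  · rw [Finset.sum_mul]
    exact Finset.sum_congr rfl fun i hi => (h i hi).2

theorem MEnd.smul {g : Module.End R M} (h : MEnd F E g) (r : R) : MEnd F E (r • g) := by
  refine ⟨fun a ha => ?_, ?_⟩
  · rw [mul_smul_comm, smul_mul_assoc, h.1 a ha]
  · rw [smul_mul_assoc, h.2]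

theorem MEnd.mul {g g' : Module.End R M} (h : MEnd F E g) (h' : MEnd F E g') :
    MEnd F E (g * g') := by
  refine ⟨fun a ha => ?_, ?_⟩
  · rw [← mul_assoc, h.1 a ha, mul_assoc, h'.1 a ha, mul_assoc]
  · rw [mul_assoc, h'.2]

theorem MEnd.restrict {E' : FusionSystem T'} (hE : E'.Sub E) (hEF : E.Sub F) {g : Module.End R M}
    (h : MEnd F E g) : MEnd F E' (g * proj R F M T') := by
  have hT := idUpTo_mem_mackeySemiring E'
  refine ⟨fun a ha => ?_, ?_⟩
  · have ha' := mackeySemiring_mono hE ha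
    have haF : ∀ {x}, x ∈ mackeySemiring E' → x ∈ mackeySemiring F := fun {x} hx =>
      mackeySemiring_mono hEF (mackeySemiring_mono hE hx)
    rw [← mul_assoc, h.1 a ha', mul_assoc, mul_assoc, proj, ← act_mul R F M (haF ha) (haF hT),
      ← act_mul R F M (haF hT) (haF ha), (idUpTo_mul_of_mem ha).1, (idUpTo_mul_of_mem ha).2]
  · rw [mul_assoc, (proj_mul_proj le_rfl).1]

theorem mem_down {x : M} : x ∈ down R F M T ↔ proj R F M T x = x := by
  constructor
  · rintro ⟨y, rfl⟩
    exact LinearMap.congr_fun (proj_mul_proj (R := R) (F := F) (M := M) (le_refl T)).1 y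
  · exact fun h => ⟨x, h⟩

theorem extend_apply (f : Module.End R (down R F M T)) (x : down R F M T) :
    extend R F f x = f x := by
  have : (act R F M (idUpTo T)).rangeRestrict (x : M) = x := Subtype.ext (mem_down.1 x.2)
  change ((f ((act R F M (idUpTo T)).rangeRestrict (x : M)) : down R F M T) : M) = f x
  rw [this]

theorem extend_mul_proj (f : Module.End R (down R F M T)) :
    extend R F f * proj R F M T = extend R F f := by
  refine LinearMap.ext fun x => ?_
  change ((f ((act R F M (idUpTo T)).rangeRestrict (proj R F M T x)) : down R F M T) : M) =
    ((f ((act R F M (idUpTo T)).rangeRestrict x) : down R F M T) : M)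
  congr 2
  exact Subtype.ext (LinearMap.congr_fun (proj_mul_proj (R := R) (F := F) (M := M) (le_refl T)).1 x)

theorem extend_injective : Function.Injective (extend R F (M := M) (T := T)) := fun f f' h =>
  LinearMap.ext fun x => Subtype.ext (by rw [← extend_apply, ← extend_apply, h])

theorem extend_compress (g : Module.End R M) :
    extend R F (compress R F T g) = proj R F M T * g * proj R F M T := rfl

theorem extend_restrictEnd (f : Module.End R (down R F M T)) :
    extend R F (restrictEnd R F T' f) = proj R F M T' * extend R F f * proj R F M T' := rfl

theorem extend_comp (f f' : Module.End R (down R F M T)) :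
    extend R F (f ∘ₗ f') = extend R F f * extend R F f' := by
  refine LinearMap.ext fun x => ?_
  change _ = extend R F f (extend R F f' x)
  exact (extend_apply f (f' ((act R F M (idUpTo T)).rangeRestrict x))).symm

theorem extend_id : extend R F (LinearMap.id : Module.End R (down R F M T)) = proj R F M T := rfl

theorem extend_add (f f' : Module.End R (down R F M T)) :
    extend R F (f + f') = extend R F f + extend R F f' := rfl

theorem extend_smul (r : R) (f : Module.End R (down R F M T)) :
    extend R F (r • f) = r • extend R F f := rfl

theorem extend_sum {ι : Type*} (s : Finset ι) (f : ι → Module.End R (down R F M T)) :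
    extend R F (∑ i ∈ s, f i) = ∑ i ∈ s, extend R F (f i) :=
  map_sum ({ toFun := extend R F, map_zero' := LinearMap.ext fun _ => rfl, map_add' := extend_add } :
    Module.End R (down R F M T) →+ Module.End R M) f s

/-- Endomorphisms of all the summands of `M` become elements of `End_R(M)`, so that later
computations take place in one ring. -/
theorem isMackeyEnd_iff (hE : E.Sub F) {f : Module.End R (down R F M T)} :
    IsMackeyEnd R F E f ↔ MEnd F E (extend R F f) := by
  have hmem : ∀ a ∈ mackeySemiring E, proj R F M T * act R F M a = act R F M a ∧
      act R F M a * proj R F M T = act R F M a := by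
    intro a ha
    have ha' := mackeySemiring_mono hE ha
    rw [proj, ← act_mul R F M (idUpTo_mem T) ha', ← act_mul R F M ha' (idUpTo_mem T),
      (idUpTo_mul_of_mem ha).1, (idUpTo_mul_of_mem ha).2]
    exact ⟨rfl, rfl⟩
  constructor
  · refine fun h => ⟨fun a ha => LinearMap.ext fun x => ?_, extend_mul_proj f⟩
    let z : down R F M T := (act R F M (idUpTo T)).rangeRestrict x
    let y : down R F M T := ⟨act R F M a x, mem_down.2 (LinearMap.congr_fun (hmem a ha).1 x)⟩
    have h1 := h a ha z y (LinearMap.congr_fun (hmem a ha).2 x).symm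
    change act R F M a (f z) = extend R F f y
    rw [extend_apply, h1]
  · intro h a ha x y hxy
    rw [← extend_apply, ← extend_apply, hxy]
    exact (LinearMap.congr_fun (h.1 a ha) x).symm

end Act

end FusionMackey

namespace FusionMackey

open FusionSystem BisetSemiring

variable {S : Type u} [Group S] [Finite S] {T T' : Subgroup S}
variable {R : Type v} [CommRing R] {F : FusionSystem (⊤ : Subgroup S)}
variable {M : Type w} [AddCommGroup M] [Module R M] [Module (MackeyAlgebra R F) M]
variable [IsScalarTower R (MackeyAlgebra R F) M]

/-! ## Transfers -/

section Iso

variable {A B C L : Subgroup S} {φ : S → S}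

/-- Reparametrizing the apex along `φ` turns the biset of `φ` read backwards into the conjugation by
`φ⁻¹`. -/
theorem op_flip (hφ : F.Mor φ A B) (him : img φ A = B) :
    op R F M A B A id φ = op R F M A B B (finv φ A) id := by
  subst him
  have hid := F.mor_id (le_refl A) le_top
  refine op_eq hid hφ hφ.finv hφ.img_finv (Cj.refl _ _ _) (Cj.of_eq fun c hc => ?_)
  exact (hφ.apply_finv hc).symm

theorem op_flip' (hφ : F.Mor φ A B) (him : img φ A = B) :
    op R F M B A A φ id = op R F M B A B id (finv φ A) := by
  subst him
  have hid := F.mor_id (le_refl A) le_top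
  refine op_eq hφ hid hφ.finv hφ.img_finv (Cj.of_eq fun c hc => ?_) (Cj.refl _ _ _)
  exact (hφ.apply_finv hc).symm

theorem op_iso_mul_inv (hφ : F.Mor φ A B) (him : img φ A = B) :
    op R F M A B A id φ * op R F M B A A φ id = op R F M A A A id id := by
  have hid := F.mor_id (le_refl A) le_top
  have h := hφ.finv
  rw [him] at h
  rw [op_flip hφ him, op_mul_of_right_id h hφ hid]
  exact op_congr (hφ.comp h) hid (Cj.of_eq fun c hc => (hφ.finv_apply hc).symm) (Cj.refl _ _ _)

end Iso

theorem inner_sub {H : Subgroup S} {E : FusionSystem T} (hH : H ≤ T) : (inner H).Sub E := by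
  rintro α A B ⟨φ, ⟨hA, hB, t, ht, h⟩, e⟩
  exact ⟨φ, E.conj_mem φ (hA.trans hH) (hB.trans hH) ⟨t, hH ht, h⟩, e⟩

variable (F) in
/-- The summand of a transfer that belongs to a span. -/
noncomputable def wt (g : Module.End R M) (L : Subgroup S) (x : Span S) : Module.End R M :=
  op R F M L (img x.a x.C) x.C x.c x.a * g * op R F M (img x.a x.C) L x.C x.a x.c

/-! ### Summands of transfers attached to spans. -/

section Weight

variable {g g' : Module.End R M} {C H K L : Subgroup S} {x y : Span S} {b c : S → S}

theorem wt_id : wt F g L ⟨C, id, b, c⟩ = op R F M L C C c id * g * op R F M C L C id c := by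
  simp only [wt, img_id]

/-- An isomorphism of spans matches the legs to `L` up to a conjugation in `L`, which the bisets do
not see, and the legs to `H` up to conjugation by some `k ∈ H`. The latter cancels because `g`
commutes with conjugations by elements of `H`. -/
theorem wt_congr {E : FusionSystem T} (hE : E.Sub F) (hg : MEnd F (inner H) g)
    (hxa : F.Mor x.a x.C H) (hxc : F.Mor x.c x.C L) (hya : F.Mor y.a y.C H) (hyc : F.Mor y.c y.C L)
    (h : Span.Le E H K L x y) (h' : Span.Le E H K L y x) : wt F g L x = wt F g L y := by
  obtain ⟨δ, hδ, him, ⟨k, hk, e1⟩, -, e2⟩ := h.exists_iso h'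
  have hδ := hE _ _ _ hδ
  have hkm : ∀ d ∈ img x.a x.C, cj k d ∈ img y.a y.C := by
    intro d hd
    obtain ⟨c, hc, rfl⟩ := hxa.mem_img.1 hd
    rw [← e1 c hc]
    exact mem_img_of_mem (hδ.mem hc)
  have hkH : (inner H).Mor (cj k) (img x.a x.C) (img y.a y.C) :=
    (inner H).mor_cj hk hxa.img_le hya.img_le hkm
  have hkF : F.Mor (cj k) (img x.a x.C) (img y.a y.C) := inner_sub le_top _ _ _ hkH
  have hkim : img (cj k) (img x.a x.C) = img y.a y.C := by
    refine le_antisymm hkF.img_le fun d hd => ?_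
    obtain ⟨c', hc', rfl⟩ := hya.mem_img.1 hd
    obtain ⟨c, hc, rfl⟩ := hδ.mem_img.1 (him ▸ hc')
    rw [← Function.comp_apply (f := y.a), e1 c hc]
    exact mem_img_of_mem (mem_img_of_mem hc)
  have e1' : Cj (img y.a y.C) x.C (y.a ∘ δ) (cj k ∘ x.a) := Cj.of_eq fun c hc => (e1 c hc).symm
  have h1 : op R F M L (img y.a y.C) y.C y.c y.a =
      op R F M L (img x.a x.C) x.C x.c x.a *
        op R F M (img x.a x.C) (img y.a y.C) (img x.a x.C) id (cj k) := by
    rw [op_eq hyc hya.onto hδ him e2.symm e1', op_mul_of_left_id hxc hxa.onto hkF]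
  have h2 : op R F M (img y.a y.C) L y.C y.a y.c =
      op R F M (img y.a y.C) (img x.a x.C) (img x.a x.C) (cj k) id *
        op R F M (img x.a x.C) L x.C x.a x.c := by
    rw [op_eq hya.onto hyc hδ him e1' e2.symm, op_mul_of_right_id hkF hxa.onto hxc]
  have h3 := hg.comm ((inner H).mor_id (le_refl (img x.a x.C)) hxa.img_le) hkH
  rw [wt, wt, h1, h2, mul_assoc _ _ g, h3]
  simp only [mul_assoc]
  rw [← mul_assoc (op R F M (img x.a x.C) (img y.a y.C) (img x.a x.C) id (cj k)),
    op_iso_mul_inv hkF hkim, op_one_mul hxa.onto hxc]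

theorem wt_eq_zero (hM : IsCentricMackeyFunctor R F M) (ha : F.Mor x.a x.C H)
    (hc : F.Mor x.c x.C L) (h : ¬F.IsCentric x.C) : wt F g L x = 0 := by
  rw [wt, op_eq_zero hM ha.onto hc h, mul_zero]

/-- For the identity of the restriction to `H`, the isomorphism `C → a(C)` cancels against its
inverse, and the leg to `H` disappears. -/
theorem wt_proj (ha : F.Mor x.a x.C H) (hc : F.Mor x.c x.C L) :
    wt F (proj R F M H) L x = op R F M L x.C x.C x.c id * op R F M x.C L x.C id x.c := by
  rw [wt, op_mul_proj hc ha.onto ha.img_le, op_eq_mul hc ha.onto, op_eq_mul ha.onto hc, mul_assoc,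
    ← mul_assoc (op R F M x.C (img x.a x.C) x.C id x.a), op_iso_mul_inv ha.onto rfl, op_one_mul]
  · exact F.mor_id le_rfl le_top
  · exact hc

theorem one_mul_wt (ha : F.Mor x.a x.C H) (hc : F.Mor x.c x.C L) :
    op R F M L L L id id * wt F g L x = wt F g L x := by
  rw [wt, ← mul_assoc, ← mul_assoc, op_one_mul hc ha.onto]

theorem wt_mul_one (ha : F.Mor x.a x.C H) (hc : F.Mor x.c x.C L) :
    wt F g L x * op R F M L L L id id = wt F g L x := by
  rw [wt, mul_assoc, op_mul_one ha.onto hc]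

theorem wt_sum {ι : Type*} (s : Finset ι) (g : ι → Module.End R M) :
    wt F (∑ i ∈ s, g i) L x = ∑ i ∈ s, wt F (g i) L x := by
  simp only [wt, Finset.mul_sum, Finset.sum_mul]

end Weight

/-! ### Transfers as elements of the endomorphism ring of `M`. -/

section Tr

variable (F) in
/-- The component at `L` of the transfer of `g`. -/
noncomputable def Tr (E : FusionSystem T) (H : Subgroup S) (g : Module.End R M) (L : Subgroup S) :
    Module.End R M :=
  ∑ P ∈ productReps E H L, wt F g L ⟨P.A, id, fun _ => 1, P.fn⟩

open Classical in
variable (F) in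
/-- The transfer of `g`. -/
noncomputable def trf (E : FusionSystem T) (H : Subgroup S) (g : Module.End R M) :
    Module.End R M :=
  ∑ L ∈ Finset.univ.filter (fun L => E.IsCentric L), Tr F E H g L

variable {p : ℕ} [Fact p.Prime] {E : FusionSystem T} {g g' : Module.End R M}
  {H K L J : Subgroup S}

/-- The families may contain spans whose apex is centric in `E` but not in `F`. These need not be
`Ok`, but they act as zero because `M` is centric over `F`. -/
theorem sum_wt_eq_of_cover {T'' : Subgroup S} {E' : FusionSystem T''} {Ok : Span S → Prop}
    (hE : E.Sub F) (hE' : E'.Sub F)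
    (hM : IsCentricMackeyFunctor R F M) (hg : MEnd F (inner H) g) {ι κ : Type*}
    (hOk : ∀ x, Ok x → F.IsCentric x.C ∧ x.C ≤ T ∧ E'.Mor x.a x.C H ∧ E.Mor x.c x.C L)
    {s : Finset ι} {z : ι → Span S} {t : Finset κ} {z' : κ → Span S}
    (hs : ∀ x, Ok x → ∃! i, i ∈ s ∧ Span.Le E H K L x (z i))
    (ht : ∀ x, Ok x → ∃! j, j ∈ t ∧ Span.Le E H K L x (z' j))
    (hsa : ∀ i ∈ s, E'.Mor (z i).a (z i).C H ∧ E.Mor (z i).c (z i).C L)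
    (hta : ∀ j ∈ t, E'.Mor (z' j).a (z' j).C H ∧ E.Mor (z' j).c (z' j).C L)
    (hs' : ∀ i ∈ s, F.IsCentric (z i).C → Ok (z i))
    (ht' : ∀ j ∈ t, F.IsCentric (z' j).C → Ok (z' j)) :
    ∑ i ∈ s, wt F g L (z i) = ∑ j ∈ t, wt F g L (z' j) := by
  refine sum_eq_sum_of_cover Ok (Span.Le E H K L) (fun x hx => Span.Le.refl (hOk x hx).2.1)
    (fun _ _ _ => Span.Le.trans) (fun x i hi hx h => hs' i hi (h.centric hE (hOk x hx).1))
    (fun x j hj hx h => ht' j hj (h.centric hE (hOk x hx).1)) hs ht (wt F g L)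
    (fun x y hx hy h h' => ?_) (fun i hi h => ?_) fun j hj h => ?_
  · obtain ⟨-, -, h1, h2⟩ := hOk x hx
    obtain ⟨-, -, h3, h4⟩ := hOk y hy
    exact wt_congr hE hg (hE' _ _ _ h1) (hE _ _ _ h2) (hE' _ _ _ h3) (hE _ _ _ h4) h h'
  · exact wt_eq_zero hM (hE' _ _ _ (hsa i hi).1) (hE _ _ _ (hsa i hi).2) fun hc => h (hs' i hi hc)
  · exact wt_eq_zero hM (hE' _ _ _ (hta j hj).1) (hE _ _ _ (hta j hj).2) fun hc => h (ht' j hj hc)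

/-- A transfer may be computed with any family that represents the product. -/
theorem sum_wt_eq_Tr (hS : IsPGroup p S) (hE : E.Good) (hEF : E.Sub F)
    (hM : IsCentricMackeyFunctor R F M) (hg : MEnd F (inner H) g) (hH : H ≤ T) {ι : Type*}
    {s : Finset ι} {z : ι → Span S}
    (hs : ∀ x, Ok2 F E H L x → ∃! i, i ∈ s ∧ Span.Le E H ⊥ L x (z i))
    (hsa : ∀ i ∈ s, (z i).b = (fun _ => 1) ∧ E.Mor (z i).a (z i).C H ∧ E.Mor (z i).c (z i).C L) :
    ∑ i ∈ s, wt F g L (z i) = Tr F E H g L :=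
  sum_wt_eq_of_cover (Ok := Ok2 F E H L) hEF hEF hM hg (fun _ hx => ⟨hx.1, hx.le, hx.2.2⟩) hs
    ((isProductReps_productReps E H L).cover_id hS hE hEF hH) (fun i hi => (hsa i hi).2)
    (fun P _ => ⟨E.mor_id P.le hH, P.mor⟩) (fun i hi hc => ⟨hc, hsa i hi⟩)
    fun P _ hc => ⟨hc, rfl, E.mor_id P.le hH, P.mor⟩

theorem one_mul_Tr (hE : E.Sub F) : op R F M L L L id id * Tr F E H g L = Tr F E H g L := by
  rw [Tr, Finset.mul_sum]
  exact Finset.sum_congr rfl fun P _ =>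
    one_mul_wt (x := ⟨P.A, id, _, P.fn⟩) (F.mor_id le_rfl le_top) (hE _ _ _ P.mor)

theorem Tr_mul_one (hE : E.Sub F) : Tr F E H g L * op R F M L L L id id = Tr F E H g L := by
  rw [Tr, Finset.sum_mul]
  exact Finset.sum_congr rfl fun P _ =>
    wt_mul_one (x := ⟨P.A, id, _, P.fn⟩) (F.mor_id le_rfl le_top) (hE _ _ _ P.mor)

theorem one_mul_one_of_ne (h : K ≠ L) : op R F M K K K id id * op R F M L L L id id = 0 := by
  have hid : ∀ L : Subgroup S, F.Mor id L L := fun L => F.mor_id le_rfl le_top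
  exact op_mul_op_of_ne (hid _) (hid _) (hid _) (hid _) h

/-- If `L` is not centric in `E`, the transfer has no component there; then `L` is not centric in
`F` either, and `Tr` vanishes as well. -/
theorem trf_mul_one (hE : E.Sub F) (hM : IsCentricMackeyFunctor R F M) (hL : L ≤ T) :
    trf F E H g * op R F M L L L id id = Tr F E H g L := by
  classical
  by_cases hc : E.IsCentric L
  · rw [trf, Finset.sum_mul, Finset.sum_eq_single L, Tr_mul_one hE]
    · intro K _ hK
      rw [← Tr_mul_one hE, mul_assoc, one_mul_one_of_ne hK, mul_zero]
    · exact fun h => absurd (Finset.mem_filter.2 ⟨Finset.mem_univ _, hc⟩) h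
  · rw [← Tr_mul_one hE, one_eq_zero hM fun h => hc (hE.centric h hL), mul_zero, mul_zero]

theorem one_mul_trf (hE : E.Sub F) (hM : IsCentricMackeyFunctor R F M) (hL : L ≤ T) :
    op R F M L L L id id * trf F E H g = Tr F E H g L := by
  classical
  by_cases hc : E.IsCentric L
  · rw [trf, Finset.mul_sum, Finset.sum_eq_single L, one_mul_Tr hE]
    · intro K _ hK
      rw [← one_mul_Tr hE, ← mul_assoc, one_mul_one_of_ne hK.symm, zero_mul]
    · exact fun h => absurd (Finset.mem_filter.2 ⟨Finset.mem_univ _, hc⟩) h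
  · rw [← one_mul_Tr hE, one_eq_zero hM fun h => hc (hE.centric h hL), zero_mul, zero_mul]

theorem one_mul_proj (hL : L ≤ T) :
    op R F M L L L id id * proj R F M T = op R F M L L L id id :=
  op_mul_proj (F.mor_id le_rfl le_top) (F.mor_id le_rfl le_top) hL

theorem proj_mul_one (hL : L ≤ T) :
    proj R F M T * op R F M L L L id id = op R F M L L L id id :=
  proj_mul_op (F.mor_id le_rfl le_top) (F.mor_id le_rfl le_top) hL

theorem trf_mul_proj (hE : E.Sub F) : trf F E H g * proj R F M T = trf F E H g := by
  classical
  rw [trf, Finset.sum_mul]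
  refine Finset.sum_congr rfl fun L hL => ?_
  rw [← Tr_mul_one hE, mul_assoc, one_mul_proj (Finset.mem_filter.1 hL).2.1]

theorem proj_mul_trf (hE : E.Sub F) : proj R F M T * trf F E H g = trf F E H g := by
  classical
  rw [trf, Finset.mul_sum]
  refine Finset.sum_congr rfl fun L hL => ?_
  rw [← one_mul_Tr hE, ← mul_assoc, proj_mul_one (Finset.mem_filter.1 hL).2.1]

theorem mul_proj_eq_of_mul_one (h : ∀ L ≤ T, g * op R F M L L L id id = g' * op R F M L L L id id) :
    g * proj R F M T = g' * proj R F M T := by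
  classical
  rw [proj_eq, Finset.mul_sum, Finset.mul_sum]
  exact Finset.sum_congr rfl fun L hL => h L (Finset.mem_filter.1 hL).2

theorem OrbitPair.iso_apply {H K : Subgroup S} (P : OrbitPair E H K) (a : P.A) :
    (P.iso a : S) = P.fn a := by
  rw [P.fn_apply]
  rfl

/-- In each term, the composites `c_{φ⁻¹} R` and `I c_φ` are the two transitive bisets with apex `A`
and legs the identity and `φ`. -/
theorem extend_transfer (hE : E.Sub F) (f : Module.End R (down R F M H)) :
    extend R F (transfer R F E H f) = trf F E H (extend R F f) := by
  classical
  have key : ∑ K ∈ Finset.univ.filter (fun K : Subgroup S => E.IsCentric K),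
      ∑ P ∈ productReps E H K,
        act R F M (ind P.im_le) ∘ₗ act R F M (conj P.iso) ∘ₗ extend R F f ∘ₗ
          act R F M (conj P.iso.symm) ∘ₗ act R F M (res P.im_le) ∘ₗ
            act R F M (ind (le_refl K)) = trf F E H (extend R F f) := by
    refine Finset.sum_congr rfl fun K _ => Finset.sum_congr rfl fun P _ => ?_
    have hP := hE _ _ _ P.mor
    have hP' : F.Mor P.fn P.A P.im := by rw [P.im_eq]; exact hP.onto
    have hid : ∀ L : Subgroup S, F.Mor id L L := fun L => F.mor_id le_rfl le_top
    have hi : F.Mor id P.im K := F.mor_id P.im_le le_top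
    have hs : ∀ b : P.im, (P.iso.symm b : S) = finv P.fn P.A b := by
      intro b
      have : (b : S) = P.fn (P.iso.symm b) := by rw [← P.iso_apply, P.iso.apply_symm_apply]
      rw [this, hP.finv_apply (P.iso.symm b).2]
    rw [ind_eq_sp, ind_eq_sp, res_eq_sp, conj_eq_sp P.iso P.iso_apply, conj_eq_sp P.iso.symm hs,
      wt_id]
    change op R F M K P.im P.im id id * (op R F M P.im P.A P.A P.fn id * (extend R F f *
      (op R F M P.A P.im P.im (finv P.fn P.A) id * (op R F M P.im K P.im id id *
        op R F M K K K id id)))) = _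
    rw [← op_flip hP' P.im_eq.symm, op_mul_one (hid _) hi, op_mul_of_left_id (hid _) hP' hi,
      ← mul_assoc, op_mul_of_right_id hi hP' (hid _), mul_assoc]
    rfl
  rw [transfer, extend_compress, key, proj_mul_trf hE, trf_mul_proj hE]

end Tr

end FusionMackey

namespace FusionMackey

open FusionSystem BisetSemiring

variable {S : Type u} [Group S] [Finite S] {T T' : Subgroup S}
variable {R : Type v} [CommRing R] {F : FusionSystem (⊤ : Subgroup S)}
variable {M : Type w} [AddCommGroup M] [Module R M] [Module (MackeyAlgebra R F) M]
variable [IsScalarTower R (MackeyAlgebra R F) M]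

/-! ## Transfers are endomorphisms of Mackey functors -/

section TransferEnd

variable {p : ℕ} [Fact p.Prime] {E : FusionSystem T} {g g' : Module.End R M}
  {H K L J : Subgroup S} {σ : S → S}

/-- Morphisms to `K` correspond to morphisms to `J` by composition with `σ⁻¹`, so a family for `J`
serves for `K`. -/
theorem cover_postcomp (hS : IsPGroup p S) (hE : E.Good) (hEF : E.Sub F) (hH : H ≤ T)
    (hσ : E.Mor σ J K) (him : img σ J = K) {X : Finset (OrbitPair E H J)}
    (hX : IsProductReps E H J X) (x : Span S) (hx : Ok2 F E H K x) :
    ∃! P, P ∈ X ∧ Span.Le E H ⊥ K x ⟨P.A, id, fun _ => 1, σ ∘ P.fn⟩ := by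
  obtain ⟨hC, hb, ha, hc⟩ := hx
  have hC' := hEF.centric hC ha.le_left
  have hσ' := hσ.finv
  rw [him] at hσ'
  have hlift : ∀ {P : OrbitPair E H J} {δ : S → S}, E.Mor δ x.C P.A →
      Cj K x.C x.c (σ ∘ P.fn ∘ δ) → Cj J x.C (finv σ J ∘ x.c) (P.fn ∘ δ) := by
    intro P δ hδ h
    rw [← him] at h
    exact (Cj.finv hσ h.symm fun c hc => P.mor.mem (hδ.mem hc)).symm
  refine existsUnique_of_exists_of_unique ?_ ?_
  · obtain ⟨P, hP, δ, hδ, h1, h2⟩ := hX.exists_factor hC' ha (hc.comp hσ')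
    refine ⟨P, hP, δ, hδ, h1, Cj.of_eq fun c _ => by rw [hb]; rfl, ?_⟩
    have h3 := Cj.postcomp hσ h2 fun c hc' => hσ'.mem (hc.mem hc')
    rw [him] at h3
    refine (Cj.of_eq fun c hc' => ?_).trans h3
    exact hσ.apply_finv (him.symm ▸ hc.mem hc')
  · rintro P P' ⟨hP, δ, hδ, h1, -, h2⟩ ⟨hP', δ', hδ', h1', -, h2'⟩
    exact (hX.factor_unique hS hE hH hC' hP hP' hδ hδ' (h1.symm.trans h1')
      ((hlift hδ h2).symm.trans (hlift hδ' h2'))).1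

/-- The double coset formula for the functor `[H × K]` restricted to `J ≤ K`. -/
theorem cover_double (hS : IsPGroup p S) (hE : E.Good) (hEF : E.Sub F) (hH : H ≤ T) (hK : K ≤ T)
    (hJ : J ≤ K) {X : Finset (OrbitPair E H K)} (hX : IsProductReps E H K X)
    {s : OrbitPair E H K → Finset S} (hs : ∀ P, IsDoubleReps J K P.A P.fn (s P)) (x : Span S)
    (hx : Ok2 F E H J x) :
    ∃! i : (_ : OrbitPair E H K) × S, i ∈ X.sigma s ∧ Span.Le E H ⊥ J x
      ⟨pb (cj i.2 ∘ i.1.fn) i.1.A J, id, fun _ => 1, cj i.2 ∘ i.1.fn⟩ := by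
  obtain ⟨hC, hb, ha, hc⟩ := hx
  have hC' := hEF.centric hC ha.le_left
  have hcK := hc.comp (E.mor_id hJ hK)
  have hm : ∀ {P : OrbitPair E H K} {t : S}, t ∈ s P → E.Mor (cj t ∘ P.fn) P.A K := fun {P t} ht =>
    P.mor.comp (E.mor_cj (hK ((hs P).1 t ht)) hK hK fun c hc => cj_mem ((hs P).1 t ht) hc)
  refine existsUnique_of_exists_of_unique ?_ ?_
  · obtain ⟨P, hP, δ, hδ, ⟨h, hh, h1⟩, k, hk, h2⟩ := hX.exists_factor hC' ha hcK
    -- Here `k⁻¹ = j * t * P.fn y`. The element `j` is absorbed by the leg to `J`, and `y` by the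
    -- factor into `P.A`.
    obtain ⟨t, ⟨ht, j, hj, y, hy, e⟩, -⟩ := (hs P).2 k⁻¹ (inv_mem hk)
    have e1 : ∀ c ∈ x.C, x.c c = cj j (cj t (P.fn (cj y (δ c)))) := fun c hc => by
      rw [P.mor.map_cj hy (hδ.mem hc), cj_cj, cj_cj, ← e, ← Function.comp_apply (f := P.fn),
        h2 c hc, cj_inv_cj]
      rfl
    have e2 : ∀ c ∈ x.C, cj t (P.fn (cj y (δ c))) = cj j⁻¹ (x.c c) := fun c hc => by
      rw [e1 c hc, cj_inv_cj]
    have hle : pb (cj t ∘ P.fn) P.A J ≤ P.A := fun z hz => ((hm ht).hm.mem_pb.1 hz).1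
    refine ⟨⟨P, t⟩, Finset.mem_sigma.2 ⟨hP, ht⟩, cj y ∘ δ, ?_, ?_, Cj.of_eq fun c _ => by
      rw [hb]; rfl, ?_⟩
    · refine (hδ.comp (E.mor_cj (P.centric.1 hy) P.centric.1 P.centric.1 fun c hc =>
        cj_mem hy hc)).cod (fun c hc' => (hm ht).hm.mem_pb.2 ⟨cj_mem hy (hδ.mem hc'), ?_⟩)
        (hle.trans P.centric.1)
      change cj t (P.fn (cj y (δ c))) ∈ J
      rw [e2 c hc']
      exact cj_mem (inv_mem hj) (hc.mem hc')
    · exact ⟨y * h, mul_mem (P.le hy) hh, fun c hc => by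
        rw [← cj_cj, ← h1 c hc]; rfl⟩
    · exact ⟨j⁻¹, inv_mem hj, fun c hc => e2 c hc⟩
  · rintro ⟨P, t⟩ ⟨P', t'⟩ ⟨hi, δ, hδ, h1, -, h2⟩ ⟨hi', δ', hδ', h1', -, h2'⟩
    obtain ⟨hP, ht⟩ := Finset.mem_sigma.1 hi
    obtain ⟨hP', ht'⟩ := Finset.mem_sigma.1 hi'
    dsimp only at *
    have hδA := hδ.cod (fun c hc => ((hm ht).hm.mem_pb.1 (hδ.mem hc)).1) P.centric.1
    have hδA' := hδ'.cod (fun c hc => ((hm ht').hm.mem_pb.1 (hδ'.mem hc)).1) P'.centric.1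
    have hcj : ∀ {P : OrbitPair E H K} {t : S} (δ : S → S), t ∈ s P →
        Cj J x.C x.c ((cj t ∘ P.fn) ∘ δ) → Cj K x.C x.c (P.fn ∘ δ) := fun {P t} δ ht h =>
      (h.mono hJ le_rfl).trans ⟨t⁻¹, inv_mem ((hs P).1 t ht), fun c _ => (cj_inv_cj _ _).symm⟩
    obtain ⟨rfl, y, hy, e⟩ := hX.factor_unique hS hE hH hC' hP hP' hδA hδA' (h1.symm.trans h1')
      ((hcj δ ht h2).symm.trans (hcj δ' ht' h2'))
    obtain ⟨j, hj, e'⟩ := h2.symm.trans h2'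
    have e3 : ∀ c ∈ x.C, cj ((j * t)⁻¹ * (t' * P.fn y)) ((P.fn ∘ δ) c) = (P.fn ∘ δ) c := by
      intro c hc
      have h3 := e' c hc
      simp only [Function.comp_apply] at h3
      rw [e c hc, P.mor.map_cj hy (hδA.mem hc), cj_cj, cj_cj] at h3
      rw [← cj_cj, Function.comp_apply, h3, cj_inv_cj]
    have hjT : j ∈ T := hK (hJ hj)
    -- The element centralizes the image of `C` and so lies in it by centricity. Therefore `t` and
    -- `t'` represent the same double coset.
    have h4 := hC'.mem_img (hδA.comp P.mor) (mul_mem (inv_mem (mul_mem hjT (hK ((hs P).1 t ht))))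
      (mul_mem (hK ((hs P).1 t' ht')) (hK (P.mor.mem hy)))) e3
    obtain ⟨c, hc', e4⟩ := (hδA.comp P.mor).mem_img.1 h4
    have e5 : t' = j * t * P.fn (δ c * y⁻¹) := by
      rw [P.mor.map_mul (hδA.mem hc') (inv_mem hy), P.mor.map_inv hy]
      change P.fn (δ c) = _ at e4
      rw [e4]
      group
    have e6 : t = t' := ((hs P).2 t' ((hs P).1 t' ht')).unique
      ⟨ht, j, hj, _, mul_mem (hδA.mem hc') (inv_mem hy), e5⟩
      ⟨ht', 1, one_mem _, 1, one_mem _, by rw [P.mor.map_one]; simp⟩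
    rw [e6]

theorem sum_sigma_wt (hS : IsPGroup p S) (hE : E.Good) (hEF : E.Sub F)
    (hM : IsCentricMackeyFunctor R F M) (hg : MEnd F (inner H) g) (hH : H ≤ T)
    (hJ : J ≤ K) (hK : K ≤ T) {s : OrbitPair E H K → Finset S}
    (hs : ∀ P, IsDoubleReps J K P.A P.fn (s P)) :
    ∑ P ∈ productReps E H K, ∑ t ∈ s P,
      wt F g J ⟨pb (cj t ∘ P.fn) P.A J, id, fun _ => 1, cj t ∘ P.fn⟩ = Tr F E H g J := by
  refine Eq.trans (Finset.sum_sigma (productReps E H K) s fun i : (_ : OrbitPair E H K) × S =>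
    wt F g J ⟨pb (cj i.2 ∘ i.1.fn) i.1.A J, id, fun _ => 1, cj i.2 ∘ i.1.fn⟩).symm
    (sum_wt_eq_Tr hS hE hEF hM hg hH
      (cover_double hS hE hEF hH hK hJ (isProductReps_productReps E H K) hs) ?_)
  rintro ⟨P, t⟩ hi
  have ht := (hs P).1 t (Finset.mem_sigma.1 hi).2
  have hm : E.Mor (cj t ∘ P.fn) P.A K :=
    P.mor.comp (E.mor_cj (hK ht) hK hK fun c hc => cj_mem ht hc)
  have hle : pb (cj t ∘ P.fn) P.A J ≤ P.A := fun z hz => (hm.hm.mem_pb.1 hz).1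
  exact ⟨rfl, E.mor_id (hle.trans P.le) hH, (hm.restrict hle).cod
    (fun c hc => (hm.hm.mem_pb.1 hc).2) (hJ.trans hK)⟩

/-- Apply the double coset formula to each summand and move the inner restriction past `g`, which
commutes with it. The pairs `(P, t)` index a family that represents `[H ×_E J]`, so the outcome is
the component at `J`. -/
theorem res_mul_Tr (hS : IsPGroup p S) (hE : E.Good) (hEF : E.Sub F)
    (hM : IsCentricMackeyFunctor R F M) (hg : MEnd F (inner H) g) (hH : H ≤ T)
    (hJ : J ≤ K) (hK : K ≤ T) :
    op R F M J K J id id * Tr F E H g K = Tr F E H g J * op R F M J K J id id := by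
  choose s hs using fun P : OrbitPair E H K => exists_isDoubleReps (J := J) P.mor.hm
  have hid : ∀ L : Subgroup S, F.Mor id L L := fun L => F.mor_id le_rfl le_top
  have hJK : F.Mor id J K := F.mor_id hJ le_top
  rw [← sum_sigma_wt hS hE hEF hM hg hH hJ hK hs, Tr, Finset.mul_sum, Finset.sum_mul]
  refine Finset.sum_congr rfl fun P _ => ?_
  have hP := hEF _ _ _ P.mor
  rw [wt_id, ← mul_assoc, ← mul_assoc, op_res_mul hJ hP (hid _) (hs P), Finset.sum_mul,
    Finset.sum_mul, Finset.sum_mul]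
  refine Finset.sum_congr rfl fun t ht => ?_
  have htK := (hs P).1 t ht
  have hm : F.Mor (cj t ∘ P.fn) P.A K :=
    hP.comp (F.mor_cj trivial le_top le_top fun c hc => cj_mem htK hc)
  have hle : pb (cj t ∘ P.fn) P.A J ≤ P.A := fun z hz => (hm.hm.mem_pb.1 hz).1
  have hm' : F.Mor (cj t ∘ P.fn) (pb (cj t ∘ P.fn) P.A J) J :=
    (hm.restrict hle).cod (fun c hc => (hm.hm.mem_pb.1 hc).2) le_top
  rw [wt_id, op_eq_mul hm' (F.mor_id hle le_top), mul_assoc _ _ g,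
    hg.comm ((inner H).mor_id le_rfl (hle.trans P.le)) ((inner H).mor_id hle P.le)]
  simp only [mul_assoc]
  rw [op_mul_of_left_id (hid _) (F.mor_id hle le_top) hP, op_mul_of_left_id (hid _) hm' hJK]
  congr 2
  exact op_congr (hid _) (hP.restrict hle) (Cj.refl _ _ _) ⟨t, htK, fun c _ => rfl⟩

/-- The mirror image of `res_mul_Tr`, with the double coset formula applied on the right of `g`. -/
theorem Tr_mul_ind (hS : IsPGroup p S) (hE : E.Good) (hEF : E.Sub F)
    (hM : IsCentricMackeyFunctor R F M) (hg : MEnd F (inner H) g) (hH : H ≤ T)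
    (hJ : J ≤ K) (hK : K ≤ T) :
    op R F M K J J id id * Tr F E H g J = Tr F E H g K * op R F M K J J id id := by
  choose s hs using fun P : OrbitPair E H K => exists_isDoubleReps (J := J) P.mor.hm
  have hid : ∀ L : Subgroup S, F.Mor id L L := fun L => F.mor_id le_rfl le_top
  have hJK : F.Mor id J K := F.mor_id hJ le_top
  rw [← sum_sigma_wt hS hE hEF hM hg hH hJ hK hs, Tr, Finset.mul_sum, Finset.sum_mul]
  refine Finset.sum_congr rfl fun P _ => ?_
  have hP := hEF _ _ _ P.mor
  rw [wt_id, mul_assoc, op_mul_ind hJ hP (hid _) (hs P), Finset.mul_sum, Finset.mul_sum]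
  refine Finset.sum_congr rfl fun t ht => ?_
  have htK := (hs P).1 t ht
  have hm : F.Mor (cj t ∘ P.fn) P.A K :=
    hP.comp (F.mor_cj trivial le_top le_top fun c hc => cj_mem htK hc)
  have hle : pb (cj t ∘ P.fn) P.A J ≤ P.A := fun z hz => (hm.hm.mem_pb.1 hz).1
  have hm' : F.Mor (cj t ∘ P.fn) (pb (cj t ∘ P.fn) P.A J) J :=
    (hm.restrict hle).cod (fun c hc => (hm.hm.mem_pb.1 hc).2) le_top
  rw [wt_id, op_eq_mul (F.mor_id hle le_top) hm', mul_assoc (op R F M K P.A P.A P.fn id),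
    ← mul_assoc g, ← hg.comm ((inner H).mor_id hle P.le) ((inner H).mor_id le_rfl (hle.trans P.le))]
  simp only [← mul_assoc]
  rw [op_mul_of_right_id hP (F.mor_id hle le_top) (hid _), op_mul_of_right_id hJK hm' (hid _)]
  congr 2
  exact (op_congr (hP.restrict hle) (hid _) ⟨t, htK, fun c _ => rfl⟩ (Cj.refl _ _ _)).symm

/-- By `cover_postcomp` the component at `K` may be computed with the family for `J` composed with
`σ`, and then the terms match one by one. -/
theorem conj_mul_Tr (hS : IsPGroup p S) (hE : E.Good) (hEF : E.Sub F)
    (hM : IsCentricMackeyFunctor R F M) (hg : MEnd F (inner H) g) (hH : H ≤ T)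
    (hσ : E.Mor σ J K) (him : img σ J = K) :
    op R F M K J J σ id * Tr F E H g J = Tr F E H g K * op R F M K J J σ id := by
  have hid : ∀ L : Subgroup S, F.Mor id L L := fun L => F.mor_id le_rfl le_top
  have hσF := hEF _ _ _ hσ
  have hσ' := hσF.finv
  rw [him] at hσ'
  rw [← sum_wt_eq_Tr (L := K) hS hE hEF hM hg hH
    (cover_postcomp hS hE hEF hH hσ him (isProductReps_productReps E H J))
    fun P _ => ⟨rfl, E.mor_id P.le hH, P.mor.comp hσ⟩, Tr, Finset.mul_sum, Finset.sum_mul]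
  refine Finset.sum_congr rfl fun P _ => ?_
  have hP := hEF _ _ _ P.mor
  rw [wt_id, wt_id, ← mul_assoc, ← mul_assoc, op_mul_of_right_id hσF hP (hid _), op_flip' hσF him,
    mul_assoc _ _ (op R F M K J K id (finv σ J)),
    op_mul_of_left_id (hid _) (hP.comp hσF) hσ']
  congr 1
  exact op_congr (hid _) hP (Cj.refl _ _ _) (Cj.of_eq fun c hc => hσF.finv_apply (hP.mem hc))

/-- Transfers are endomorphisms of Mackey functors. -/
theorem trf_mEnd (hS : IsPGroup p S) (hE : E.Good) (hEF : E.Sub F)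
    (hM : IsCentricMackeyFunctor R F M) (hg : MEnd F (inner H) g) (hH : H ≤ T) :
    MEnd F E (trf F E H g) := by
  have hid : ∀ L : Subgroup S, F.Mor id L L := fun L => F.mor_id le_rfl le_top
  -- A generator from the value at `J` to the value at `K` only meets these two components of the
  -- transfer.
  have key : ∀ {J K : Subgroup S} {x : Module.End R M}, J ≤ T → K ≤ T →
      x * op R F M J J J id id = x → op R F M K K K id id * x = x →
      x * Tr F E H g J = Tr F E H g K * x → x * trf F E H g = trf F E H g * x := by
    intro J K x hJ hK h1 h2 h
    conv_lhs => rw [← h1, mul_assoc, one_mul_trf hEF hM hJ, h]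
    conv_rhs => rw [← h2, ← mul_assoc, trf_mul_one hEF hM hK]
  refine MEnd.of_generators hEF (trf_mul_proj hEF) (fun J K hJ hK => ?_) (fun J K hJ hK => ?_)
    fun J K σ hσ him => ?_
  · have hJK : F.Mor id J K := F.mor_id hJ le_top
    exact key (hJ.trans hK) hK (op_mul_one hJK (hid _)) (op_one_mul hJK (hid _))
      (Tr_mul_ind hS hE hEF hM hg hH hJ hK)
  · have hJK : F.Mor id J K := F.mor_id hJ le_top
    exact key hK (hJ.trans hK) (op_mul_one (hid _) hJK) (op_one_mul (hid _) hJK)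
      (res_mul_Tr hS hE hEF hM hg hH hJ hK)
  · have hσF := hEF _ _ _ hσ
    exact key hσ.le_left hσ.le_right (op_mul_one hσF (hid _)) (op_one_mul hσF (hid _))
      (conj_mul_Tr hS hE hEF hM hg hH hσ him)

end TransferEnd

end FusionMackey

namespace FusionMackey

open FusionSystem BisetSemiring

variable {S : Type u} [Group S] [Finite S] {T T' : Subgroup S}
variable {R : Type v} [CommRing R] {F : FusionSystem (⊤ : Subgroup S)}
variable {M : Type w} [AddCommGroup M] [Module R M] [Module (MackeyAlgebra R F) M]
variable [IsScalarTower R (MackeyAlgebra R F) M]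

/-! ## Conjugates of endomorphisms -/

open Classical in
variable (F) in
/-- The conjugate of `g` by the isomorphism `φ : A → φ(A)`. -/
noncomputable def cjEnd (φ : S → S) (A : Subgroup S) (g : Module.End R M) : Module.End R M :=
  ∑ J ∈ Finset.univ.filter (· ≤ img φ A), wt F g J ⟨J, finv φ A, fun _ => 1, id⟩

section Conj

variable {g : Module.End R M} {φ b c : S → S} {A B C H J K L : Subgroup S}

theorem img_finv_img (hφ : F.Mor φ A B) (hL : L ≤ A) : img (finv φ A) (img φ L) = L := by
  have hL' := hφ.img_mono hL
  refine le_antisymm (img_le fun y hy => ?_) fun y hy => ?_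
  · obtain ⟨l, hl, rfl⟩ := (hφ.restrict hL).mem_img.1 hy
    rwa [hφ.finv_apply (hL hl)]
  · rw [← hφ.finv_apply (hL hy)]
    exact mem_img_of_mem (mem_img_of_mem hy)

theorem wt_img (hφ : F.Mor φ A B) (hC : C ≤ A) (hL : F.Mor φ C L) :
    wt F g L ⟨img φ C, finv φ A, b, id⟩ = op R F M L C C φ id * g * op R F M C L C id φ := by
  have hid : ∀ L : Subgroup S, F.Mor id L L := fun L => F.mor_id le_rfl le_top
  have h1 : F.Mor (finv φ A) (img φ C) C := (hφ.finv.restrict (hφ.img_mono hC)).cod (fun y hy => by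
    obtain ⟨l, hl, rfl⟩ := (hφ.restrict hC).mem_img.1 hy
    rwa [hφ.finv_apply (hC hl)]) le_top
  have h2 : F.Mor id (img φ C) L := F.mor_id hL.img_le le_top
  simp only [wt, img_finv_img hφ hC]
  rw [op_eq h2 h1 hL.onto rfl (Cj.refl _ _ _) (Cj.of_eq fun x hx => (hφ.finv_apply (hC hx)).symm),
    op_eq h1 h2 hL.onto rfl (Cj.of_eq fun x hx => (hφ.finv_apply (hC hx)).symm) (Cj.refl _ _ _)]
  rfl

theorem wt_self :
    wt F g J ⟨J, finv φ A, b, id⟩ = op R F M J (img (finv φ A) J) J id (finv φ A) * g *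
      op R F M (img (finv φ A) J) J J (finv φ A) id := rfl

theorem cjEnd_mul_one (hφ : F.Mor φ A B) (hJ : J ≤ img φ A) :
    cjEnd F φ A g * op R F M J J J id id = wt F g J ⟨J, finv φ A, fun _ => 1, id⟩ := by
  classical
  have h : ∀ K ∈ Finset.univ.filter (· ≤ img φ A), wt F g K ⟨K, finv φ A, fun _ => 1, id⟩ *
      op R F M K K K id id = wt F g K ⟨K, finv φ A, fun _ => 1, id⟩ := fun K hK =>
    wt_mul_one (hφ.finv.restrict (Finset.mem_filter.1 hK).2) (F.mor_id le_rfl le_top)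
  have hJ' : J ∈ Finset.univ.filter (· ≤ img φ A) := Finset.mem_filter.2 ⟨Finset.mem_univ _, hJ⟩
  rw [cjEnd, Finset.sum_mul, Finset.sum_eq_single J, h J hJ']
  · intro K hK hne
    rw [← h K hK, mul_assoc, one_mul_one_of_ne hne, mul_zero]
  · exact fun h => absurd hJ' h

theorem one_mul_cjEnd (hφ : F.Mor φ A B) (hJ : J ≤ img φ A) :
    op R F M J J J id id * cjEnd F φ A g = wt F g J ⟨J, finv φ A, fun _ => 1, id⟩ := by
  classical
  have h : ∀ K ∈ Finset.univ.filter (· ≤ img φ A), op R F M K K K id id *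
      wt F g K ⟨K, finv φ A, fun _ => 1, id⟩ = wt F g K ⟨K, finv φ A, fun _ => 1, id⟩ :=
    fun K hK => one_mul_wt (hφ.finv.restrict (Finset.mem_filter.1 hK).2) (F.mor_id le_rfl le_top)
  have hJ' : J ∈ Finset.univ.filter (· ≤ img φ A) := Finset.mem_filter.2 ⟨Finset.mem_univ _, hJ⟩
  rw [cjEnd, Finset.mul_sum, Finset.sum_eq_single J, h J hJ']
  · intro K hK hne
    rw [← h K hK, ← mul_assoc, one_mul_one_of_ne hne.symm, zero_mul]
  · exact fun h => absurd hJ' h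

/-- Conjugating the endomorphism amounts to composing the first leg of the span with `φ⁻¹`;
conjugates enter the calculus of spans in this way. -/
theorem wt_cjEnd (hφ : F.Mor φ A B) (hC : C ≤ img φ A) (hc : F.Mor c C L) :
    wt F (cjEnd F φ A g) L ⟨C, id, b, c⟩ = wt F g L ⟨C, finv φ A, b, c⟩ := by
  have hid : ∀ L : Subgroup S, F.Mor id L L := fun L => F.mor_id le_rfl le_top
  have hf : F.Mor (finv φ A) C (img (finv φ A) C) := (hφ.finv.restrict hC).onto
  rw [wt_id, ← op_one_mul (hid C) hc, mul_assoc, ← mul_assoc (cjEnd F φ A g),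
    cjEnd_mul_one hφ hC, wt, wt]
  dsimp only
  rw [op_eq_mul hc hf, op_eq_mul hf hc]
  simp only [mul_assoc]

/-- `φ⁻¹` carries conjugation by an element of `φ(A)` to conjugation by an element of `A ≤ H`, and
inclusions to inclusions, and `g` commutes with these. -/
theorem cjEnd_mEnd (hφ : F.Mor φ A B) (hA : A ≤ H) (hg : MEnd F (FusionSystem.inner H) g) :
    MEnd F (FusionSystem.inner (img φ A)) (cjEnd F φ A g) := by
  classical
  have hid : ∀ L : Subgroup S, F.Mor id L L := fun L => F.mor_id le_rfl le_top
  have key : ∀ {J K : Subgroup S} {x : Module.End R M}, J ≤ img φ A → K ≤ img φ A →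
      x * op R F M J J J id id = x → op R F M K K K id id * x = x →
      x * wt F g J ⟨J, finv φ A, fun _ => 1, id⟩ = wt F g K ⟨K, finv φ A, fun _ => 1, id⟩ * x →
      x * cjEnd F φ A g = cjEnd F φ A g * x := by
    intro J K x hJ hK h1 h2 h
    conv_lhs => rw [← h1, mul_assoc, one_mul_cjEnd hφ hJ, h]
    conv_rhs => rw [← h2, ← mul_assoc, cjEnd_mul_one hφ hK]
  set ψ := finv φ A with hψ
  have hψI : F.Mor ψ (img φ A) A := hφ.finv
  have hψm : ∀ {J}, J ≤ img φ A → F.Mor ψ J (img ψ J) := fun hJ => (hφ.finv.restrict hJ).onto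
  have hψA : ∀ {J}, J ≤ img φ A → img ψ J ≤ A := fun hJ => (hφ.finv.restrict hJ).img_le
  have hφψ : ∀ {x}, x ∈ img φ A → φ (ψ x) = x := fun hx => hφ.apply_finv hx
  have hψφ : ∀ {x}, x ∈ A → ψ (φ x) = x := fun hx => hφ.finv_apply hx
  have hφm : ∀ {J}, J ≤ img φ A → F.Mor φ (img ψ J) J ∧ img φ (img ψ J) = J := by
    intro J hJ
    have h1 : F.Mor φ (img ψ J) J := (hφ.restrict (hψA hJ)).cod (fun y hy => by
      obtain ⟨x, hx, rfl⟩ := (hψm hJ).mem_img.1 hy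
      rwa [hφψ (hJ hx)]) le_top
    exact ⟨h1, h1.of_isPGroup_card_le (by rw [(hψm hJ).card_img])⟩
  -- Inductions and conjugations both have apex `J` with identity right leg, so one computation
  -- covers them; restrictions are treated separately below.
  have hmor : ∀ J K σ, (FusionSystem.inner (img φ A)).Mor σ J K →
      op R F M K J J σ id * cjEnd F φ A g = cjEnd F φ A g * op R F M K J J σ id := by
    intro J K σ hσ
    have hJ := hσ.le_left
    have hK := hσ.le_right
    have hσF : F.Mor σ J K := inner_sub le_top _ _ _ hσ
    have hσ' := hσ
    obtain ⟨χ, ⟨-, -, t, ht, h⟩, e⟩ := hσ'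
    have hcj : ∀ x ∈ J, σ x = cj t x := fun x hx => by
      rw [← e ⟨x, hx⟩, h]
      rfl
    have htA : ψ t ∈ A := hφ.finv.mem ht
    have hτ : ∀ x ∈ J, cj (ψ t) (ψ x) = ψ (σ x) := fun x hx => by
      rw [hcj x hx, hψI.map_cj ht (hJ hx)]
    have hτm : (FusionSystem.inner H).Mor (cj (ψ t)) (img ψ J) (img ψ K) :=
      (FusionSystem.inner H).mor_cj (hA htA) ((hψA hJ).trans hA) ((hψA hK).trans hA) fun y hy => by
        obtain ⟨x, hx, rfl⟩ := (hψm hJ).mem_img.1 hy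
        rw [hτ x hx]
        exact mem_img_of_mem (hσ.mem hx)
    have hτF : F.Mor (cj (ψ t)) (img ψ J) (img ψ K) := inner_sub le_top _ _ _ hτm
    have hu : op R F M (img ψ K) K K ψ id * op R F M K J J σ id =
        op R F M (img ψ K) (img ψ J) (img ψ J) (cj (ψ t)) id * op R F M (img ψ J) J J ψ id := by
      rw [op_mul_of_right_id (hψm hK) hσF (hid _), op_mul_of_right_id hτF (hψm hJ) (hid _)]
      exact op_congr (hσF.comp (hψm hK)) (hid _) (Cj.of_eq hτ) (Cj.refl _ _ _)
    have hv : op R F M K J J σ id * op R F M J (img ψ J) J id ψ =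
        op R F M K (img ψ K) K id ψ *
          op R F M (img ψ K) (img ψ J) (img ψ J) (cj (ψ t)) id := by
      rw [op_mul_of_right_id hσF (hid _) (hψm hJ), op_eq (hid K) (hψm hK) (hφm hK).1 (hφm hK).2
        (α' := φ) (β' := id) (Cj.refl _ _ _) (Cj.of_eq fun y hy => (hψφ (hψA hK hy)).symm),
        op_mul_of_right_id (hφm hK).1 hτF (hid _), op_eq (hτF.comp (hφm hK).1) (hid _) (hψm hJ) rfl
        (α' := σ ∘ id) (β' := ψ) (Cj.of_eq fun x hx => ?_) (Cj.refl _ _ _)]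
      simp only [Function.comp_apply, id]
      rw [hτ x hx, hφψ (hK (hσ.mem hx))]
    refine key hJ hK (op_mul_one hσF (hid _)) (op_one_mul hσF (hid _)) ?_
    rw [wt_self, wt_self, ← hψ, mul_assoc _ _ (op R F M K J J σ id), hu, ← mul_assoc,
      ← mul_assoc, hv, mul_assoc _ _ g, hg.comm hτm ((FusionSystem.inner H).mor_id le_rfl ((hψA hJ).trans hA))]
    simp only [mul_assoc]
  refine MEnd.of_generators (inner_sub le_top) ?_
    (fun J K hJ hK => hmor J K id ((FusionSystem.inner _).mor_id hJ hK)) (fun J K hJK hK => ?_)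
    fun J K σ hσ _ => hmor J K σ hσ
  · rw [cjEnd, Finset.sum_mul]
    refine Finset.sum_congr rfl fun J hJ => ?_
    have hJ := (Finset.mem_filter.1 hJ).2
    have := wt_mul_one (g := g) (x := ⟨J, finv φ A, fun _ => 1, id⟩) (hφ.finv.restrict hJ) (hid J)
    rw [← this, mul_assoc, one_mul_proj hJ]
  · have hJ := hJK.trans hK
    have hi : F.Mor id J K := F.mor_id hJK le_top
    have hle : img ψ J ≤ img ψ K := (hψm hK).img_mono hJK
    have hi' : F.Mor id (img ψ J) (img ψ K) := F.mor_id hle le_top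
    have hv : op R F M J K J id id * op R F M K (img ψ K) K id ψ =
        op R F M J (img ψ J) J id ψ * op R F M (img ψ J) (img ψ K) (img ψ J) id id := by
      rw [op_mul_of_left_id (hid _) hi (hψm hK), op_mul_of_left_id (hid _) (hψm hJ) hi']
      rfl
    have hu : op R F M (img ψ J) (img ψ K) (img ψ J) id id * op R F M (img ψ K) K K ψ id =
        op R F M (img ψ J) J J ψ id * op R F M J K J id id := by
      rw [op_mul_of_right_id (hψm hJ) (hid _) hi, op_eq (hψm hK) (hid _) (hφm hK).1 (hφm hK).2
        (α' := id) (β' := φ) (Cj.of_eq fun y hy => (hψφ (hψA hK hy)).symm) (Cj.refl _ _ _),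
        op_mul_of_left_id (hid _) hi' (hφm hK).1]
      refine (op_eq (hψm hJ) hi (hφm hJ).1 (hφm hJ).2
        (Cj.of_eq fun y hy => (hψφ (hψA hJ hy)).symm) (Cj.refl _ _ _)).symm
    refine key hK hJ (op_mul_one (hid _) hi) (op_one_mul (hid _) hi) ?_
    rw [wt_self, wt_self, ← hψ, mul_assoc _ _ (op R F M J K J id id), ← hu, ← mul_assoc,
      ← mul_assoc, hv, mul_assoc _ _ g, hg.comm ((FusionSystem.inner H).mor_id le_rfl ((hψA hJ).trans hA))
        ((FusionSystem.inner H).mor_id hle ((hψA hK).trans hA))]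
    simp only [mul_assoc]

/-- `conjEnd` sums over the centric subgroups of `A` only, `cjEnd` over all subgroups of the image.
The additional terms have a noncentric apex and vanish. -/
theorem extend_conjEnd (hM : IsCentricMackeyFunctor R F M) {E : FusionSystem T} (hE : E.Sub F)
    (P : OrbitPair E H K) (f : Module.End R (down R F M P.A)) :
    extend R F (conjEnd R F P.φ P.injective f) =
      proj R F M P.im * cjEnd F P.fn P.A (extend R F f) * proj R F M P.im := by
  classical
  have hid : ∀ L : Subgroup S, F.Mor id L L := fun L => F.mor_id le_rfl le_top
  have hP := hE _ _ _ P.mor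
  have key : (∑ L : {L : Subgroup S // L ≤ P.A ∧ F.IsCentric L},
      let ψ : L.1 →* K := P.φ.comp (Subgroup.inclusion L.2.1)
      let e : L.1 ≃* FusionSystem.im ψ :=
        FusionSystem.isoIm ψ (P.injective.comp (Subgroup.inclusion_injective L.2.1))
      act R F M (conj e) ∘ₗ extend R F f ∘ₗ act R F M (conj e.symm) ∘ₗ
        act R F M (ind (le_refl (FusionSystem.im ψ)))) = cjEnd F P.fn P.A (extend R F f) := by
    refine Finset.sum_of_injOn (fun L => img P.fn L.1) ?_ ?_ ?_ ?_
    · intro L _ L' _ h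
      have := congrArg (img (finv P.fn P.A)) h
      dsimp only at this
      rw [img_finv_img hP L.2.1, img_finv_img hP L'.2.1] at this
      exact Subtype.ext this
    · intro L _
      exact Finset.mem_coe.2 (Finset.mem_filter.2 ⟨Finset.mem_univ _, hP.img_mono L.2.1⟩)
    · intro J hJ hJ'
      have hJ := (Finset.mem_filter.1 hJ).2
      have hm := hP.finv.restrict hJ
      refine wt_eq_zero hM hm (hid J) fun hc => hJ' ⟨⟨img (finv P.fn P.A) J, hm.img_le, hc.img hm⟩,
        Finset.mem_coe.2 (Finset.mem_univ _), ?_⟩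
      have h := img_finv_img hP.finv hJ
      refine le_antisymm (img_le fun y hy => ?_) fun y hy => ?_
      · obtain ⟨x, hx, rfl⟩ := hm.mem_img.1 hy
        rwa [hP.apply_finv (hJ hx)]
      · rw [← hP.apply_finv (hJ hy)]
        exact mem_img_of_mem (mem_img_of_mem hy)
    · intro L _
      have hL := hP.restrict L.2.1
      dsimp only
      set ψ : L.1 →* K := P.φ.comp (Subgroup.inclusion L.2.1) with hψ
      set e : L.1 ≃* FusionSystem.im ψ :=
        FusionSystem.isoIm ψ (P.injective.comp (Subgroup.inclusion_injective L.2.1)) with he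
      have him : FusionSystem.im ψ = img P.fn L.1 := by
        refine le_antisymm ?_ (img_le fun x hx => ⟨⟨x, hx⟩, ?_⟩)
        · rintro _ ⟨x, rfl⟩
          have : ((P.φ (Subgroup.inclusion L.2.1 x) : K) : S) = P.fn x := by rw [P.fn_apply]; rfl
          change ((P.φ (Subgroup.inclusion L.2.1 x) : K) : S) ∈ _
          rw [this]
          exact mem_img_of_mem x.2
        · change ((P.φ (Subgroup.inclusion L.2.1 ⟨x, hx⟩) : K) : S) = P.fn x
          exact (P.fn_apply (L.2.1 hx)).symm
      have hL' : F.Mor P.fn L.1 (FusionSystem.im ψ) := by rw [him]; exact hL.onto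
      have hef : ∀ x : L.1, (e x : S) = P.fn x := fun x => by
        exact (P.fn_apply (L.2.1 x.2)).symm
      have hes : ∀ y : FusionSystem.im ψ, (e.symm y : S) = finv P.fn L.1 y := by
        intro y
        have : (y : S) = P.fn (e.symm y) := by rw [← hef, e.apply_symm_apply]
        rw [this, hL.finv_apply (e.symm y).2]
      rw [ind_eq_sp, conj_eq_sp e hef, conj_eq_sp e.symm hes, ← him]
      have h3 := wt_img (g := extend R F f) (b := fun _ => 1) hP L.2.1 hL'
      rw [← him] at h3
      rw [h3]
      change op R F M _ L.1 L.1 P.fn id * (extend R F f *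
        (op R F M L.1 _ _ (finv P.fn L.1) id * op R F M _ _ _ id id)) = _
      rw [← op_flip hL' him.symm, op_mul_one (hid _) hL', mul_assoc]
  rw [conjEnd, extend_compress]
  refine congrArg (fun x => proj R F M P.im * x * proj R F M P.im) ?_
  exact key

end Conj

end FusionMackey

namespace FusionMackey

open FusionSystem BisetSemiring

variable {S : Type u} [Group S] [Finite S] {T T' : Subgroup S}
variable {R : Type v} [CommRing R] {F : FusionSystem (⊤ : Subgroup S)}
variable {M : Type w} [AddCommGroup M] [Module R M] [Module (MackeyAlgebra R F) M]
variable [IsScalarTower R (MackeyAlgebra R F) M]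

/-! ## Products of transfers -/

section Product

variable {p : ℕ} [Fact p.Prime] {E : FusionSystem T} {E' : FusionSystem T'}
  {g g' : Module.End R M} {H K L J : Subgroup S} {σ φ : S → S}

theorem mEnd_proj (hE : E.Sub F) : MEnd F E (proj R F M T) := by
  refine ⟨fun a ha => ?_, (proj_mul_proj le_rfl).1⟩
  have ha' := mackeySemiring_mono hE ha
  rw [proj, ← act_mul R F M (idUpTo_mem T) ha', ← act_mul R F M ha' (idUpTo_mem T),
    (idUpTo_mul_of_mem ha).1, (idUpTo_mul_of_mem ha).2]

/-- By `wt_proj` the leg to `H` is irrelevant, and reparametrizing along `φ` leaves restriction to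
the image followed by induction from it. -/
theorem Tr_proj (hE : E.Sub F) : Tr F E H (proj R F M H) L = ∑ Q ∈ productReps E H L,
    op R F M L Q.im Q.im id id * op R F M Q.im L Q.im id id := by
  refine Finset.sum_congr rfl fun Q _ => ?_
  have hid : ∀ L : Subgroup S, F.Mor id L L := fun L => F.mor_id le_rfl le_top
  have hQ := hE _ _ _ Q.mor
  have hi : F.Mor id Q.im L := F.mor_id Q.im_le le_top
  have hQ' : F.Mor Q.fn Q.A Q.im := by
    rw [Q.im_eq]
    exact hQ.onto
  rw [wt_proj (x := ⟨Q.A, id, fun _ => 1, Q.fn⟩) (F.mor_id Q.le le_top) hQ,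
    op_mul_of_right_id hQ (hid _) hQ, op_mul_of_right_id hi (hid _) hi]
  exact (op_eq hi hi hQ' Q.im_eq.symm (Cj.refl _ _ _) (Cj.refl _ _ _)).symm

theorem wt_im (hE : E.Sub F) {I : Subgroup S} (hI : I ≤ L)
    (P : OrbitPair E H I) {b : S → S} :
    wt F g L ⟨P.im, finv P.fn P.A, b, id⟩ =
      op R F M L I I id id * wt F g I ⟨P.A, id, fun _ => 1, P.fn⟩ * op R F M I L I id id := by
  have hid : ∀ L : Subgroup S, F.Mor id L L := fun L => F.mor_id le_rfl le_top
  have hP := hE _ _ _ P.mor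
  have hi : F.Mor id I L := F.mor_id hI le_top
  rw [P.im_eq, wt_img hP le_rfl (hP.comp hi), wt_id, ← mul_assoc, ← mul_assoc,
    op_mul_of_right_id hi hP (hid _), mul_assoc _ _ (op R F M I L I id id),
    op_mul_of_left_id (hid _) hP hi]
  rfl

/-- The composite of the action of the class of `K` with a transfer. -/
theorem trf_proj_mul_trf (hS : IsPGroup p S) (hE : E.Good) (hE' : E'.Good) (hEE' : E.Sub E')
    (hE'F : E'.Sub F) (hM : IsCentricMackeyFunctor R F M) (hg : MEnd F (FusionSystem.inner H) g)
    (hH : H ≤ T') (hK : K ≤ T) {X : Finset (OrbitPair E' H K)} (hX : IsProductReps E' H K X) :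
    trf F E K (proj R F M K) * trf F E' H g * proj R F M T =
      ∑ P ∈ X, trf F E P.im (cjEnd F P.fn P.A g) := by
  have hEF : E.Sub F := fun _ _ _ h => hE'F _ _ _ (hEE' _ _ _ h)
  have hT := hEE'.le
  have e1 : ∑ P ∈ X, trf F E P.im (cjEnd F P.fn P.A g) =
      (∑ P ∈ X, trf F E P.im (cjEnd F P.fn P.A g)) * proj R F M T := by
    rw [Finset.sum_mul]
    exact Finset.sum_congr rfl fun P _ => (trf_mul_proj hEF).symm
  rw [e1]
  refine mul_proj_eq_of_mul_one fun L hL => ?_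
  -- At `L` the class of `K` acts by inductions and restrictions over `[K ×_E L]`. Restriction to
  -- `Q.im` commutes with the inner transfer, which then expands over the product of `H` with
  -- `Q.im`.
  have h1 : trf F E K (proj R F M K) * trf F E' H g * op R F M L L L id id =
      ∑ i ∈ (productReps E K L).sigma fun Q => productReps E' H Q.im,
        wt F g L ⟨i.2.im, finv i.2.fn i.2.A, finv i.1.fn i.1.A, id⟩ := by
    rw [mul_assoc, trf_mul_one hE'F hM (hL.trans hT), ← one_mul_Tr hE'F, ← mul_assoc,
      trf_mul_one hEF hM hL, Tr_proj hEF, Finset.sum_mul, Finset.sum_sigma]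
    refine Finset.sum_congr rfl fun Q _ => ?_
    rw [mul_assoc, res_mul_Tr hS hE' hE'F hM hg hH Q.im_le (hL.trans hT), Tr, Finset.sum_mul,
      Finset.mul_sum]
    refine Finset.sum_congr rfl fun P _ => ?_
    rw [wt_im hE'F Q.im_le P, mul_assoc]
  -- The other order of expansion: first the product of `H` with `K` in `E'`, then the product of
  -- `P.im` with `L` in `E`.
  have h2 : (∑ P ∈ X, trf F E P.im (cjEnd F P.fn P.A g)) * op R F M L L L id id =
      ∑ i ∈ X.sigma fun P => productReps E P.im L,
        wt F g L ⟨i.2.A, finv i.1.fn i.1.A, id, i.2.fn⟩ := by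
    rw [Finset.sum_mul, Finset.sum_sigma]
    refine Finset.sum_congr rfl fun P _ => ?_
    rw [trf_mul_one hEF hM hL, Tr]
    refine Finset.sum_congr rfl fun Q _ => ?_
    exact wt_cjEnd (hE'F _ _ _ P.mor) (Q.le.trans P.im_eq.le) (hEF _ _ _ Q.mor)
  rw [h1, h2]
  have hm : ∀ P : OrbitPair E' H K, E'.Mor (finv P.fn P.A) P.im H := fun P => by
    have := P.mor.finv
    rw [← P.im_eq] at this
    exact this.cod (fun a ha => P.le (this.mem ha)) hH
  have hl : ∀ (Q : OrbitPair E K L) (P : OrbitPair E' H Q.im),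
      E'.Mor (finv P.fn P.A) P.im H ∧ E.Mor (finv Q.fn Q.A) P.im K ∧ E.Mor id P.im L := by
    intro Q P
    have h3 := P.mor.finv
    rw [← P.im_eq] at h3
    have h4 := Q.mor.finv
    rw [← Q.im_eq] at h4
    exact ⟨h3.cod (fun a ha => P.le (h3.mem ha)) hH,
      (h4.cod (fun a ha => Q.le (h4.mem ha)) hK).restrict P.im_le,
      E.mor_id (P.im_le.trans Q.im_le) hL⟩
  refine sum_wt_eq_of_cover (Ok := Ok3 F E' E H K L) hEF hE'F hM hg
    (fun x hx => ⟨hx.1, hx.2.2.1.le_left, hx.2.1, hx.2.2.2⟩)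
    (cover_left hS hE hE' hEE' hE'F hH hK (isProductReps_productReps E K L)
      (fun Q => isProductReps_productReps E' H Q.im))
    (cover_right hS hE hE' hEE' hE'F hH hK hX (fun P => isProductReps_productReps E P.im L))
    ?_ ?_ ?_ ?_
  · rintro ⟨Q, P⟩ -
    exact ⟨(hl Q P).1, (hl Q P).2.2⟩
  · rintro ⟨P, Q⟩ -
    exact ⟨(hm P).restrict Q.le, Q.mor⟩
  · rintro ⟨Q, P⟩ - hc
    exact ⟨hc, hl Q P⟩
  · rintro ⟨P, Q⟩ - hc
    exact ⟨hc, (hm P).restrict Q.le, E.mor_id (Q.le.trans P.im_le) hK, Q.mor⟩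

theorem trf_eq_of_wt (h : ∀ L, ∀ P : OrbitPair E H L,
    wt F g L ⟨P.A, id, fun _ => 1, P.fn⟩ = wt F g' L ⟨P.A, id, fun _ => 1, P.fn⟩) :
    trf F E H g = trf F E H g' :=
  Finset.sum_congr rfl fun L _ => Finset.sum_congr rfl fun P _ => h L P

theorem trf_cjEnd_proj {E₀ : FusionSystem T'} (hE : E.Sub F) (hE₀ : E₀.Sub F)
    (P : OrbitPair E₀ H K) :
    trf F E P.im (cjEnd F P.fn P.A (proj R F M H)) = trf F E P.im (proj R F M P.im) := by
  refine trf_eq_of_wt fun L Q => ?_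
  have hP := hE₀ _ _ _ P.mor
  have hQ := hE _ _ _ Q.mor
  have hle := Q.le.trans P.im_eq.le
  have h1 : F.Mor (finv P.fn P.A) Q.A H := (hP.finv.restrict hle).cod
    (fun x hx => P.le (hP.finv.mem (hle hx))) le_top
  rw [wt_cjEnd hP hle hQ, wt_proj (x := ⟨Q.A, finv P.fn P.A, fun _ => 1, Q.fn⟩) h1 hQ,
    wt_proj (x := ⟨Q.A, id, fun _ => 1, Q.fn⟩) (F.mor_id Q.le le_top) hQ]

theorem Tr_eq_sum_iso (hS : IsPGroup p S) (hE : E.Good) (hEF : E.Sub F)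
    (hM : IsCentricMackeyFunctor R F M) (hg : MEnd F (FusionSystem.inner H) g)
    (hσ : E.Mor σ H K) (him : img σ H = K) :
    ∑ P ∈ productReps E K L, wt F g L ⟨P.A, finv σ H, fun _ => 1, P.fn⟩ = Tr F E H g L := by
  have h := hσ.finv
  rw [him] at h
  exact sum_wt_eq_Tr hS hE hEF hM hg hσ.le_left
    ((isProductReps_productReps E K L).cover hS hE hEF hσ him)
    fun P _ => ⟨rfl, h.restrict P.le, P.mor⟩

theorem trf_proj_congr (hS : IsPGroup p S) (hE : E.Good) (hEF : E.Sub F)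
    (hM : IsCentricMackeyFunctor R F M) (h : E.IsIso H K) :
    trf F E H (proj R F M H) = trf F E K (proj R F M K) := by
  obtain ⟨σ, hσ, him⟩ := isIso_iff_mor.1 h
  refine Finset.sum_congr rfl fun L _ => ?_
  rw [← Tr_eq_sum_iso hS hE hEF hM (mEnd_proj (inner_sub le_top)) hσ him, Tr]
  refine Finset.sum_congr rfl fun P _ => ?_
  have h := hσ.finv
  rw [him] at h
  rw [wt_proj (x := ⟨P.A, finv σ H, fun _ => 1, P.fn⟩) (hEF _ _ _ (h.restrict P.le))
    (hEF _ _ _ P.mor), wt_proj (x := ⟨P.A, id, fun _ => 1, P.fn⟩) (F.mor_id P.le le_top)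
    (hEF _ _ _ P.mor)]

/-- The transfers of an endomorphism and of its conjugate by an isomorphism of `E` are equal. -/
theorem trf_cjEnd (hS : IsPGroup p S) (hE : E.Good) (hEF : E.Sub F)
    (hM : IsCentricMackeyFunctor R F M) (hg : MEnd F (FusionSystem.inner H) g)
    (hσ : E.Mor σ H K) (him : img σ H = K) : trf F E K (cjEnd F σ H g) = trf F E H g := by
  refine Finset.sum_congr rfl fun L _ => ?_
  rw [← Tr_eq_sum_iso hS hE hEF hM hg hσ him, Tr]
  refine Finset.sum_congr rfl fun P _ => ?_
  exact wt_cjEnd (hEF _ _ _ hσ) (P.le.trans him.ge) (hEF _ _ _ P.mor)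

/-- Transfers are linear over the endomorphisms of the restriction to `E`. -/
theorem trf_mul (hg : MEnd F E g) :
    trf F E H (g * g') = g * trf F E H g' := by
  rw [trf, trf, Finset.mul_sum]
  refine Finset.sum_congr rfl fun L _ => ?_
  rw [Tr, Tr, Finset.mul_sum]
  refine Finset.sum_congr rfl fun P _ => ?_
  rw [wt_id, wt_id, ← mul_assoc, ← mul_assoc, ← mul_assoc,
    hg.comm P.mor (E.mor_id le_rfl P.centric.1)]

theorem trf_sum {ι : Type*} (s : Finset ι) (g : ι → Module.End R M) :
    trf F E H (∑ i ∈ s, g i) = ∑ i ∈ s, trf F E H (g i) := by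
  simp only [trf, Tr, wt_sum]
  exact (Finset.sum_congr rfl fun L _ => Finset.sum_comm).trans Finset.sum_comm

end Product

/-! ## The action of the centric Burnside ring -/

section Burnside

variable {p : ℕ} [Fact p.Prime] {E : FusionSystem T} {H K L : Subgroup S}

variable (F M) in
/-- The action of the centric Burnside ring. -/
noncomputable def bact (E : FusionSystem T) : CentricBurnside R E →ₗ[R] Module.End R M :=
  Finsupp.linearCombination R fun a => trf F E a.rep (proj R F M a.rep)

theorem extend_burnsideAct (hE : E.Sub F) (u : CentricBurnside R E) :
    extend R F (burnsideAct R F M E u) = bact F M E u := by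
  rw [burnsideAct, Finsupp.sum, extend_sum, bact, Finsupp.linearCombination_apply, Finsupp.sum]
  refine Finset.sum_congr rfl fun a _ => ?_
  rw [extend_smul, extend_transfer hE, extend_id]

theorem mEnd_bact (hS : IsPGroup p S) (hE : E.Good) (hEF : E.Sub F)
    (hM : IsCentricMackeyFunctor R F M) (u : CentricBurnside R E) : MEnd F E (bact F M E u) := by
  rw [bact, Finsupp.linearCombination_apply, Finsupp.sum]
  exact MEnd.sum fun a _ => (trf_mEnd hS hE hEF hM (mEnd_proj (inner_sub le_top))
    a.rep_centric.1).smul _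

theorem bact_single (a : CentricClass E) :
    bact F M E (Finsupp.single a (1 : R)) = trf F E a.rep (proj R F M a.rep) := by
  rw [bact, Finsupp.linearCombination_single, one_smul]

theorem bact_mk (hS : IsPGroup p S) (hE : E.Good) (hEF : E.Sub F)
    (hM : IsCentricMackeyFunctor R F M) (hK : E.IsCentric K) :
    bact F M E (Finsupp.single (CentricClass.mk K hK) (1 : R)) = trf F E K (proj R F M K) := by
  rw [bact_single, trf_proj_congr hS hE hEF hM (CentricClass.rep_mk hK)]

/-- On basis elements this is `trf_proj_mul_trf` with `E' = E`, applied to the identity. The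
reversed order of the factors is harmless, as the ring is commutative. -/
theorem bact_burnsideBilin (hS : IsPGroup p S) (hE : E.Good) (hEF : E.Sub F)
    (hM : IsCentricMackeyFunctor R F M) (x y : CentricBurnside R E) :
    bact F M E (burnsideBilin R E x y) = bact F M E y * bact F M E x := by
  have h : (burnsideBilin R E).compr₂ (bact F M E) =
      ((LinearMap.mul R (Module.End R M)).compl₁₂ (bact F M E) (bact F M E)).flip := by
    ext a b : 4
    simp only [LinearMap.comp_apply, Finsupp.lsingle_apply, LinearMap.flip_apply,
      LinearMap.compr₂_apply, LinearMap.compl₁₂_apply, LinearMap.mul_apply']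
    rw [burnsideBilin_single, bact_single, bact_single, ← trf_mul_proj (H := a.rep) hEF,
      ← mul_assoc, trf_proj_mul_trf hS hE hE (Sub.refl E) hEF hM (mEnd_proj (inner_sub le_top))
        a.rep_centric.1 b.rep_centric.1 (isProductReps_productReps E a.rep b.rep), classMul, map_sum]
    refine Finset.sum_congr rfl fun P _ => ?_
    rw [bact_mk hS hE hEF hM, trf_cjEnd_proj hEF hEF, trf_proj_congr hS hE hEF hM P.isIso_im]
  exact LinearMap.congr_fun₂ h x y

variable {R : Type v} [CommRing R] {M : Type w} [AddCommGroup M] [Module R M]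
  [Module (MackeyAlgebra R F) M] [IsScalarTower R (MackeyAlgebra R F) M]

/-- The triangular argument of `burnsideBilin_top_surjective`, carried out in `End_R(M)` by
induction on the order of `L`: at `L` the class of `T` acts as a unit multiple of the identity plus
maps through smaller subgroups. -/
theorem exists_one_eq_mul (hS : IsPGroup p S) (hE : E.Good) (hEF : E.Sub F)
    (hstar : E.Star p T) (hR : IsPLocalRing p R) (hM : IsCentricMackeyFunctor R F M) (hL : L ≤ T) :
    ∃ y, op R F M L L L id id = trf F E T (proj R F M T) * y := by
  classical
  have hid : ∀ L : Subgroup S, F.Mor id L L := fun L => F.mor_id le_rfl le_top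
  have key : ∀ n, ∀ L ≤ T, Nat.card L = n →
      ∃ y, op R F M L L L id id = trf F E T (proj R F M T) * y := by
    intro n
    induction n using Nat.strong_induction_on with
    | _ n ih =>
      rintro L hL rfl
      by_cases hc : E.IsCentric L
      swap
      · exact ⟨0, by rw [one_eq_zero hM fun h => hc (hEF.centric h hL), mul_zero]⟩
      have hX := isProductReps_productReps E T L
      have h1 := trf_mul_one (g := proj R F M T) (H := T) hEF hM hL
      rw [Tr_proj hEF, ← Finset.sum_filter_add_sum_filter_not _ (fun P => P.im = L)] at h1
      have h2 : ∑ Q ∈ (productReps E T L).filter (fun P => P.im = L),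
          op R F M L Q.im Q.im id id * op R F M Q.im L Q.im id id =
          (Nat.card (RepTop E L) : R) • op R F M L L L id id := by
        rw [← hX.card_filter_im hS hE hc, Nat.cast_smul_eq_nsmul, ← Finset.sum_const]
        refine Finset.sum_congr rfl fun P hP => ?_
        rw [(Finset.mem_filter.1 hP).2, op_one_mul (hid _) (hid _)]
      have h3 : ∀ Q ∈ (productReps E T L).filter (fun P => ¬P.im = L),
          ∃ y, op R F M L Q.im Q.im id id * op R F M Q.im L Q.im id id =
            trf F E T (proj R F M T) * y := by
        intro Q hQ
        have hi : E.Mor id Q.im L := E.mor_id Q.im_le hL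
        have hiF := hEF _ _ _ hi
        obtain ⟨y, hy⟩ := ih (Nat.card Q.im) (by
          by_contra hcon
          exact (Finset.mem_filter.1 hQ).2 (Subgroup.eq_of_le_of_card_ge Q.im_le (not_lt.1 hcon)))
          Q.im (Q.im_le.trans hL) rfl
        refine ⟨op R F M L Q.im Q.im id id * y * op R F M Q.im L Q.im id id, ?_⟩
        have hT := trf_mEnd hS hE hEF hM (mEnd_proj (R := R) (M := M) (F := F)
          (E := FusionSystem.inner T) (inner_sub le_top)) le_rfl
        -- The action of the class commutes with induction from `Q.im`, so it can be brought to the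
        -- front.
        rw [← mul_assoc, ← mul_assoc, ← hT.comm hi (E.mor_id le_rfl hi.le_left), mul_assoc _ _ y,
          ← hy, op_mul_one hiF (hid _)]
      choose! y hy using h3
      rw [h2, Finset.sum_congr rfl hy, ← Finset.mul_sum] at h1
      obtain ⟨c, hc'⟩ := hR.isUnit_natCast (card_repTop hS hE hstar hc)
      rw [← hc'] at h1
      refine ⟨(↑c⁻¹ : R) • (op R F M L L L id id -
        ∑ Q ∈ (productReps E T L).filter (fun P => ¬P.im = L), y Q), ?_⟩
      rw [mul_smul_comm, mul_sub, h1, add_sub_cancel_right, smul_smul, Units.inv_mul, one_smul]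
  exact key _ L hL rfl

/-- The product of `u` and the class of `T` acts as the ring identity `e`, and the point is that `e`
acts as the identity of the restriction of `M`. It fixes the image of the class of `T`, which
contains all the values at `L ≤ T` by `exists_one_eq_mul`. -/
theorem bact_mul_trf (hS : IsPGroup p S) (hE : E.Good) (hEF : E.Sub F) (hstar : E.Star p T)
    (hR : IsPLocalRing p R) (hM : IsCentricMackeyFunctor R F M) {u : CentricBurnside R E}
    (hu : IsBurnsideInverse (burnsideTop R E) u) :
    bact F M E u * trf F E T (proj R F M T) = proj R F M T := by
  classical
  have htop : bact F M E (burnsideTop R E) = trf F E T (proj R F M T) :=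
    bact_mk hS hE hEF hM (isCentric_self E)
  obtain ⟨e, he, h1, -⟩ := hu
  have h2 := (he (burnsideTop R E)).2
  rw [burnsideMul_eq] at h1 h2
  have h3 := congrArg (bact F M E) h1
  have h4 := congrArg (bact F M E) h2
  rw [bact_burnsideBilin hS hE hEF hM, htop] at h3 h4
  rw [h3, ← (mEnd_bact hS hE hEF hM e).2, ← one_mul (proj R F M T)]
  refine mul_proj_eq_of_mul_one fun L hL => ?_
  obtain ⟨y, hy⟩ := exists_one_eq_mul hS hE hEF hstar hR hM hL
  rw [hy, ← mul_assoc, h4, one_mul]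

end Burnside

end FusionMackey

namespace FusionMackey

open FusionSystem BisetSemiring

variable {S : Type u} [Group S] [Finite S] {T : Subgroup S}
variable {R : Type v} [CommRing R] {F : FusionSystem (⊤ : Subgroup S)}
variable {M : Type w} [AddCommGroup M] [Module R M] [Module (MackeyAlgebra R F) M]
variable [IsScalarTower R (MackeyAlgebra R F) M]

/-! ## The transfer from a fully normalized centric subgroup -/

/-! ### The endomorphisms `f_K`. -/

section Twisted

variable {E : FusionSystem T} {g : Module.End R M} {φ : S → S} {A B H K : Subgroup S}

/-- Only the values of `g` at subgroups of `A` enter the conjugate. -/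
theorem cjEnd_restrict (hφ : F.Mor φ A B) :
    cjEnd F φ A (proj R F M A * g * proj R F M A) = cjEnd F φ A g := by
  classical
  refine Finset.sum_congr rfl fun J hJ => ?_
  have hJ := (Finset.mem_filter.1 hJ).2
  have hid : ∀ L : Subgroup S, F.Mor id L L := fun L => F.mor_id le_rfl le_top
  have hm := hφ.finv.restrict hJ
  rw [wt_self, wt_self, ← mul_assoc, ← mul_assoc, op_mul_proj (hid J) hm.onto hm.img_le,
    mul_assoc _ (proj R F M A), proj_mul_op hm.onto (hid J) hm.img_le]

theorem mEnd_mul_cjEnd (hEF : E.Sub F) (hg : MEnd F (FusionSystem.inner H) g)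
    {h : Module.End R M} (hh : MEnd F E h) (hT : K ≤ T) (P : OrbitPair F H K) :
    MEnd F (FusionSystem.inner P.im) (h * cjEnd F P.fn P.A g) := by
  have h1 := cjEnd_mEnd P.mor P.le hg
  rw [← P.im_eq] at h1
  have h2 := (hh.restrict (inner_sub (P.im_le.trans hT)) hEF).mul h1
  rwa [mul_assoc, h1.proj_mul] at h2

/-- The projections inserted by the successive restrictions are absorbed: the conjugate lives on the
values at subgroups of the image, and `h` preserves these values. -/
theorem extend_twisted (hEF : E.Sub F) (hM : IsCentricMackeyFunctor R F M)
    {f : Module.End R (down R F M H)} (hf : MEnd F (FusionSystem.inner H) (extend R F f))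
    {h : Module.End R (down R F M T)} (hh : MEnd F E (extend R F h)) (P : OrbitPair F H T) :
    extend R F (restrictEnd R F P.im
      (restrictEnd R F P.im h ∘ₗ conjEnd R F P.φ P.injective (restrictEnd R F P.A f))) =
      extend R F h * cjEnd F P.fn P.A (extend R F f) := by
  have h1 := cjEnd_mEnd P.mor P.le hf
  rw [← P.im_eq] at h1
  have h2 := hh.restrict (inner_sub P.im_le) hEF
  have h3 := mEnd_mul_cjEnd hEF hf hh le_rfl P
  have e1 : extend R F (T := P.im) (conjEnd R F P.φ P.injective (restrictEnd R F P.A f)) =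
      cjEnd F P.fn P.A (extend R F f) := by
    refine (extend_conjEnd hM (Sub.refl F) P _).trans ?_
    rw [extend_restrictEnd, cjEnd_restrict P.mor, h1.proj_mul, h1.2]
  have e2 := extend_comp (restrictEnd R F P.im h)
    (conjEnd R F P.φ P.injective (restrictEnd R F P.A f) : Module.End R (down R F M P.im))
  rw [e1, extend_restrictEnd, mul_assoc (proj R F M P.im), h2.proj_mul, mul_assoc,
    h1.proj_mul] at e2
  rw [extend_restrictEnd]
  refine (congrArg (fun x => proj R F M P.im * x * proj R F M P.im) e2).trans ?_
  rw [h3.proj_mul, h3.2]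

theorem extend_twistedConj (hEF : E.Sub F) (hM : IsCentricMackeyFunctor R F M)
    {f : Module.End R (down R F M H)} (hf : MEnd F (FusionSystem.inner H) (extend R F f))
    {h : Module.End R (down R F M T)} (hh : MEnd F E (extend R F h))
    [DecidableEq (Subgroup S)] (X : Finset (OrbitPair F H T)) (K : Subgroup S) :
    extend R F (twistedConj R F X h f K) =
      ∑ P ∈ X.filter (fun P => P.im = K), extend R F h * cjEnd F P.fn P.A (extend R F f) := by
  rw [twistedConj, extend_sum]
  refine Finset.sum_congr (by congr) fun P hP => ?_
  obtain rfl := (Finset.mem_filter.1 hP).2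
  exact extend_twisted hEF hM hf hh P

end Twisted

/-! ### Comparison of the products of `H` with `N_S(H)` in `F` and in `N_F(H)`. -/

section Normalizer

variable {p : ℕ} [Fact p.Prime] {H : Subgroup S}

/-- A morphism of `N_F(H)` defined on a subgroup of `H` extends to `H` and then maps `H` onto
itself, so maximality forces the domain to be `H`. -/
theorem IsProductReps.eq_of_normalizerSystem
    {Y : Finset (OrbitPair (F.normalizerSystem H) H (Subgroup.normalizer (H : Set S)))}
    (hY : IsProductReps (F.normalizerSystem H) H (Subgroup.normalizer (H : Set S)) Y)
    {Q : OrbitPair (F.normalizerSystem H) H (Subgroup.normalizer (H : Set S))} (hQ : Q ∈ Y) :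
    Q.A = H ∧ Q.im = H := by
  obtain ⟨ψ, hψ, he, hψH, hψE⟩ := exists_extension_of_mor Q.mor
  have hle : Q.A ⊔ H = H := sup_eq_right.2 Q.le
  rw [hle] at hψE hψ
  have hA : Q.A = H := by
    refine le_antisymm Q.le ?_
    exact (hY.1 Q hQ).maxPair.max H ψ Q.le le_rfl hψE
      (Cj.of_eq fun c hc => he c hc)
  refine ⟨hA, ?_⟩
  rw [Q.im_eq, img_congr (α := ψ) fun a ha => (he a ha).symm, hA]
  exact (hψ.cod hψH le_top).of_isPGroup_card_le le_rfl

/-- A pair with image `H` is an automorphism of `H` in `F`, hence a morphism of `N_F(H)`. Both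
families therefore cover the spans from `H` with identity first leg and second leg onto `H`, and the
constant weight `1` compares their sizes. -/
theorem IsProductReps.card_filter_im_eq (hS : IsPGroup p S) (hF : F.IsSaturated p)
    (hHc : F.IsCentric H) (hHn : F.IsFullyNormalized H) [DecidableEq (Subgroup S)]
    {X : Finset (OrbitPair F H (Subgroup.normalizer (H : Set S)))}
    (hX : IsProductReps F H (Subgroup.normalizer (H : Set S)) X)
    {Y : Finset (OrbitPair (F.normalizerSystem H) H (Subgroup.normalizer (H : Set S)))}
    (hY : IsProductReps (F.normalizerSystem H) H (Subgroup.normalizer (H : Set S)) Y) :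
    (X.filter (fun P => P.im = H)).card = Y.card := by
  have hHN : H ≤ Subgroup.normalizer (H : Set S) := Subgroup.le_normalizer
  have hEF := normalizerSystem_sub F H
  have hHE := hEF.centric hHc hHN
  have hAX : ∀ P : OrbitPair F H (Subgroup.normalizer (H : Set S)), P.im = H → P.A = H :=
    fun P hP => Subgroup.eq_of_le_of_card_ge P.le (by rw [P.isIso_im.card_eq, hP])
  let Ok : Span S → Prop := fun x => x.C = H ∧ x.a = id ∧ x.b = (fun _ => 1) ∧
    F.Mor x.c x.C (Subgroup.normalizer (H : Set S)) ∧ img x.c x.C = H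
  have hOkX : ∀ P ∈ X.filter (fun P => P.im = H), Ok ⟨P.A, id, fun _ => 1, P.fn⟩ := fun P hP =>
    have him := (Finset.mem_filter.1 hP).2
    ⟨hAX P him, rfl, rfl, P.mor, P.im_eq.symm.trans him⟩
  have hOkY : ∀ Q ∈ Y, Ok ⟨Q.A, id, fun _ => 1, Q.fn⟩ := fun Q hQ =>
    have h := hY.eq_of_normalizerSystem hQ
    ⟨h.1, rfl, rfl, hEF _ _ _ Q.mor, Q.im_eq.symm.trans h.2⟩
  have key := sum_eq_sum_of_cover Ok
    (Span.Le F H ⊥ (Subgroup.normalizer (H : Set S)))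
    (fun x _ => Span.Le.refl le_top) (fun _ _ _ => Span.Le.trans)
    (s := X.filter fun P => P.im = H) (z := fun P => ⟨P.A, id, fun _ => 1, P.fn⟩)
    (t := Y) (z' := fun Q => ⟨Q.A, id, fun _ => 1, Q.fn⟩)
    (fun x P hP _ _ => hOkX P hP) (fun x Q hQ _ _ => hOkY Q hQ) ?_ ?_ (fun _ => 1)
    (fun _ _ _ _ _ _ => rfl) (fun P hP h => absurd (hOkX P hP) h)
    (fun Q hQ h => absurd (hOkY Q hQ) h)
  · simpa using key
  · rintro x ⟨hC, ha, hb, hc, him⟩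
    have hC' : F.IsCentric x.C := hC ▸ hHc
    refine existsUnique_of_exists_of_unique ?_ ?_
    · obtain ⟨P, hP, δ, hδ, h1, h2⟩ := hX.exists_factor hC' (F.mor_id hC.le le_top) hc
      have hA : img δ x.C = P.A := hδ.of_isPGroup_card_le (by
        rw [hC]
        exact Subgroup.card_le_of_le P.le)
      have hPim : P.im = H := by
        refine Subgroup.eq_of_le_of_card_ge ?_ ?_
        · rw [P.im_eq, ← hA, ← img_comp hδ]
          obtain ⟨k, hk, e⟩ := h2
          refine img_le fun y hy => ?_
          rw [e y hy]
          refine (mem_normalizer_iff_cj.1 hk _).2 ?_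
          rw [← him]
          exact mem_img_of_mem hy
        · rw [← P.isIso_im.card_eq, ← hA, hδ.card_img, hC]
      exact ⟨P, Finset.mem_filter.2 ⟨hP, hPim⟩, δ, hδ, by rw [ha]; exact h1,
        Cj.of_eq fun c _ => by rw [hb]; rfl, h2⟩
    · rintro P P' ⟨hP, δ, hδ, h1, -, h2⟩ ⟨hP', δ', hδ', h1', -, h2'⟩
      exact (hX.factor_unique hS (hF.good hS) le_top hC' (Finset.mem_filter.1 hP).1
        (Finset.mem_filter.1 hP').1 hδ hδ' (h1.symm.trans h1') (h2.symm.trans h2')).1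
  · rintro x ⟨hC, ha, hb, hc, him⟩
    have hC' : (F.normalizerSystem H).IsCentric x.C := hC ▸ hHE
    have hid : (F.normalizerSystem H).Mor id x.C H := FusionSystem.mor_id _ hC.le hHN
    refine existsUnique_of_exists_of_unique ?_ ?_
    · have hc' := mor_normalizerSystem hc hC.ge (hC.le.trans hHN) fun y hy => by
        have : x.c y ∈ img x.c x.C := mem_img_of_mem (hC.ge hy)
        rwa [him] at this
      obtain ⟨Q, hQ, δ, hδ, h1, h2⟩ := hY.exists_factor hC' hid hc'
      exact ⟨Q, hQ, δ, hEF _ _ _ hδ, by rw [ha]; exact h1,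
        Cj.of_eq fun c _ => by rw [hb]; rfl, h2⟩
    -- The first leg is the identity, so a factor is a conjugation by an element of `H` and belongs
    -- to `N_F(H)`.
    · have hδE : ∀ {Q : OrbitPair (F.normalizerSystem H) H (Subgroup.normalizer (H : Set S))}
          {δ : S → S}, F.Mor δ x.C Q.A → Cj H x.C x.a δ →
          (F.normalizerSystem H).Mor δ x.C Q.A := fun {Q δ} hδ h =>
        (h.mor (ha ▸ hid)).cod (fun y hy => hδ.mem hy) Q.centric.1
      rintro Q Q' ⟨hQ, δ, hδ, h1, -, h2⟩ ⟨hQ', δ', hδ', h1', -, h2'⟩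
      exact (hY.factor_unique hS (good_normalizerSystem hS hF hHc hHn) hHN hC' hQ hQ' (hδE hδ h1)
        (hδE hδ' h1') (h1.symm.trans h1') (h2.symm.trans h2')).1

/-- The decomposition of the restriction of a transfer, in terms of endomorphisms of `M`. -/
theorem trf_mul_proj_normalizer (hS : IsPGroup p S) (hF : F.IsSaturated p) (hHc : F.IsCentric H)
    (hHn : F.IsFullyNormalized H) (hR : IsPLocalRing p R) (hM : IsCentricMackeyFunctor R F M)
    [DecidableEq (Subgroup S)] {u : CentricBurnside R (F.normalizerSystem H)}
    (hu : IsBurnsideInverse (burnsideTop R (F.normalizerSystem H)) u)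
    {X : Finset (OrbitPair F H (Subgroup.normalizer (H : Set S)))}
    (hX : IsProductReps F H (Subgroup.normalizer (H : Set S)) X) {g : Module.End R M}
    (hg : MEnd F (FusionSystem.inner H) g) :
    trf F F H g * proj R F M (Subgroup.normalizer (H : Set S)) =
      trf F (F.normalizerSystem H) H g + ∑ P ∈ X.filter (fun P => ¬P.im = H),
        trf F (F.normalizerSystem H) P.im
          (bact F M (F.normalizerSystem H) u * cjEnd F P.fn P.A g) := by
  have hHN : H ≤ Subgroup.normalizer (H : Set S) := Subgroup.le_normalizer
  have hEF := normalizerSystem_sub F H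
  have hE := good_normalizerSystem hS hF hHc hHn
  have hY := isProductReps_productReps (F.normalizerSystem H) H (Subgroup.normalizer (H : Set S))
  have hub := mEnd_bact hS hE hEF hM u
  have hinv := bact_mul_trf hS hE hEF (star_normalizerSystem hS hF hHn _) hR hM hu
  have hD := trf_mEnd hS hE hEF hM hg hHN
  have hG := trf_mEnd hS (hF.good hS) (Sub.refl F) hM hg le_top
  -- An automorphism of `H` in `F` is an isomorphism of `N_F(H)`, and conjugation by such an
  -- isomorphism does not change the transfer.
  have hcj : ∀ {φ : S → S}, F.Mor φ H (Subgroup.normalizer (H : Set S)) → img φ H = H →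
      trf F (F.normalizerSystem H) H (cjEnd F φ H g) = trf F (F.normalizerSystem H) H g := by
    intro φ hφ him
    have hφH : ∀ x ∈ H, φ x ∈ H := fun x hx => him.le (mem_img_of_mem hx)
    exact trf_cjEnd hS hE hEF hM hg ((mor_normalizerSystem hφ le_rfl hHN hφH).cod hφH hHN) him
  -- The product formula is used twice with `K = N_S(H)`: here for the transfer to `F`, and in `h2`
  -- for the transfer to `N_F(H)`.
  have h1 := trf_proj_mul_trf hS hE (hF.good hS) hEF (Sub.refl F) hM hg le_top le_rfl hX
  have h2 := trf_proj_mul_trf hS hE hE (Sub.refl _) hEF hM hg hHN le_rfl hY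
  have h3 : ∑ Q ∈ productReps (F.normalizerSystem H) H (Subgroup.normalizer (H : Set S)),
      trf F (F.normalizerSystem H) Q.im (cjEnd F Q.fn Q.A g) =
      (productReps (F.normalizerSystem H) H (Subgroup.normalizer (H : Set S))).card •
        trf F (F.normalizerSystem H) H g := by
    rw [← Finset.sum_const]
    refine Finset.sum_congr rfl fun Q hQ => ?_
    obtain ⟨hA, him⟩ := hY.eq_of_normalizerSystem hQ
    rw [hA, him]
    have hm := Q.mor
    rw [hA] at hm
    have h := Q.im_eq
    rw [hA, him] at h
    exact hcj (hEF _ _ _ hm) h.symm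
  have h4 : ∑ P ∈ X.filter (fun P => P.im = H),
      trf F (F.normalizerSystem H) P.im (cjEnd F P.fn P.A g) =
      (productReps (F.normalizerSystem H) H (Subgroup.normalizer (H : Set S))).card •
        trf F (F.normalizerSystem H) H g := by
    rw [← hX.card_filter_im_eq hS hF hHc hHn hY, ← Finset.sum_const]
    refine Finset.sum_congr rfl fun P hP => ?_
    have him := (Finset.mem_filter.1 hP).2
    have hA : P.A = H :=
      Subgroup.eq_of_le_of_card_ge P.le (by rw [P.isIso_im.card_eq, him])
    rw [hA, him]
    have hm := P.mor
    rw [hA] at hm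
    have h := P.im_eq
    rw [hA, him] at h
    exact hcj hm h.symm
  -- By `h2` and `h3` the multiple is the class of `N_S(H)` applied to the transfer, and the inverse
  -- undoes it. The number of terms itself is never inverted.
  have h5 : bact F M (F.normalizerSystem H) u *
      ((productReps (F.normalizerSystem H) H (Subgroup.normalizer (H : Set S))).card •
        trf F (F.normalizerSystem H) H g) = trf F (F.normalizerSystem H) H g := by
    rw [← h3, ← h2, mul_assoc, hD.2, ← mul_assoc, hinv, hD.proj_mul]
  -- On the left the inverse cancels the class of `N_S(H)`; on the right the terms with image `H`
  -- collapse by `h5`.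
  have h6 := congrArg (bact F M (F.normalizerSystem H) u * ·) h1
  rw [← Finset.sum_filter_add_sum_filter_not X (fun P => P.im = H), h4, mul_add, h5, Finset.mul_sum,
    ← mul_assoc, ← mul_assoc, hinv, proj, hG.1 _ (idUpTo_mem _), ← proj, mul_assoc,
    (proj_mul_proj le_rfl).1] at h6
  rw [h6]
  refine congrArg _ (Finset.sum_congr rfl fun P _ => ?_)
  rw [trf_mul hub]

end Normalizer

end FusionMackey

/-! ### The main theorem. -/

open FusionMackey FusionMackey.FusionSystem in
theorem mainTheorem8 {p : ℕ} [Fact p.Prime]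
    {S : Type u} [Group S] [Finite S] (hS : IsPGroup p S)
    (F : FusionSystem (⊤ : Subgroup S)) (hF : F.IsSaturated p)
    (H : Subgroup S) (hHc : F.IsCentric H) (hHn : F.IsFullyNormalized H)
    {R : Type v} [CommRing R] (hR : IsPLocalRing p R)
    {M : Type w} [AddCommGroup M] [Module R M] [Module (MackeyAlgebra R F) M]
    [IsScalarTower R (MackeyAlgebra R F) M] [Module.Finite (MackeyAlgebra R F) M]
    (hM : IsCentricMackeyFunctor R F M) :
    (∃ u : CentricBurnside R (F.normalizerSystem H),
      IsBurnsideInverse (burnsideTop R (F.normalizerSystem H)) u) ∧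
    ∀ u : CentricBurnside R (F.normalizerSystem H),
      IsBurnsideInverse (burnsideTop R (F.normalizerSystem H)) u →
      IsMackeyEnd R F (F.normalizerSystem H) (burnsideAct R F M (F.normalizerSystem H) u) ∧
      ∀ X : Finset (OrbitPair F H (Subgroup.normalizer (H : Set S))),
        IsProductReps F H (Subgroup.normalizer (H : Set S)) X →
        ∀ f : Module.End R (down R F M H), IsMackeyEnd R F (inner H) f →
          IsMackeyEnd R F F (transfer R F F H f) ∧
          IsMackeyEnd R F (F.normalizerSystem H) (transfer R F (F.normalizerSystem H) H f) ∧
          (∀ K ∈ properSubconj F H,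
            IsMackeyEnd R F (inner K)
              (twistedConj R F X (burnsideAct R F M (F.normalizerSystem H) u) f K) ∧
            IsMackeyEnd R F (F.normalizerSystem H)
              (transfer R F (F.normalizerSystem H) K
                (twistedConj R F X (burnsideAct R F M (F.normalizerSystem H) u) f K))) ∧
          restrictEnd R F (Subgroup.normalizer (H : Set S)) (transfer R F F H f) =
            transfer R F (F.normalizerSystem H) H f +
              ∑ K ∈ properSubconj F H,
                transfer R F (F.normalizerSystem H) K
                  (twistedConj R F X (burnsideAct R F M (F.normalizerSystem H) u) f K) := by
  classical
  have hHN : H ≤ Subgroup.normalizer (H : Set S) := Subgroup.le_normalizer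
  have hEF := normalizerSystem_sub F H
  have hE := good_normalizerSystem hS hF hHc hHn
  have hstar := star_normalizerSystem hS hF hHn (Subgroup.normalizer (H : Set S))
  refine ⟨exists_isBurnsideInverse_top hS hE hstar hR, fun u hu => ?_⟩
  have hub : MEnd F (F.normalizerSystem H)
      (extend R F (burnsideAct R F M (F.normalizerSystem H) u)) := by
    rw [extend_burnsideAct hEF]
    exact mEnd_bact hS hE hEF hM u
  refine ⟨(isMackeyEnd_iff hEF).2 hub, fun X hX f hf => ?_⟩
  have hg := (isMackeyEnd_iff (inner_sub le_top)).1 hf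
  have hG := trf_mEnd hS (hF.good hS) (Sub.refl F) hM hg le_top
  have hK : ∀ K ∈ properSubconj F H, K ≤ Subgroup.normalizer (H : Set S) := fun K hK =>
    (Finset.mem_filter.1 hK).2.2.1
  have htw : ∀ K, MEnd F (FusionSystem.inner K) (extend R F
      (twistedConj R F X (burnsideAct R F M (F.normalizerSystem H) u) f K)) := by
    intro K
    rw [extend_twistedConj hEF hM hg hub]
    refine MEnd.sum fun P hP => ?_
    obtain rfl := (Finset.mem_filter.1 hP).2
    exact mEnd_mul_cjEnd hEF hg hub le_rfl P
  refine ⟨(isMackeyEnd_iff (Sub.refl F)).2 ?_, (isMackeyEnd_iff hEF).2 ?_, fun K hKY =>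
    ⟨(isMackeyEnd_iff (inner_sub le_top)).2 (htw K), (isMackeyEnd_iff hEF).2 ?_⟩,
    extend_injective (F := F) ?_⟩
  · rw [extend_transfer (Sub.refl F)]
    exact hG
  · rw [extend_transfer hEF]
    exact trf_mEnd hS hE hEF hM hg hHN
  · rw [extend_transfer hEF]
    exact trf_mEnd hS hE hEF hM (htw K) (hK K hKY)
  -- The transfer preserves the values at subgroups of `N_S(H)`, so the outer projection of the
  -- restriction can be dropped.
  · have h1 := (hG.restrict (E' := F.normalizerSystem H) hEF (Sub.refl F)).proj_mul
    rw [← mul_assoc] at h1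
    rw [extend_restrictEnd, extend_transfer (Sub.refl F), h1,
      trf_mul_proj_normalizer hS hF hHc hHn hR hM hu hX hg, extend_add, extend_transfer hEF,
      extend_sum]
    refine congrArg _ ?_
    -- Group the pairs by their image. Additivity of the transfer assembles `f_K` from the pairs
    -- with image `K`, and `K ≠ H` makes the filter on the image redundant.
    rw [← Finset.sum_fiberwise_of_maps_to (t := properSubconj F H) (g := OrbitPair.im)]
    · refine Finset.sum_congr rfl fun K hKY => ?_
      rw [extend_transfer hEF, extend_twistedConj hEF hM hg hub, trf_sum, extend_burnsideAct hEF,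
        Finset.filter_filter]
      have hne : K ≠ H := (Finset.mem_filter.1 hKY).2.2.2.2
      refine Finset.sum_congr (Finset.filter_congr fun P _ =>
        ⟨fun h => h.2, fun h => ⟨h ▸ hne, h⟩⟩) fun P hP => ?_
      rw [(Finset.mem_filter.1 hP).2]
    · intro P hP
      refine Finset.mem_filter.2 ⟨Finset.mem_univ _, ⟨P.A, P.le, P.isIso_im.symm⟩, P.im_le,
        P.centric.of_isIso P.isIso_im, (Finset.mem_filter.1 hP).2⟩
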